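/- **Setting.** Fix integers $J\ge1$ (clusters), $d_w,d_z\ge0$, $d_\phi\ge1$, and a nonempty compact $\Upsilon\subset(0,1)$. For each total sample size $n$, cluster $j\in[J]$ has $n_j$ units ($\sum_j n_j=n$) with data $D_{i,j}=(y_{i,j},X_{i,j},W_{i,j},Z_{i,j})\in\mathbb R\times\mathbb R\times\mathbb R^{d_w}\times\mathbb R^{d_z}$. Let $\Phi_{i,j}(\tau)\in\mathbb R^{d_\phi}$ and $V_{i,j}(\tau)\ge0$ be functions of $(W_{i,j},Z_{i,j},\tau)$ (possibly cluster-specific), with data-dependent estimates $\hat\Phi_{i,j}(\tau)$, $\hat V_{i,j}(\tau)\ge0$ that are (estimated) functions of the same variables. Put $\Psi=(W^\top,\Phi^\top)^\top$, $\hat\Psi=(W^\top,\hat\Phi^\top)^\top$, $\rho_\tau(u)=u(\tau-1\{u\le0\})$, $$f_\tau(D,b,r,t)=(\tau-1\{y-Xb-W^\top r-\Phi^\top(\tau)t\le0\})\Psi(\tau)V(\tau),$$ and $\hat f_\tau$ the same with hats; $\mathbb P_n,\mathbb P_{n,j}$ are averages over the whole sample and over cluster $j$, and $\overline{\mathbb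 P}_n,\overline{\mathbb P}_{n,j}$ the corresponding averages of expectations (estimated functions being held fixed under the expectation). Let $\beta_n(\tau)=\beta_0(\tau)+\mu_\beta(\tau)/r_n$, $\gamma_n(\tau)=\gamma_0(\tau)+\mu_\gamma(\tau)/r_n$, where $0<r_n\to\infty$, and $\varepsilon_{i,j}(\tau)=y_{i,j}-X_{i,j}\beta_n(\tau)-W_{i,j}^\top\gamma_n(\tau)$. All expectations below are assumed to exist; probabilities of possibly non-measurable events are outer probabilities. **Estimators and tests.** $(\hat\gamma(b,\tau),\hat\theta(b,\tau))$ is any minimizer over $(r,t)$ of $\hat L(r,t)=\sum_j\sum_i\rho_\tau(y_{i,j}-X_{i,j}b-W_{i,j}^\top r-\hat\Phi_{i,j}^\top(\tau)t)\hat V_{i,j}(\tau)$; $\hat\gamma^r(\tau)=\hat\gamma(\beta_0(\tau),\tau)$; $\hat S_j(\tau)=\sum_{i}\hat f_\tau(D_{i,j},\beta_0(\tau),\hat\gamma^r(\tau),0)$. For $g\in\mathbf G=\{-1,1\}^J$, $(\hat\gamma_g^*(b,\tau),\hat\theta_g^*(b,\tau))$ is any minimizer (arbitrary if none exists) of $\hat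 L(r,t)-\sum_jg_j\hat S_j(\tau)^\top(r^\top,t^\top)^\top$. With $\|u\|_A=(u^\top Au)^{1/2}$ and a weight $\hat A(\tau)$, the statistic is $\sup_{\tau\in\Upsilon}\|\hat\theta(\beta_0(\tau),\tau)\|_{\hat A(\tau)}$, its bootstrap versions are $\sup_{\tau\in\Upsilon}\|\hat\theta^*_g(\beta_0(\tau),\tau)-\hat\theta(\beta_0(\tau),\tau)\|_{\hat A(\tau)}$, $g\in\mathbf G$, and the test rejects if the statistic exceeds the $(1-\alpha)$-quantile of the $2^J$ bootstrap values, $\alpha\in(0,1)$. $AR_n$ and $\hat c_{AR,n}(1-\alpha)$ are the statistic and the quantile for $\hat A=\hat A_3$; $AR_{CR,n}$ and $\hat c_{AR,CR,n}(1-\alpha)$ those for $\hat A(\tau)=\tilde A_{CR}(\tau)=[\hat H(\tau)\tilde\Omega(\tau,\tau)\hat H(\tau)]^{-1}$, where $\tilde\Omega(\tau,\tau)=n^{-1}\sum_j\omega\hat S_j(\tau)\hat S_j(\tau)^\top\omega^\top$, $\omega=(0,\mathbb I_{d_\phi})$, and $\hat H(\tau)$ is symmetric. **Assumption 1.** (i)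 $\mathbb P(y_{i,j}\le X_{i,j}\beta_n(\tau)+W_{i,j}^\top\gamma_n(\tau)\mid W_{i,j},Z_{i,j})=\tau$ for $\tau\in\Upsilon$. (ii) $\mu_\gamma,\mu_\beta,\beta_0,\gamma_0$ are bounded on $\Upsilon$. (iii) $\beta_n(\tau)\in\mathrm{int}(\mathcal B)$, $\mathcal B$ compact and convex. (iv) The conditional density of $y_{i,j}$ given $(W_{i,j},X_{i,j},Z_{i,j})$ is bounded by a constant. (v) There are compact $\mathcal R\subset\mathbb R^{d_w}$, $\Theta\subset\mathbb R^{d_\phi}$ such that the Jacobian in $(r,t)$ of $\Pi(b,r,t,\tau)=\overline{\mathbb P}_nf_\tau(D,b,r,t)$ exists, is continuous, and has full column rank uniformly in large $n$ and over $\mathcal B\times\mathcal R\times\Theta\times\Upsilon$. (vi) $\sup\mathbb E\|\Psi_{i,j}(\tau)\|^{2+a}<\infty$ for some $a>0$. **Assumption 2.** (i) $\mathcal Q_n(b,r,t,\tau)=\overline{\mathbb P}_n\rho_\tau(y-Xb-W^\top r-\Phi^\top(\tau)t)V(\tau)$ (for large $n$) and its limit $\mathcal Q_\infty$ have unique minimizers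 in $(r,t)$ for $b\in\mathcal B,\tau\in\Upsilon$, continuous in $b$ uniformly over $\tau$, that of $\mathcal Q_n$ lying in $\mathrm{int}(\mathcal R\times\Theta)$; for each $(r,t)$, $\sup_{b,\tau}|\mathcal Q_\infty-\mathcal Q_n|=o(1)$ and $\sup_{b,\tau}|n^{-1}\hat L-\mathcal Q_n|=o_p(1)$. (ii) For every $\varepsilon>0$, $\lim_{\delta\to0}\limsup_n\mathbb P(\sup\|r_n(\mathbb P_{n,j}-\overline{\mathbb P}_{n,j})(\hat f_\tau(D,\beta_n(\tau)+v_b,\gamma_n(\tau)+v_r,v_t)-f_\tau(D,\beta_n(\tau),\gamma_n(\tau),0))\|_2\ge\varepsilon)=0$, the supremum being over $j\in[J]$, $\tau\in\Upsilon$ and $v=(v_b,v_r,v_t)$ with $\|v\|_2\le\delta$. (iii) With $f_{\varepsilon_{i,j}(\tau)}(\cdot\mid W,Z)$ a conditional density of $\varepsilon_{i,j}(\tau)$, $\delta_{i,j}(v,\tau)=X_{i,j}v_b+W_{i,j}^\top v_r+\hat\Phi_{i,j}^\top(\tau)v_t$, the limits $Q_{\Psi,\Psi,j}(\tau)=\lim\overline{\mathbb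 P}_{n,j}f_{\varepsilon(\tau)}(0|W,Z)\Psi\Psi^\top V$ and $Q_{\Psi,X,j}(\tau)=\lim\overline{\mathbb P}_{n,j}f_{\varepsilon(\tau)}(0|W,Z)\Psi XV$ exist, and $\overline{\mathbb P}_{n,j}f_{\varepsilon(\tau)}(\delta(v,\tau)|W,Z)\hat\Psi\hat\Psi^\top\hat V$ and $\overline{\mathbb P}_{n,j}f_{\varepsilon(\tau)}(\delta(v,\tau)|W,Z)\hat\Psi X\hat V$ converge to them in the same locally uniform sense as in (ii). (iv) $\sup_\tau r_n\|\mathbb P_{n,j}f_\tau(D,\beta_n(\tau),\gamma_n(\tau),0)\|_2=O_p(1)$ for each $j$, and $r_n=O(\sqrt n)$. (v) $J$ is fixed and $n_j/n\to\xi_j>0$. (vi) The eigenvalues of $\sum_j\xi_jQ_{\Psi,\Psi,j}(\tau)$ are bounded, and bounded away from $0$, uniformly over $\Upsilon$. **Assumption 3.** (i) The $W$–$\Phi$ block of $Q_{\Psi,\Psi,j}(\tau)$ is $0$ for all $j,\tau$. (ii) There are tight centered Gaussian processes $\mathcal Z_j$ on $\Upsilon$ with values in $\mathbb R^{d_\phi}$,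 independent across $j$, such that the eigenvalues of $\mathbb E\mathcal Z_j(\tau)\mathcal Z_j(\tau)^\top$ are bounded and bounded away from $0$ uniformly in $j,\tau$, and $\sup_{j,\tau}\|r_n\mathbb P_{n,j}(\tau-1\{\varepsilon_{i,j}(\tau)\le0\})\Phi_{i,j}(\tau)V_{i,j}(\tau)-\mathcal Z_j(\tau)\|_2\to0$ in probability. **Assumption 7.** Either (i) $\sup_\tau\|\hat A_3(\tau)-A_3(\tau)\|_{op}=o_p(1)$ for deterministic symmetric $A_3(\tau)$ with eigenvalues bounded and bounded away from $0$; or (ii) the weight is $\tilde A_{CR}$, $\sup_\tau\|\hat H(\tau)-H(\tau)\|_{op}=o_p(1)$ for a deterministic $H$ with the eigenvalues of $H^\top(\tau)H(\tau)$ bounded and bounded away from $0$, and $J>d_\phi$. **Non-degeneracy across quantiles** (void if $\Upsilon$ is a single point). Let $Q_{\Phi,\Phi}(\tau)$ be the $\Phi$–$\Phi$ block of $\sum_j\xi_jQ_{\Psi,\Psi,j}(\tau)$, $M(\tau)=\sum_j\xi_j^2\mathcal Z_j(\tau)\mathcal Z_j(\tau)^\top$ and $L_A(g)=\sup_{\tau\in\Upsilon}\|Q_{\Phi,\Phi}^{-1}(\tau)\sum_j\xi_jg_j\mathcal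 Z_j(\tau)\|_{A(\tau)}$. If $\Upsilon$ has more than one point, assume that almost surely $L_A(g)\ne L_A(g')$ whenever $g'\notin\{g,-g\}$, where $A=A_3$ in case (i) and $A=[HMH]^{-1}$ in case (ii); if moreover $\Upsilon$ is infinite, assume in case (ii) that almost surely $\inf_{\tau\in\Upsilon}\lambda_{\min}(M(\tau))>0$. **Theorem.** Suppose Assumptions 1–3 hold and $\beta_n(\tau)=\beta_0(\tau)$ for all $n$ and $\tau\in\Upsilon$ (no identification of $\beta_n$ is assumed in any cluster). Under Assumption 7(i) and the non-degeneracy condition for it, $$\alpha-\frac1{2^{J-1}}\le\liminf_{n\to\infty}\mathbb P(AR_n>\hat c_{AR,n}(1-\alpha))\le\limsup_{n\to\infty}\mathbb P(AR_n>\hat c_{AR,n}(1-\alpha))\le\alpha+\frac1{2^{J-1}},$$ and under Assumption 7(ii) and the non-degeneracy condition for it, $$\alpha-\frac1{2^{J-1}}\le\liminf_{n\to\infty}\mathbb P(AR_{CR,n}>\hat c_{AR,CR,n}(1-\alpha))\le\limsup_{n\to\infty}\mathbb P(AR_{CR,n}>\hat c_{AR,CR,n}(1-\alpha))\le\alpha+\frac1{2^{J-1}}.$$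 -/

import Mathlib

open MeasureTheory ProbabilityTheory Filter Topology Set
open scoped ENNReal UniformConvergence Matrix.Norms.L2Operator

noncomputable section

/-! ### Vectors, observations and elementary functions -/

/-- Column vectors with the Euclidean norm. -/
abbrev Vec (d : ℕ) := EuclideanSpace ℝ (Fin d)

/-- Stacked vectors `(r, t)`, with `r` of dimension `dw` and `t` of dimension `dφ`. -/
abbrev StackVec (dw dφ : ℕ) := EuclideanSpace ℝ (Fin dw ⊕ Fin dφ)

/-- The stacked vector `(r, t)`. -/
def stack {dw dφ : ℕ} (r : Vec dw) (t : Vec dφ) : StackVec dw dφ :=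
  WithLp.toLp 2 (Sum.elim (fun a => r a) (fun a => t a))

/-- The block `r` of `(r, t)`. -/
def upper {dw dφ : ℕ} (π : StackVec dw dφ) : Vec dw := WithLp.toLp 2 (fun a => π (Sum.inl a))

/-- The block `t` of `(r, t)`, that is, multiplication by `ω = (0, I)`. -/
def lower {dw dφ : ℕ} (π : StackVec dw dφ) : Vec dφ := WithLp.toLp 2 (fun a => π (Sum.inr a))

/-- The set `R × T`, inside the space of stacked vectors. -/
def box {dw dφ : ℕ} (R : Set (Vec dw)) (T : Set (Vec dφ)) : Set (StackVec dw dφ) :=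
  {π | upper π ∈ R ∧ lower π ∈ T}

/-- An observation `(y, X, W, Z)`. -/
abbrev Obs (dw dz : ℕ) := ℝ × ℝ × Vec dw × Vec dz

namespace Obs
variable {dw dz : ℕ}
/-- outcome -/
def y (d : Obs dw dz) : ℝ := d.1
/-- endogenous regressor -/
def x (d : Obs dw dz) : ℝ := d.2.1
/-- exogenous regressors (controls) -/
def w (d : Obs dw dz) : Vec dw := d.2.2.1
/-- excluded exogenous variables -/
def z (d : Obs dw dz) : Vec dz := d.2.2.2
end Obs

/-- An instrument function `(W, Z, τ) ↦ Φ(W, Z, τ)`; it may differ between clusters. -/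
abbrev InstrFun (J dw dz dφ : ℕ) (Υ : Set ℝ) := Fin J → Υ → Vec dw → Vec dz → Vec dφ

/-- A weight function `(W, Z, τ) ↦ V(W, Z, τ)`; it may differ between clusters. -/
abbrev WeightFun (J dw dz : ℕ) (Υ : Set ℝ) := Fin J → Υ → Vec dw → Vec dz → ℝ

/-- The check function `ρ_τ(u) = u (τ - 1{u ≤ 0})`. -/
def checkFun (τ u : ℝ) : ℝ := u * (τ - if u ≤ 0 then 1 else 0)

section Score
variable {J dw dz dφ : ℕ} {Υ : Set ℝ}

/-- `Ψ = (W, Φ(τ))`. -/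
def regressor (φ : InstrFun J dw dz dφ Υ) (j : Fin J) (τ : Υ) (d : Obs dw dz) : StackVec dw dφ :=
  stack d.w (φ j τ d.w d.z)

/-- The residual `y - X b - Wᵀ r - Φ(τ)ᵀ t`, where `π = (r, t)`. -/
def resid (φ : InstrFun J dw dz dφ Υ) (j : Fin J) (τ : Υ) (d : Obs dw dz) (b : ℝ)
    (π : StackVec dw dφ) : ℝ :=
  d.y - d.x * b - inner ℝ (regressor φ j τ d) π

/-- The score `f_τ(D, b, r, t) = (τ - 1{y - X b - Wᵀ r - Φ(τ)ᵀ t ≤ 0}) Ψ(τ) V(τ)`. -/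
def score (φ : InstrFun J dw dz dφ Υ) (v : WeightFun J dw dz Υ) (j : Fin J) (τ : Υ)
    (d : Obs dw dz) (b : ℝ) (π : StackVec dw dφ) : StackVec dw dφ :=
  (((τ : ℝ) - if resid φ j τ d b π ≤ 0 then 1 else 0) * v j τ d.w d.z) • regressor φ j τ d

/-- The weighted check loss `ρ_τ(y - X b - Wᵀ r - Φ(τ)ᵀ t) V(τ)`. -/
def loss (φ : InstrFun J dw dz dφ Υ) (v : WeightFun J dw dz Υ) (j : Fin J) (τ : Υ)
    (d : Obs dw dz) (b : ℝ) (π : StackVec dw dφ) : ℝ :=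
  checkFun τ (resid φ j τ d b π) * v j τ d.w d.z

end Score

/-! ### Probabilistic notions

Probabilities of events that need not be measurable are outer probabilities. -/

section Probability
variable {Ω : Type*} [MeasurableSpace Ω]

/-- `sup_i f n i = O_p(1)`. -/
def UnifBigOp (μ : Measure Ω) {ι : Type*} (f : ℕ → ι → Ω → ℝ) : Prop :=
  ∀ ε : ℝ≥0∞, 0 < ε → ∃ M : ℝ, ∀ᶠ n in atTop, μ {ω | ∃ i, M < f n i ω} ≤ ε

/-- `sup_i f n i = o_p(1)`. -/
def UnifLittleOp (μ : Measure Ω) {ι : Type*} (f : ℕ → ι → Ω → ℝ) : Prop :=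
  ∀ ε : ℝ, 0 < ε → Tendsto (fun n => μ {ω | ∃ i, ε < f n i ω}) atTop (𝓝 0)

/-- `f (· | u)` is a version of the conditional (Lebesgue) density of `Y` given `U = u`. -/
structure IsCondDensity (μ : Measure Ω) {T : Type*} [MeasurableSpace T] (Y : Ω → ℝ) (U : Ω → T)
    (f : ℝ → T → ℝ) : Prop where
  measurable : Measurable (Function.uncurry f)
  nonneg : ∀ e u, 0 ≤ f e u
  law : μ.map (fun ω => (Y ω, U ω)) =
    ((volume : Measure ℝ).prod (μ.map U)).withDensity (fun p => ENNReal.ofReal (f p.1 p.2))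

/-- `Z` is a tight random element of the space of bounded functions with the sup norm. -/
def IsTightProcess (μ : Measure Ω) {ι E : Type*} [NormedAddCommGroup E] (Z : ι → Ω → E) : Prop :=
  ∀ ε : ℝ≥0∞, 0 < ε → ∃ K : Set (ι →ᵤ E), IsCompact K ∧
    (∀ f ∈ K, Bornology.IsBounded (range (UniformFun.toFun f))) ∧
    μ {ω | UniformFun.ofFun (fun i => Z i ω) ∉ K} ≤ ε

end Probability

/-! ### Matrices, weighted norms, signs and quantiles -/

/-- Every Rayleigh quotient of `A` lies in `[c, C]`; for symmetric `A` this says that all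
eigenvalues lie in `[c, C]`. -/
def RayleighBounds {k : Type*} [Fintype k] (c C : ℝ) (A : Matrix k k ℝ) : Prop :=
  ∀ x : k → ℝ, c * (x ⬝ᵥ x) ≤ x ⬝ᵥ A.mulVec x ∧ x ⬝ᵥ A.mulVec x ≤ C * (x ⬝ᵥ x)

/-- `A x` as a Euclidean vector. -/
def matApply {d : ℕ} (A : Matrix (Fin d) (Fin d) ℝ) (x : Vec d) : Vec d :=
  WithLp.toLp 2 (A.mulVec (fun a => x a))

/-- `x xᵀ`. -/
def outerProd {k : Type*} (x : EuclideanSpace ℝ k) : Matrix k k ℝ :=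
  Matrix.vecMulVec (fun a => x a) (fun a => x a)

/-- `‖u‖_A = (uᵀ A u)^{1/2}`. -/
def wnorm {d : ℕ} (A : Matrix (Fin d) (Fin d) ℝ) (u : Vec d) : ℝ :=
  Real.sqrt ((fun a => u a) ⬝ᵥ A.mulVec (fun a => u a))

/-- `sup_τ ‖u(τ)‖_{A(τ)}`, with value `∞` if unbounded. -/
def supNorm {Υ : Set ℝ} {d : ℕ} (A : Υ → Matrix (Fin d) (Fin d) ℝ) (u : Υ → Vec d) : ℝ≥0∞ :=
  ⨆ τ : Υ, ENNReal.ofReal (wnorm (A τ) (u τ))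

/-- The group `{-1, 1}^J` of sign changes. -/
abbrev Signs (J : ℕ) := Fin J → ℤˣ

/-- The sign `g_j` as a real number. -/
def sgn {J : ℕ} (g : Signs J) (j : Fin J) : ℝ := ((g j : ℤ) : ℝ)

/-- The `p`-quantile of the finite family `(T g)`: the smallest `x` such that at least a
fraction `p` of the values is at most `x`. -/
def finQuantile {G : Type*} [Fintype G] (p : ℝ) (T : G → ℝ≥0∞) : ℝ≥0∞ :=
  sInf {x | p * (Fintype.card G : ℝ) ≤ ((Finset.univ.filter (fun g => T g ≤ x)).card : ℝ)}

/-- `x` minimizes `F` whenever `F` has a minimizer (an arbitrary choice of `arg inf F`). -/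
def IsArgInf {E : Type*} (F : E → ℝ) (x : E) : Prop :=
  (∃ x', ∀ z, F x' ≤ F z) → ∀ z, F x ≤ F z

/-! ### The clustered instrumental variable quantile regression model -/

/-- The ingredients of the model; `n` is the total sample size. -/
structure IVQR (Ω : Type*) (J dw dz dφ : ℕ) (Υ : Set ℝ) where
  /-- size `n_j` of cluster `j` -/
  size : ℕ → Fin J → ℕ
  /-- the observation of unit `i` of cluster `j` (the units of cluster `j` are `i < n_j`) -/
  obs : ℕ → Fin J → ℕ → Ω → Obs dw dz
  /-- instrument function -/
  Φ : InstrFun J dw dz dφ Υ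
  /-- weight function -/
  V : WeightFun J dw dz Υ
  /-- estimated instrument function -/
  Φhat : ℕ → Ω → InstrFun J dw dz dφ Υ
  /-- estimated weight function -/
  Vhat : ℕ → Ω → WeightFun J dw dz Υ
  /-- hypothesized structural parameter -/
  β₀ : Υ → ℝ
  /-- local parameter of the endogenous regressor -/
  μβ : Υ → ℝ
  /-- limit of the control coefficients -/
  γ₀ : Υ → Vec dw
  /-- local parameter of the controls -/
  μγ : Υ → Vec dw
  /-- convergence rate of the score -/
  r : ℕ → ℝ

namespace IVQR

variable {Ω : Type*} {J dw dz dφ : ℕ} {Υ : Set ℝ} (M : IVQR Ω J dw dz dφ Υ)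

/-- `β_n(τ) = β_0(τ) + μ_β(τ) / r_n`. -/
def βn (n : ℕ) (τ : Υ) : ℝ := M.β₀ τ + M.μβ τ / M.r n

/-- `γ_n(τ) = γ_0(τ) + μ_γ(τ) / r_n`. -/
def γn (n : ℕ) (τ : Υ) : Vec dw := M.γ₀ τ + (M.r n)⁻¹ • M.μγ τ

/-- The error `ε_{i,j}(τ) = y - X β_n(τ) - Wᵀ γ_n(τ)`. -/
def err (n : ℕ) (j : Fin J) (i : ℕ) (τ : Υ) (ω : Ω) : ℝ :=
  (M.obs n j i ω).y - (M.obs n j i ω).x * M.βn n τ - inner ℝ (M.obs n j i ω).w (M.γn n τ)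

/-- `(W_{i,j}, Z_{i,j})`. -/
def exog (n : ℕ) (j : Fin J) (i : ℕ) (ω : Ω) : Vec dw × Vec dz :=
  ((M.obs n j i ω).w, (M.obs n j i ω).z)

/-- `ℙ_{n,j} h(D_{i,j})`. -/
def avg {E : Type*} [AddCommGroup E] [Module ℝ E] (n : ℕ) (j : Fin J) (h : Obs dw dz → E)
    (ω : Ω) : E :=
  ((M.size n j : ℝ)⁻¹) • ∑ i ∈ Finset.range (M.size n j), h (M.obs n j i ω)

/-! #### Estimators and test statistics -/

/-- The quantile regression objective `∑_j ∑_i ρ_τ(y - X b - Wᵀ r - Φ̂ᵀ t) V̂`, `π = (r, t)`. -/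
def objective (n : ℕ) (ω : Ω) (b : ℝ) (τ : Υ) (π : StackVec dw dφ) : ℝ :=
  ∑ j, ∑ i ∈ Finset.range (M.size n j),
    loss (M.Φhat n ω) (M.Vhat n ω) j τ (M.obs n j i ω) b π

/-- `est n ω b τ = (γ̂(b, τ), θ̂(b, τ))` is a minimizer of the objective. -/
def IsEstimator (est : ℕ → Ω → ℝ → Υ → StackVec dw dφ) : Prop :=
  ∀ n ω b τ, IsArgInf (M.objective n ω b τ) (est n ω b τ)

/-- The cluster sum of null-restricted scores
`∑_i f̂_τ(D_{i,j}, β_0(τ), γ̂^r(τ), 0)`, where `γ̂^r(τ) = γ̂(β_0(τ), τ)`. -/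
def nullScore (est : ℕ → Ω → ℝ → Υ → StackVec dw dφ) (n : ℕ) (ω : Ω) (j : Fin J) (τ : Υ) :
    StackVec dw dφ :=
  ∑ i ∈ Finset.range (M.size n j),
    score (M.Φhat n ω) (M.Vhat n ω) j τ (M.obs n j i ω) (M.β₀ τ)
      (stack (upper (est n ω (M.β₀ τ) τ)) 0)

/-- The gradient wild bootstrap objective. -/
def bootObjective (est : ℕ → Ω → ℝ → Υ → StackVec dw dφ) (n : ℕ) (ω : Ω) (g : Signs J) (b : ℝ)
    (τ : Υ) (π : StackVec dw dφ) : ℝ :=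
  M.objective n ω b τ π - ∑ j, sgn g j * inner ℝ (M.nullScore est n ω j τ) π

/-- `boot n ω g b τ = (γ̂*_g(b, τ), θ̂*_g(b, τ))` is a minimizer of the bootstrap objective
(whenever that objective, which can be unbounded below, has a minimizer). -/
def IsBootEstimator (est : ℕ → Ω → ℝ → Υ → StackVec dw dφ)
    (boot : ℕ → Ω → Signs J → ℝ → Υ → StackVec dw dφ) : Prop :=
  ∀ n ω g b τ, IsArgInf (M.bootObjective est n ω g b τ) (boot n ω g b τ)

/-- The test statistic `sup_τ ‖θ̂(β_0(τ), τ)‖_{A(τ)}`. -/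
def AR (est : ℕ → Ω → ℝ → Υ → StackVec dw dφ)
    (A : ℕ → Ω → Υ → Matrix (Fin dφ) (Fin dφ) ℝ) (n : ℕ) (ω : Ω) : ℝ≥0∞ :=
  supNorm (A n ω) (fun τ => lower (est n ω (M.β₀ τ) τ))

/-- The bootstrap statistic `sup_τ ‖θ̂*_g(β_0(τ), τ) - θ̂(β_0(τ), τ)‖_{A(τ)}`. -/
def ARboot (est : ℕ → Ω → ℝ → Υ → StackVec dw dφ)
    (boot : ℕ → Ω → Signs J → ℝ → Υ → StackVec dw dφ)
    (A : ℕ → Ω → Υ → Matrix (Fin dφ) (Fin dφ) ℝ) (n : ℕ) (ω : Ω) (g : Signs J) : ℝ≥0∞ :=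
  supNorm (A n ω) (fun τ => lower (boot n ω g (M.β₀ τ) τ) - lower (est n ω (M.β₀ τ) τ))

/-- The event that the test rejects: the statistic exceeds the `1 - α` quantile of the
bootstrap statistics. -/
def rejects (est : ℕ → Ω → ℝ → Υ → StackVec dw dφ)
    (boot : ℕ → Ω → Signs J → ℝ → Υ → StackVec dw dφ)
    (A : ℕ → Ω → Υ → Matrix (Fin dφ) (Fin dφ) ℝ) (α : ℝ) (n : ℕ) : Set Ω :=
  {ω | finQuantile (1 - α) (M.ARboot est boot A n ω) < M.AR est A n ω}

/-- `Ω̃(τ, τ) = n⁻¹ ∑_j (ω ∑_i f̂_τ) (ω ∑_i f̂_τ)ᵀ`, with null-restricted scores. -/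
def nullCRVE (est : ℕ → Ω → ℝ → Υ → StackVec dw dφ) (n : ℕ) (ω : Ω) (τ : Υ) :
    Matrix (Fin dφ) (Fin dφ) ℝ :=
  ((n : ℝ)⁻¹) • ∑ j, outerProd (lower (M.nullScore est n ω j τ))

/-- The weight `Ã_CR(τ) = [Ĥ(τ) Ω̃(τ, τ) Ĥ(τ)]⁻¹`. -/
def weightCR (est : ℕ → Ω → ℝ → Υ → StackVec dw dφ)
    (Hhat : ℕ → Ω → Υ → Matrix (Fin dφ) (Fin dφ) ℝ) (n : ℕ) (ω : Ω) (τ : Υ) :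
    Matrix (Fin dφ) (Fin dφ) ℝ :=
  (Hhat n ω τ * M.nullCRVE est n ω τ * Hhat n ω τ)⁻¹

/-! #### Assumptions -/

variable [MeasurableSpace Ω]

/-- `ℙ̄_{n,j} h(D_{i,j})`; the expectation is over the data only, a random `h` is frozen. -/
def popAvg {E : Type*} [NormedAddCommGroup E] [NormedSpace ℝ E] (μ : Measure Ω) (n : ℕ)
    (j : Fin J) (h : Obs dw dz → E) : E :=
  ((M.size n j : ℝ)⁻¹) • ∑ i ∈ Finset.range (M.size n j), ∫ ω, h (M.obs n j i ω) ∂μ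

/-- The expectations in `ℙ̄_{n,j} h(D_{i,j})` exist. -/
def PopInt {E : Type*} [NormedAddCommGroup E] (μ : Measure Ω) (n : ℕ) (j : Fin J)
    (h : Obs dw dz → E) : Prop :=
  ∀ i < M.size n j, Integrable (fun ω => h (M.obs n j i ω)) μ

/-- `Π(b, r, t, τ) = ℙ̄_n f_τ(D, b, r, t)`, `π = (r, t)`. -/
def popScore (μ : Measure Ω) (n : ℕ) (b : ℝ) (τ : Υ) (π : StackVec dw dφ) : StackVec dw dφ :=
  ((n : ℝ)⁻¹) • ∑ j, ∑ i ∈ Finset.range (M.size n j),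
    ∫ ω, score M.Φ M.V j τ (M.obs n j i ω) b π ∂μ

/-- `Q_n(b, r, t, τ)`, `π = (r, t)`. -/
def popObjective (μ : Measure Ω) (n : ℕ) (b : ℝ) (τ : Υ) (π : StackVec dw dφ) : ℝ :=
  ((n : ℝ)⁻¹) * ∑ j, ∑ i ∈ Finset.range (M.size n j),
    ∫ ω, loss M.Φ M.V j τ (M.obs n j i ω) b π ∂μ

/-- The standing conventions of the set-up. -/
structure Setup (μ : Measure Ω) : Prop where
  nonempty : Υ.Nonempty
  compact : IsCompact Υ
  subset : Υ ⊆ Ioo 0 1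
  total : ∀ n, ∑ j, M.size n j = n
  measurable_obs : ∀ n j i, Measurable (M.obs n j i)
  measurable_Φ : ∀ j τ, Measurable (Function.uncurry (M.Φ j τ))
  measurable_V : ∀ j τ, Measurable (Function.uncurry (M.V j τ))
  measurable_Φhat : ∀ n ω j τ, Measurable (Function.uncurry (M.Φhat n ω j τ))
  measurable_Vhat : ∀ n ω j τ, Measurable (Function.uncurry (M.Vhat n ω j τ))
  V_nonneg : ∀ j τ w z, 0 ≤ M.V j τ w z
  Vhat_nonneg : ∀ n ω j τ w z, 0 ≤ M.Vhat n ω j τ w z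
  r_pos : ∀ n, 0 < M.r n
  r_tendsto : Tendsto M.r atTop atTop
  /-- the mean scores are well defined -/
  integrable_score : ∀ n j b τ π, M.PopInt μ n j (fun d => score M.Φ M.V j τ d b π)

/-- The moment condition, the local parameters, and the regularity of the population score,
without any identification of the structural parameter. -/
structure ModelAssumption (μ : Measure Ω) (𝓑 : Set ℝ) (𝓡 : Set (Vec dw)) (𝓣 : Set (Vec dφ)) :
    Prop where
  /-- `P(y ≤ X β_n(τ) + Wᵀ γ_n(τ) | W, Z) = τ` -/
  quantile : ∀ n j, ∀ i < M.size n j, ∀ τ : Υ,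
    μ[{ω | (M.obs n j i ω).y ≤ (M.obs n j i ω).x * M.βn n τ
          + inner ℝ (M.obs n j i ω).w (M.γn n τ)}.indicator (fun _ => (1 : ℝ)) |
        MeasurableSpace.comap (M.exog n j i) inferInstance] =ᵐ[μ] fun _ => (τ : ℝ)
  bounded : ∃ C : ℝ, ∀ τ, ‖M.μγ τ‖ + |M.μβ τ| + |M.β₀ τ| + ‖M.γ₀ τ‖ ≤ C
  compact_B : IsCompact 𝓑
  convex_B : Convex ℝ 𝓑
  interior_B : ∀ n τ, M.βn n τ ∈ interior 𝓑
  /-- the conditional density of `y` given `(W, X, Z)` is bounded by a constant -/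
  density : ∃ C : ℝ, ∀ n j, ∀ i < M.size n j, ∃ f : ℝ → (Vec dw × ℝ × Vec dz) → ℝ,
    IsCondDensity μ (fun ω => (M.obs n j i ω).y)
      (fun ω => ((M.obs n j i ω).w, (M.obs n j i ω).x, (M.obs n j i ω).z)) f ∧
    ∀ e u, f e u < C
  compact_R : IsCompact 𝓡
  compact_T : IsCompact 𝓣
  /-- the Jacobian of `Π(b, r, t, τ)` with respect to `(r, t)` exists and is continuous -/
  jacobian : ∀ᶠ n in atTop,
    (∀ b ∈ 𝓑, ∀ τ, ∀ π ∈ box 𝓡 𝓣, DifferentiableAt ℝ (M.popScore μ n b τ) π) ∧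
    ContinuousOn (fun p : ℝ × Υ × StackVec dw dφ => fderiv ℝ (M.popScore μ n p.1 p.2.1) p.2.2)
      {p | p.1 ∈ 𝓑 ∧ p.2.2 ∈ box 𝓡 𝓣}
  /-- the Jacobian has full column rank, uniformly in `n` and over the parameters -/
  full_rank : ∃ c : ℝ, 0 < c ∧ ∀ᶠ n in atTop, ∀ b ∈ 𝓑, ∀ τ, ∀ π ∈ box 𝓡 𝓣,
    ∀ v : StackVec dw dφ, c * ‖v‖ ^ 2 ≤ ‖fderiv ℝ (M.popScore μ n b τ) π v‖ ^ 2
  moment : ∃ a : ℝ, 0 < a ∧ ∃ C : ℝ, ∀ n j, ∀ i < M.size n j, ∀ τ,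
    ∫⁻ ω, ENNReal.ofReal (‖regressor M.Φ j τ (M.obs n j i ω)‖ ^ (2 + a)) ∂μ ≤ ENNReal.ofReal C

/-- Unique minimizers of the population objectives and uniform convergence of the objectives. -/
structure ObjectiveAssumption (μ : Measure Ω) (𝓑 : Set ℝ) (𝓡 : Set (Vec dw)) (𝓣 : Set (Vec dφ))
    (Qinf : ℝ → Υ → StackVec dw dφ → ℝ)
    (πn : ℕ → ℝ → Υ → StackVec dw dφ) (πinf : ℝ → Υ → StackVec dw dφ) : Prop where
  integrable : ∀ n j, ∀ b ∈ 𝓑, ∀ τ π, M.PopInt μ n j (fun d => loss M.Φ M.V j τ d b π)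
  limit : ∀ b ∈ 𝓑, ∀ τ π, Tendsto (fun n => M.popObjective μ n b τ π) atTop (𝓝 (Qinf b τ π))
  /-- `πn n b τ = (γ_n(b, τ), θ_n(b, τ))` is the unique minimizer of `Q_n` -/
  unique_n : ∀ᶠ n in atTop, ∀ b ∈ 𝓑, ∀ τ, ∀ π ≠ πn n b τ,
    M.popObjective μ n b τ (πn n b τ) < M.popObjective μ n b τ π
  /-- `πinf b τ = (γ_∞(b, τ), θ_∞(b, τ))` is the unique minimizer of `Q_∞` -/
  unique_inf : ∀ b ∈ 𝓑, ∀ τ, ∀ π ≠ πinf b τ, Qinf b τ (πinf b τ) < Qinf b τ π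
  /-- continuity in `b`, uniformly over `τ` -/
  cont_n : ∀ᶠ n in atTop, ∀ b ∈ 𝓑, ∀ ε > 0, ∃ δ > 0, ∀ b' ∈ 𝓑, |b' - b| < δ →
    ∀ τ, ‖πn n b' τ - πn n b τ‖ < ε
  cont_inf : ∀ b ∈ 𝓑, ∀ ε > 0, ∃ δ > 0, ∀ b' ∈ 𝓑, |b' - b| < δ →
    ∀ τ, ‖πinf b' τ - πinf b τ‖ < ε
  interior : ∀ᶠ n in atTop, ∀ b ∈ 𝓑, ∀ τ, πn n b τ ∈ interior (box 𝓡 𝓣)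
  unif_pop : ∀ π, ∀ ε > 0, ∀ᶠ n in atTop, ∀ b ∈ 𝓑, ∀ τ,
    |Qinf b τ π - M.popObjective μ n b τ π| < ε
  unif_sample : ∀ π, UnifLittleOp μ (fun n (p : 𝓑 × Υ) ω =>
    |((n : ℝ)⁻¹) * M.objective n ω p.1 p.2 π - M.popObjective μ n p.1 p.2 π|)

/-- The increment `δ(v, τ) = X v_b + Wᵀ v_r + Φ̂ᵀ v_t`, where `v = (v_b, (v_r, v_t))`. -/
def shift (φ : InstrFun J dw dz dφ Υ) (j : Fin J) (τ : Υ) (d : Obs dw dz)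
    (v : WithLp 2 (ℝ × StackVec dw dφ)) : ℝ :=
  d.x * v.fst + inner ℝ (regressor φ j τ d) v.snd

/-- `f_ε(δ | W, Z) Ψ Ψᵀ V`. -/
def jacΨΨ (φ : InstrFun J dw dz dφ Υ) (v : WeightFun J dw dz Υ) (j : Fin J) (τ : Υ)
    (fε : ℝ → Vec dw × Vec dz → ℝ) (δ : ℝ) (d : Obs dw dz) :
    Matrix (Fin dw ⊕ Fin dφ) (Fin dw ⊕ Fin dφ) ℝ :=
  (fε δ (d.w, d.z) * v j τ d.w d.z) • outerProd (regressor φ j τ d)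

/-- `f_ε(δ | W, Z) Ψ X V`. -/
def jacΨX (φ : InstrFun J dw dz dφ Υ) (v : WeightFun J dw dz Υ) (j : Fin J) (τ : Υ)
    (fε : ℝ → Vec dw × Vec dz → ℝ) (δ : ℝ) (d : Obs dw dz) : StackVec dw dφ :=
  (fε δ (d.w, d.z) * d.x * v j τ d.w d.z) • regressor φ j τ d

/-- Average over the units of cluster `j` of expectations of unit-specific functions. -/
def popAvg' {E : Type*} [NormedAddCommGroup E] [NormedSpace ℝ E] (μ : Measure Ω) (n : ℕ)
    (j : Fin J) (h : ℕ → Obs dw dz → E) : E :=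
  ((M.size n j : ℝ)⁻¹) • ∑ i ∈ Finset.range (M.size n j), ∫ ω, h i (M.obs n j i ω) ∂μ

/-- Existence of the expectations in `popAvg'`. -/
def PopInt' {E : Type*} [NormedAddCommGroup E] (μ : Measure Ω) (n : ℕ) (j : Fin J)
    (h : ℕ → Obs dw dz → E) : Prop :=
  ∀ i < M.size n j, Integrable (fun ω => h i (M.obs n j i ω)) μ

/-- The empirical process increment
`r_n (ℙ_{n,j} - ℙ̄_{n,j}) (f̂_τ(D, β_n + v_b, γ_n + v_r, v_t) - f_τ(D, β_n, γ_n, 0))`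
is well defined and of norm less than `ε`. -/
def ScoreIncrementLT (μ : Measure Ω) (ε : ℝ) (n : ℕ) (ω : Ω) (j : Fin J) (τ : Υ)
    (v : WithLp 2 (ℝ × StackVec dw dφ)) : Prop :=
  let h : Obs dw dz → StackVec dw dφ := fun d =>
    score (M.Φhat n ω) (M.Vhat n ω) j τ d (M.βn n τ + v.fst) (stack (M.γn n τ) 0 + v.snd)
      - score M.Φ M.V j τ d (M.βn n τ) (stack (M.γn n τ) 0)
  M.PopInt μ n j h ∧ ‖M.r n • (M.avg n j h ω - M.popAvg μ n j h)‖ < ε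

/-- `ℙ̄_{n,j} f_ε(δ(v, τ) | W, Z) Ψ̂ Ψ̂ᵀ V̂` is well defined and closer than `ε` to `Q`. -/
def JacΨΨClose (μ : Measure Ω) (fε : ℕ → Fin J → ℕ → Υ → ℝ → Vec dw × Vec dz → ℝ)
    (Q : Matrix (Fin dw ⊕ Fin dφ) (Fin dw ⊕ Fin dφ) ℝ) (ε : ℝ) (n : ℕ) (ω : Ω) (j : Fin J) (τ : Υ)
    (v : WithLp 2 (ℝ × StackVec dw dφ)) : Prop :=
  let h := fun i d => jacΨΨ (M.Φhat n ω) (M.Vhat n ω) j τ (fε n j i τ)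
    (shift (M.Φhat n ω) j τ d v) d
  M.PopInt' μ n j h ∧ ‖M.popAvg' μ n j h - Q‖ < ε

/-- `ℙ̄_{n,j} f_ε(δ(v, τ) | W, Z) Ψ̂ X V̂` is well defined and closer than `ε` to `Q`. -/
def JacΨXClose (μ : Measure Ω) (fε : ℕ → Fin J → ℕ → Υ → ℝ → Vec dw × Vec dz → ℝ)
    (Q : StackVec dw dφ) (ε : ℝ) (n : ℕ) (ω : Ω) (j : Fin J) (τ : Υ)
    (v : WithLp 2 (ℝ × StackVec dw dφ)) : Prop :=
  let h := fun i d => jacΨX (M.Φhat n ω) (M.Vhat n ω) j τ (fε n j i τ)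
    (shift (M.Φhat n ω) j τ d v) d
  M.PopInt' μ n j h ∧ ‖M.popAvg' μ n j h - Q‖ < ε

/-- `lim_{δ → 0} limsup_n P(P n ω j τ v fails for some j, τ and some v with ‖v‖ ≤ δ) = 0`. -/
def LocallyUniformly (μ : Measure Ω)
    (P : ℕ → Ω → Fin J → Υ → WithLp 2 (ℝ × StackVec dw dφ) → Prop) : Prop :=
  Tendsto (fun δ : ℝ => limsup (fun n : ℕ =>
      μ {ω | ¬ ∀ j τ v, ‖v‖ ≤ δ → P n ω j τ v}) atTop) (𝓝[>] 0) (𝓝 0)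

/-- Asymptotic regularity: objectives, stochastic equicontinuity of the score process,
convergence of the Jacobians, rate of the scores, and few large clusters. -/
structure AsymptoticAssumption (μ : Measure Ω) (𝓑 : Set ℝ) (𝓡 : Set (Vec dw)) (𝓣 : Set (Vec dφ))
    (fε : ℕ → Fin J → ℕ → Υ → ℝ → Vec dw × Vec dz → ℝ)
    (QΨΨ : Fin J → Υ → Matrix (Fin dw ⊕ Fin dφ) (Fin dw ⊕ Fin dφ) ℝ)
    (QΨX : Fin J → Υ → StackVec dw dφ) (ξ : Fin J → ℝ) : Prop where
  objectives : ∃ Qinf πn πinf, M.ObjectiveAssumption μ 𝓑 𝓡 𝓣 Qinf πn πinf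
  equicontinuity : ∀ ε > 0, LocallyUniformly μ (M.ScoreIncrementLT μ ε)
  /-- `fε n j i τ` is a conditional density of `ε_{i,j}(τ)` given `(W_{i,j}, Z_{i,j})` -/
  density : ∀ n j, ∀ i < M.size n j, ∀ τ,
    IsCondDensity μ (M.err n j i τ) (M.exog n j i) (fε n j i τ)
  QΨΨ_integrable : ∀ n j τ, M.PopInt' μ n j (fun i => jacΨΨ M.Φ M.V j τ (fε n j i τ) 0)
  QΨΨ_limit : ∀ j τ, Tendsto (fun n =>
    M.popAvg' μ n j (fun i => jacΨΨ M.Φ M.V j τ (fε n j i τ) 0)) atTop (𝓝 (QΨΨ j τ))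
  QΨX_integrable : ∀ n j τ, M.PopInt' μ n j (fun i => jacΨX M.Φ M.V j τ (fε n j i τ) 0)
  QΨX_limit : ∀ j τ, Tendsto (fun n =>
    M.popAvg' μ n j (fun i => jacΨX M.Φ M.V j τ (fε n j i τ) 0)) atTop (𝓝 (QΨX j τ))
  jacobianΨΨ : ∀ ε > 0,
    LocallyUniformly μ (fun n ω j τ v => M.JacΨΨClose μ fε (QΨΨ j τ) ε n ω j τ v)
  jacobianΨX : ∀ ε > 0,
    LocallyUniformly μ (fun n ω j τ v => M.JacΨXClose μ fε (QΨX j τ) ε n ω j τ v)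
  /-- `sup_τ r_n ‖ℙ_{n,j} f_τ(D, β_n(τ), γ_n(τ), 0)‖ = O_p(1)` in each cluster -/
  score_rate : ∀ j, UnifBigOp μ (fun n (τ : Υ) ω =>
    M.r n * ‖M.avg n j (fun d => score M.Φ M.V j τ d (M.βn n τ) (stack (M.γn n τ) 0)) ω‖)
  rate : M.r =O[atTop] fun n : ℕ => Real.sqrt n
  ξ_pos : ∀ j, 0 < ξ j
  cluster_size : ∀ j, Tendsto (fun n : ℕ => (M.size n j : ℝ) / n) atTop (𝓝 (ξ j))
  eigenvalues : ∃ c C : ℝ, 0 < c ∧ ∀ τ, RayleighBounds c C (∑ j, ξ j • QΨΨ j τ)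

/-- The second moment matrix `E[U Uᵀ]`. -/
def secondMoment (μ : Measure Ω) {d : ℕ} (U : Ω → Vec d) : Matrix (Fin d) (Fin d) ℝ :=
  Matrix.of fun a b => ∫ ω, U ω a * U ω b ∂μ

/-- Orthogonality of instruments and controls in each cluster, and the Gaussian approximation of
the cluster scores by processes `𝒵_j`. -/
structure BootstrapAssumption (μ : Measure Ω)
    (QΨΨ : Fin J → Υ → Matrix (Fin dw ⊕ Fin dφ) (Fin dw ⊕ Fin dφ) ℝ)
    (𝒵 : Fin J → Υ → Ω → Vec dφ) : Prop where
  orthogonal : ∀ j τ, (QΨΨ j τ).toBlocks₁₂ = 0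
  gaussian : ∀ j, IsGaussianProcess (𝒵 j) μ
  measurable : ∀ j τ, Measurable (𝒵 j τ)
  centered : ∀ j τ, ∫ ω, 𝒵 j τ ω ∂μ = 0
  tight : ∀ j, IsTightProcess μ (𝒵 j)
  indep : iIndepFun (fun j ω τ => 𝒵 j τ ω) μ
  covariance : ∃ c C : ℝ, 0 < c ∧ ∀ j τ, RayleighBounds c C (secondMoment μ (𝒵 j τ))
  approx : ∀ j, UnifLittleOp μ (fun n (τ : Υ) ω =>
    ‖M.r n • lower (M.avg n j
      (fun d => score M.Φ M.V j τ d (M.βn n τ) (stack (M.γn n τ) 0)) ω) - 𝒵 j τ ω‖)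

/-- The weight `Â(τ)` has a deterministic limit `A(τ)`, bounded and bounded away from
singularity. -/
structure DeterministicWeight (μ : Measure Ω) (Ahat : ℕ → Ω → Υ → Matrix (Fin dφ) (Fin dφ) ℝ)
    (A : Υ → Matrix (Fin dφ) (Fin dφ) ℝ) : Prop where
  symm : ∀ τ, (A τ).IsSymm
  consistent : UnifLittleOp μ (fun n (τ : Υ) ω => ‖Ahat n ω τ - A τ‖)
  eigenvalues : ∃ c C : ℝ, 0 < c ∧ ∀ τ, RayleighBounds c C (A τ)

/-- The symmetric matrix `Ĥ(τ)` in the null-imposed cluster-robust weight has a deterministic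
limit `H(τ)`, bounded and bounded away from singularity; there are more clusters than
instruments. -/
structure ClusterRobustWeight (μ : Measure Ω) (Hhat : ℕ → Ω → Υ → Matrix (Fin dφ) (Fin dφ) ℝ)
    (H : Υ → Matrix (Fin dφ) (Fin dφ) ℝ) : Prop where
  symm : ∀ n ω τ, (Hhat n ω τ).IsSymm
  consistent : UnifLittleOp μ (fun n (τ : Υ) ω => ‖Hhat n ω τ - H τ‖)
  eigenvalues : ∃ c C : ℝ, 0 < c ∧ ∀ τ, RayleighBounds c C ((H τ).transpose * H τ)
  clusters : dφ < J

end IVQR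

/-! ### Limit statistics -/

section Limit
variable {Ω : Type*} {J dw dφ : ℕ} {Υ : Set ℝ}

/-- `Q_{Φ,Φ}(τ) = ∑_j ξ_j Q_{Φ,Φ,j}(τ)`. -/
def QΦΦ (QΨΨ : Fin J → Υ → Matrix (Fin dw ⊕ Fin dφ) (Fin dw ⊕ Fin dφ) ℝ) (ξ : Fin J → ℝ) (τ : Υ) :
    Matrix (Fin dφ) (Fin dφ) ℝ :=
  ∑ j, ξ j • (QΨΨ j τ).toBlocks₂₂

/-- `∑_j ξ_j² 𝒵_j(τ) 𝒵_j(τ)ᵀ`. -/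
def limitCRVE (ξ : Fin J → ℝ) (𝒵 : Fin J → Υ → Ω → Vec dφ) (ω : Ω) (τ : Υ) :
    Matrix (Fin dφ) (Fin dφ) ℝ :=
  ∑ j, (ξ j ^ 2) • outerProd (𝒵 j τ ω)

/-- `[H(τ) (∑_j ξ_j² 𝒵_j(τ) 𝒵_j(τ)ᵀ) H(τ)]⁻¹`. -/
def limitWeightCR (ξ : Fin J → ℝ) (𝒵 : Fin J → Υ → Ω → Vec dφ)
    (H : Υ → Matrix (Fin dφ) (Fin dφ) ℝ) (ω : Ω) (τ : Υ) : Matrix (Fin dφ) (Fin dφ) ℝ :=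
  (H τ * limitCRVE ξ 𝒵 ω τ * H τ)⁻¹

/-- `sup_τ ‖Q_{Φ,Φ}(τ)⁻¹ ∑_j ξ_j g_j 𝒵_j(τ)‖_{A(τ)}`, for a possibly random weight `A`. -/
def limitAR (QΨΨ : Fin J → Υ → Matrix (Fin dw ⊕ Fin dφ) (Fin dw ⊕ Fin dφ) ℝ) (ξ : Fin J → ℝ)
    (𝒵 : Fin J → Υ → Ω → Vec dφ) (A : Ω → Υ → Matrix (Fin dφ) (Fin dφ) ℝ) (ω : Ω) (g : Signs J) :
    ℝ≥0∞ :=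
  supNorm (A ω) (fun τ => matApply (QΦΦ QΨΨ ξ τ)⁻¹ (∑ j, (ξ j * sgn g j) • 𝒵 j τ ω))

/-- Almost surely, `T g = T g'` only for `g' = g` and `g' = -g`. -/
def NoTies [MeasurableSpace Ω] (μ : Measure Ω) (T : Ω → Signs J → ℝ≥0∞) : Prop :=
  ∀ g g' : Signs J, g' ≠ g → g' ≠ -g → ∀ᵐ ω ∂μ, T ω g ≠ T ω g'

end Limit

end

/-! The statistic is compared with a quantile of its versions under cluster sign changes, and in the
limit all of these are values of one functional of a sign-symmetric Gaussian family. Let T(g) be the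
supremum over τ of the A(τ)-norm of Q_ΦΦ(τ)⁻¹ Σ_j ξ_j g_j 𝒵_j(τ). The 𝒵_j are independent, centered
and Gaussian, so flipping any of them preserves their joint law (`map_sgn_smul_eq`), and the law of
g ↦ T(hg) does not depend on h. The quantile c of the whole family ignores relabelling, hence 2^J
P(T(1) > c) = E #{g : T(g) > c}. By definition of c, #{T > c} ≤ α 2^J ≤ #{T ≥ c}, and since ties
occur only between g and -g these counts differ by at most two. This gives the error 2/2^J =
1/2^(J-1) (`measureReal_finQuantile_le_le`), and `randomization_test` carries it over to statistics
that approach T(g) in probability after a common rescaling.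

The approximation by T rests on convexity. The objective has subgradient -n times the averaged
score. The quantile restriction and the conditional density turn a mean score increment into an
integral of Jacobians along a segment. With stochastic equicontinuity, the cluster score at π₀ + v
equals the score at π₀ minus Q_j v, with error ε (1/r_n + ‖v‖) for small ‖v‖, uniformly in τ
(`norm_avg_score_sub_add_le`). A deterministic lemma, `IsArgInf.approx`, then puts every minimizer
close to the zero of the affine approximation, and `ScoreExpansion.statistics` applies it to the
original and to the bootstrap objective. Under the null the coefficient of X is never perturbed, so
its identification plays no role. Orthogonality of W and Φ removes the effect of estimating γ from
the Φ-block of every cluster score. It makes r_n θ̂ and r_n (θ̂*_g - θ̂) close to Q_ΦΦ⁻¹ Σ ξ_j 𝒵_j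
and Q_ΦΦ⁻¹ Σ ξ_j g_j 𝒵_j.

The cluster-robust weight converges after normalization by r_n²/n, and the normalization drops out
because the test is invariant under scaling. Its limit [H M H]⁻¹ is random, but M is even in each
𝒵_j, so all g share the same weight and the symmetry survives. Inversion is stable where M is
bounded below uniformly in τ. For infinite Υ this bound is a hypothesis. For finite Υ it follows
from det M being a polynomial that is not identically zero, evaluated at a vector with an absolutely
continuous law. The same argument excludes ties at a single quantile: q_g - q_g' is a polynomial, up
to a common denominator, with an explicit nonzero value.

Suprema over an uncountable Υ need not be measurable. Tightness repairs this: almost surely the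
paths are determined, up to closure, by countably many quantiles (`exists_countable_closure`), which
yields a measurable version of T. -/

/-! ### Perturbed minimization of convex functions -/

section ConvexMin

variable {E : Type*} [NormedAddCommGroup E] [InnerProductSpace ℝ E]

/-- On the sphere of radius `R / r` the quadratic term `c ‖v‖ ^ 2` beats the linear terms from `k`
and from the error, because `R` satisfies `K + ε < (c - ε) * R`. In the application `-N G` is a
subgradient, so a negative sign here means that the function grows outwards. -/
lemma inner_subgradient_sphere_neg {G : E → E} {π₀ k v : E} {q : E →L[ℝ] E}
    {c ε r K R : ℝ} (hr : 0 < r) (hc : ∀ x, c * ‖x‖ ^ 2 ≤ inner ℝ x (q x))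
    (hk : ‖k‖ ≤ K / r) (hR : K + ε < (c - ε) * R) (hR0 : 0 < R) (hv : ‖v‖ = R / r)
    (hG : ‖G (π₀ + v) - k + q v‖ ≤ ε * (1 / r + ‖v‖)) :
    inner ℝ (G (π₀ + v)) v < 0 := by
  have h1 : inner ℝ (G (π₀ + v)) v
      = inner ℝ (G (π₀ + v) - k + q v) v + inner ℝ k v - inner ℝ v (q v) := by
    rw [inner_add_left, inner_sub_left, real_inner_comm v (q v)]; ring
  have h2 := (real_inner_le_norm (G (π₀ + v) - k + q v) v)
  have h3 := real_inner_le_norm k v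
  have hv0 : 0 < ‖v‖ := by rw [hv]; positivity
  have h4 : ‖G (π₀ + v) - k + q v‖ * ‖v‖ ≤ ε * (1 / r + ‖v‖) * ‖v‖ := by gcongr
  have h5 : ‖k‖ * ‖v‖ ≤ K / r * ‖v‖ := by gcongr
  have h6 := hc v
  have h7 : ε * (1 / r + ‖v‖) + K / r - c * ‖v‖ < 0 := by
    have : ε * (1 / r + ‖v‖) + K / r - c * ‖v‖ = (K + ε - (c - ε) * R) / r := by
      rw [hv]; field_simp; ring
    rw [this]
    exact div_neg_of_neg_of_pos (by linarith) hr
  nlinarith [mul_neg_of_neg_of_pos h7 hv0]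

/-- The segment from `π₀` to an outer point `x` crosses the sphere, and the subgradient inequality
at the crossing point already forces `F` to be strictly larger at `x`. -/
lemma lt_of_inner_sphere_neg {F : E → ℝ} {G : E → E} {N : ℝ} (hN : 0 < N)
    (hsub : ∀ x y, -(N * inner ℝ (G x) (y - x)) ≤ F y - F x) {π₀ : E} {ρ : ℝ} (hρ : 0 < ρ)
    (hsphere : ∀ v : E, ‖v‖ = ρ → inner ℝ (G (π₀ + v)) v < 0) {x : E} (hx : ρ < ‖x - π₀‖) :
    ∃ v : E, ‖v‖ = ρ ∧ F (π₀ + v) < F x := by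
  have hx0 : 0 < ‖x - π₀‖ := hρ.trans hx
  set s := ρ / ‖x - π₀‖ with hs
  have hs0 : 0 < s := by positivity
  have hs1 : s < 1 := by rwa [hs, div_lt_one hx0]
  have hv : ‖s • (x - π₀)‖ = ρ := by
    rw [norm_smul, Real.norm_of_nonneg hs0.le, hs]; field_simp
  refine ⟨s • (x - π₀), hv, ?_⟩
  have h1 := hsub (π₀ + s • (x - π₀)) x
  have h2 : x - (π₀ + s • (x - π₀)) = ((1 - s) / s) • (s • (x - π₀)) := by
    rw [smul_smul, div_mul_cancel₀ _ hs0.ne', sub_smul, one_smul]; abel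
  rw [h2, inner_smul_right] at h1
  have h3 := hsphere _ hv
  have h4 : 0 < (1 - s) / s := div_pos (by linarith) hs0
  have : N * ((1 - s) / s * inner ℝ (G (π₀ + s • (x - π₀))) (s • (x - π₀))) < 0 :=
    mul_neg_of_pos_of_neg hN (mul_neg_of_pos_of_neg h4 h3)
  linarith

/-- If the subgradient `G` of `F` is approximately affine near `π₀`, a minimizer of `F` is close
to the zero of the affine approximation. -/
lemma IsArgInf.approx [FiniteDimensional ℝ E] {F : E → ℝ} {G : E → E} {N : ℝ} (hN : 0 < N)
    (hF : Continuous F) (hsub : ∀ x y, -(N * inner ℝ (G x) (y - x)) ≤ F y - F x)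
    {π₀ k x : E} {q : E →L[ℝ] E} {c C ε r K R δ : ℝ} (hr : 0 < r) (hε : 0 < ε)
    (hc : ∀ x, c * ‖x‖ ^ 2 ≤ inner ℝ x (q x)) (hC : ‖q‖ ≤ C)
    (hk : ‖k‖ ≤ K / r) (hR : K + ε < (c - ε) * R) (hR0 : 0 < R) (hδ : (R + ε) / r ≤ δ)
    (hG : ∀ v, ‖v‖ ≤ δ → ‖G (π₀ + v) - k + q v‖ ≤ ε * (1 / r + ‖v‖)) (hx : IsArgInf F x) :
    ‖x - π₀‖ ≤ R / r ∧ ‖q (x - π₀) - k‖ ≤ (C * ε + ε * (1 + R + ε)) / r := by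
  have hRδ : R / r ≤ δ := le_trans (by gcongr; linarith) hδ
  have hsphere : ∀ v : E, ‖v‖ = R / r → inner ℝ (G (π₀ + v)) v < 0 := fun v hv =>
    inner_subgradient_sphere_neg hr hc hk hR hR0 hv (hG v (hv ▸ hRδ))
  have hout := fun {x} => @lt_of_inner_sphere_neg E _ _ F G N hN hsub π₀ (R / r) (by positivity)
    hsphere x
  -- `IsArgInf` says nothing unless a minimizer exists, so existence has to be proved: the minimum
  -- over the compact ball is global, since points outside are beaten by points of the sphere.
  have hmin : ∃ x', ∀ z, F x' ≤ F z := by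
    obtain ⟨x', hx', hmin⟩ := (isCompact_closedBall π₀ (R / r)).exists_isMinOn
      ⟨π₀, Metric.mem_closedBall_self (by positivity)⟩ hF.continuousOn
    refine ⟨x', fun z => ?_⟩
    by_cases hz : ‖z - π₀‖ ≤ R / r
    · exact hmin (by rwa [Metric.mem_closedBall, dist_eq_norm])
    · obtain ⟨v, hv, hlt⟩ := hout (not_le.1 hz)
      exact (hmin (show π₀ + v ∈ _ by simp [hv])).trans hlt.le
  have hx := hx hmin
  have hball : ‖x - π₀‖ ≤ R / r := by
    by_contra h
    obtain ⟨v, -, hlt⟩ := hout (not_le.1 h)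
    exact absurd (hx (π₀ + v)) (not_le.2 hlt)
  refine ⟨hball, ?_⟩
  set w := k - q (x - π₀) with hw
  rw [norm_sub_rev, ← hw]
  rcases eq_or_ne w 0 with h0 | h0
  · rw [h0, norm_zero]
    have : 0 ≤ C := (norm_nonneg _).trans hC
    positivity
  have hw0 : 0 < ‖w‖ := norm_pos_iff.2 h0
  -- At a kink `G x` need not vanish at the minimizer. Instead the subgradient inequality is tested
  -- at distance `ε / r` from `x` in the direction of the residual `w`: minimality gives `⟨G (x +
  -- h), h⟩ ≤ 0`, while `G (x + h)` is `w - q h` up to a small error, which bounds `‖w‖`.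
  set h := (ε / r / ‖w‖) • w with hh
  have hhn : ‖h‖ = ε / r := by
    rw [hh, norm_smul, Real.norm_of_nonneg (by positivity)]; field_simp
  have hmono : inner ℝ (G (x + h)) h ≤ 0 := by
    have h1 := hsub (x + h) x
    have h2 := hx (x + h)
    rw [show x - (x + h) = -h by abel, inner_neg_right] at h1
    by_contra h3
    nlinarith [mul_pos hN (not_le.1 h3)]
  have hvn : ‖x - π₀ + h‖ ≤ (R + ε) / r := by
    refine (norm_add_le _ _).trans ?_
    rw [hhn, add_div]; gcongr
  have he := hG (x - π₀ + h) (hvn.trans hδ)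
  rw [show π₀ + (x - π₀ + h) = x + h by abel] at he
  set e := G (x + h) - k + q (x - π₀ + h) with hedef
  have hGe : G (x + h) = e + w - q h := by rw [hedef, hw, map_add]; abel
  rw [hGe, inner_sub_left, inner_add_left] at hmono
  have hwh : inner ℝ w h = ε / r * ‖w‖ := by
    rw [hh, inner_smul_right, real_inner_self_eq_norm_sq]; field_simp
  have h1 : inner ℝ (q h) h ≤ C * (ε / r) * (ε / r) := by
    refine (real_inner_le_norm _ _).trans ?_
    rw [hhn]
    have : ‖q h‖ ≤ C * (ε / r) := by
      refine (q.le_opNorm h).trans ?_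
      rw [hhn]; gcongr
    gcongr
  have h2 : -(ε * (1 / r + (R + ε) / r) * (ε / r)) ≤ inner ℝ e h := by
    have h3 := neg_le_of_abs_le (abs_real_inner_le_norm e h)
    rw [hhn] at h3
    refine le_trans (neg_le_neg ?_) h3
    gcongr
    exact he.trans (by gcongr)
  have h4 : ε / r * ‖w‖ ≤ ε / r * ((C * ε + ε * (1 + R + ε)) / r) := by
    rw [← hwh]
    have : ε / r * ((C * ε + ε * (1 + R + ε)) / r)
        = C * (ε / r) * (ε / r) + ε * (1 / r + (R + ε) / r) * (ε / r) := by
      field_simp; ring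
    linarith
  exact le_of_mul_le_mul_left h4 (by positivity)

end ConvexMin

lemma checkFun_subgradient (τ u u' : ℝ) :
    (u' - u) * (τ - if u ≤ 0 then 1 else 0) ≤ checkFun τ u' - checkFun τ u := by
  unfold checkFun
  split_ifs <;> nlinarith

lemma checkFun_eq_max (τ u : ℝ) : checkFun τ u = max (u * τ) (u * (τ - 1)) := by
  unfold checkFun
  split_ifs with h
  · rw [max_eq_right]; nlinarith
  · rw [max_eq_left] <;> nlinarith

lemma continuous_checkFun (τ : ℝ) : Continuous (checkFun τ) := by
  have : checkFun τ = fun u => max (u * τ) (u * (τ - 1)) := funext (checkFun_eq_max τ)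
  rw [this]; fun_prop

/-! ### Events of outer probability tending to one -/

section WithHighProb

variable {Ω : Type*} [MeasurableSpace Ω] {μ : Measure Ω}

/-- The outer probability that `P n` fails tends to zero. -/
def WithHighProb (μ : Measure Ω) (P : ℕ → Ω → Prop) : Prop :=
  Tendsto (fun n => μ {ω | ¬ P n ω}) atTop (𝓝 0)

lemma withHighProb_iff {P : ℕ → Ω → Prop} :
    WithHighProb μ P ↔ ∀ η : ℝ≥0∞, 0 < η → ∀ᶠ n in atTop, μ {ω | ¬ P n ω} ≤ η :=
  ENNReal.tendsto_nhds_zero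

lemma WithHighProb.and {P Q : ℕ → Ω → Prop} (hP : WithHighProb μ P) (hQ : WithHighProb μ Q) :
    WithHighProb μ (fun n ω => P n ω ∧ Q n ω) := by
  have h := Tendsto.add hP hQ
  rw [add_zero] at h
  refine tendsto_of_tendsto_of_tendsto_of_le_of_le tendsto_const_nhds h
    (fun _ => zero_le) fun n => ?_
  refine (measure_mono fun ω hω => ?_).trans (measure_union_le {ω | ¬ P n ω} {ω | ¬ Q n ω})
  exact not_and_or.1 hω

lemma WithHighProb.forall {ι : Type*} [Finite ι] {P : ι → ℕ → Ω → Prop}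
    (h : ∀ i, WithHighProb μ (P i)) : WithHighProb μ (fun n ω => ∀ i, P i n ω) := by
  have := Fintype.ofFinite ι
  have h' := tendsto_finsetSum Finset.univ fun i _ => h i
  rw [Finset.sum_const_zero] at h'
  refine tendsto_of_tendsto_of_tendsto_of_le_of_le tendsto_const_nhds h'
    (fun _ => zero_le) fun n => ?_
  refine (measure_mono fun ω hω => ?_).trans
    (measure_biUnion_finset_le Finset.univ fun i => {ω | ¬ P i n ω})
  obtain ⟨i, hi⟩ := not_forall.1 hω
  exact mem_biUnion (Finset.mem_coe.2 (Finset.mem_univ i)) hi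

lemma withHighProb_of_ae {P : ℕ → Ω → Prop} (h : ∀ n, ∀ᵐ ω ∂μ, P n ω) : WithHighProb μ P := by
  unfold WithHighProb
  simp_rw [fun n => ae_iff.1 (h n)]
  exact tendsto_const_nhds

lemma UnifLittleOp.withHighProb {ι : Type*} {f : ℕ → ι → Ω → ℝ} (h : UnifLittleOp μ f) {ε : ℝ}
    (hε : 0 < ε) : WithHighProb μ (fun n ω => ∀ i, f n i ω ≤ ε) := by
  have := h ε hε
  unfold WithHighProb
  simpa only [not_forall, not_le] using this

end WithHighProb

/-! ### Quantiles of finite families -/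

section FinQuantile

variable {G : Type*} [Fintype G]

/-- The infimum defining the quantile is attained: the count of values at most `x` is constant from
`c` up to the next larger value `m`, and some admissible `y` lies below `m`. The condition `p ≤ 1`
makes `⊤` admissible. -/
lemma finQuantile_le_iff {p : ℝ} {T : G → ℝ≥0∞} {x : ℝ≥0∞} (hp : p ≤ 1) :
    finQuantile p T ≤ x ↔
      p * (Fintype.card G : ℝ) ≤ ((Finset.univ.filter (fun g => T g ≤ x)).card : ℝ) := by
  refine ⟨fun h => ?_, fun h => sInf_le h⟩
  suffices hc : p * (Fintype.card G : ℝ) ≤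
      ((Finset.univ.filter (fun g => T g ≤ finQuantile p T)).card : ℝ) by
    refine hc.trans (Nat.cast_le.2 (Finset.card_le_card fun g hg => ?_))
    simp only [Finset.mem_filter, Finset.mem_univ, true_and] at hg ⊢
    exact hg.trans h
  set c := finQuantile p T with hcdef
  set m := (Finset.univ.filter (fun g => c < T g)).inf T with hm
  have htop : (⊤ : ℝ≥0∞) ∈ {x | p * (Fintype.card G : ℝ) ≤
      ((Finset.univ.filter (fun g => T g ≤ x)).card : ℝ)} := by
    simp only [mem_ofPred_eq, le_top, Finset.filter_true, Finset.card_univ]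
    exact mul_le_of_le_one_left (Nat.cast_nonneg _) hp
  by_cases hctop : c = ⊤
  · rw [hctop]; exact htop
  have hcm : c < m := by
    rw [hm, Finset.lt_inf_iff (lt_top_iff_ne_top.2 hctop)]
    intro g hg
    exact (Finset.mem_filter.1 hg).2
  obtain ⟨y, hy, hym⟩ := sInf_lt_iff.1 (hcdef ▸ hcm : sInf _ < m)
  refine le_trans hy (Nat.cast_le.2 (Finset.card_le_card fun g hg => ?_))
  simp only [Finset.mem_filter, Finset.mem_univ, true_and] at hg ⊢
  by_contra hlt
  exact absurd (hg.trans_lt hym) (not_lt.2 (Finset.inf_le (by simpa using hlt)))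

lemma finQuantile_le_of_forall {p : ℝ} (hp : p ≤ 1) {T T' : G → ℝ≥0∞} {f : ℝ≥0∞ → ℝ≥0∞}
    (hf : Monotone f) (h : ∀ g, T g ≤ f (T' g)) : finQuantile p T ≤ f (finQuantile p T') := by
  rw [finQuantile_le_iff hp]
  refine ((finQuantile_le_iff (T := T') hp).1 le_rfl).trans
    (Nat.cast_le.2 (Finset.card_le_card fun g hg => ?_))
  simp only [Finset.mem_filter, Finset.mem_univ, true_and] at hg ⊢
  exact (h g).trans (hf hg)

/-- Equivariance under scaling is what makes the rate of convergence and the normalization of the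
weight irrelevant for the rejection event. -/
lemma finQuantile_mul {p : ℝ} (hp : p ≤ 1) (T : G → ℝ≥0∞) {κ : ℝ≥0∞} (h0 : κ ≠ 0) (ht : κ ≠ ⊤) :
    finQuantile p (fun g => κ * T g) = κ * finQuantile p T := by
  refine le_antisymm (finQuantile_le_of_forall hp (f := fun x => κ * x)
    (fun _ _ h => by dsimp only; gcongr) fun _ => le_rfl) ?_
  have h := finQuantile_le_of_forall hp (T := T) (T' := fun g => κ * T g) (f := fun x => κ⁻¹ * x)
    (fun _ _ h => by dsimp only; gcongr) fun g => by
      rw [← mul_assoc, ENNReal.inv_mul_cancel h0 ht, one_mul]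
  calc κ * finQuantile p T ≤ κ * (κ⁻¹ * finQuantile p fun g => κ * T g) := by gcongr
    _ = _ := by rw [← mul_assoc, ENNReal.mul_inv_cancel h0 ht, one_mul]

lemma finQuantile_comp_equiv (p : ℝ) (T : G → ℝ≥0∞) (e : G ≃ G) :
    finQuantile p (fun g => T (e g)) = finQuantile p T := by
  unfold finQuantile
  congr 1; ext x
  have : (Finset.univ.filter (fun g => T (e g) ≤ x)).card
      = (Finset.univ.filter (fun g => T g ≤ x)).card :=
    Finset.card_equiv e (by simp)
  simp only [mem_ofPred_eq, this]

lemma measurable_finQuantile {p : ℝ} (hp : p ≤ 1) :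
    Measurable (finQuantile p : (G → ℝ≥0∞) → ℝ≥0∞) := by
  refine measurable_of_Iic fun x => ?_
  have : finQuantile p ⁻¹' Iic x = ⋃ s ∈ {s : Finset G | p * (Fintype.card G : ℝ) ≤ s.card},
      ⋂ g ∈ s, {T : G → ℝ≥0∞ | T g ≤ x} := by
    ext T
    simp only [mem_preimage, mem_Iic, finQuantile_le_iff hp, mem_iUnion, mem_iInter, mem_ofPred_eq,
      exists_prop]
    refine ⟨fun h => ⟨_, h, fun g hg => by simpa using hg⟩, fun ⟨s, hs, h⟩ => hs.trans ?_⟩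
    exact Nat.cast_le.2 (Finset.card_le_card fun g hg => by simpa using h g hg)
  rw [this]
  refine MeasurableSet.biUnion (to_countable _) fun s _ => ?_
  refine MeasurableSet.biInter (to_countable _) fun g _ => ?_
  exact measurableSet_le (measurable_pi_apply g) measurable_const

lemma card_finQuantile_lt_le {α : ℝ} (h0 : 0 ≤ α) (T : G → ℝ≥0∞) :
    ((Finset.univ.filter (fun g => finQuantile (1 - α) T < T g)).card : ℝ)
      ≤ α * Fintype.card G := by
  have h1 := (finQuantile_le_iff (T := T) (by linarith : 1 - α ≤ 1)).1 le_rfl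
  have h2 := Finset.card_filter_add_card_filter_not (s := (Finset.univ : Finset G))
    (fun g => T g ≤ finQuantile (1 - α) T)
  simp only [not_le, Finset.card_univ] at h2
  have h3 : ((Finset.univ.filter (fun g => T g ≤ finQuantile (1 - α) T)).card : ℝ)
    + (Finset.univ.filter (fun g => finQuantile (1 - α) T < T g)).card = Fintype.card G := by
    exact_mod_cast h2
  linarith

/-- If more than a fraction `1 - α` of the values lay strictly below the quantile, the largest of
them would itself be admissible, contradicting minimality of the quantile. -/
lemma le_card_le_finQuantile {α : ℝ} (h0 : 0 ≤ α) (h1 : α < 1) (T : G → ℝ≥0∞) :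
    α * Fintype.card G ≤
      ((Finset.univ.filter (fun g => finQuantile (1 - α) T ≤ T g)).card : ℝ) := by
  have h2 := Finset.card_filter_add_card_filter_not (s := (Finset.univ : Finset G))
    (fun g => T g < finQuantile (1 - α) T)
  simp only [not_lt, Finset.card_univ] at h2
  have h3 : ((Finset.univ.filter (fun g => T g < finQuantile (1 - α) T)).card : ℝ)
    + (Finset.univ.filter (fun g => finQuantile (1 - α) T ≤ T g)).card = Fintype.card G := by
    exact_mod_cast h2
  have h4 : ((Finset.univ.filter (fun g => T g < finQuantile (1 - α) T)).card : ℝ)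
      ≤ (1 - α) * Fintype.card G := by
    by_contra hcon
    push Not at hcon
    set s := Finset.univ.filter (fun g => T g < finQuantile (1 - α) T) with hs
    have hne : s.Nonempty := by
      rw [← Finset.card_pos, ← Nat.cast_pos (α := ℝ)]
      exact lt_of_le_of_lt (mul_nonneg (by linarith) (Nat.cast_nonneg _)) hcon
    obtain ⟨g₀, hg₀, hmax⟩ := s.exists_max_image T hne
    have h5 : finQuantile (1 - α) T ≤ T g₀ := by
      rw [finQuantile_le_iff (by linarith)]
      refine hcon.le.trans (Nat.cast_le.2 (Finset.card_le_card fun g hg => ?_))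
      simpa using hmax g hg
    exact absurd h5 (not_le.2 (Finset.mem_filter.1 hg₀).2)
  linarith

end FinQuantile

/-! ### Validity of sign-based randomization tests -/

section Randomization

variable {Ω : Type*} [MeasurableSpace Ω] {μ : Measure Ω} [IsProbabilityMeasure μ] {J : ℕ}

lemma card_signs : (Fintype.card (Signs J) : ℝ) = 2 ^ J := by
  rw [Fintype.card_fun, Fintype.card_units_int, Fintype.card_fin]; norm_num

lemma card_eq_finQuantile_le_two {T : Signs J → ℝ≥0∞}
    (hT : ∀ g g' : Signs J, g' ≠ g → g' ≠ -g → T g ≠ T g') (c : ℝ≥0∞) :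
    (Finset.univ.filter (fun g => T g = c)).card ≤ 2 := by
  rcases (Finset.univ.filter (fun g => T g = c)).eq_empty_or_nonempty with h | ⟨g₀, hg₀⟩
  · simp [h]
  · refine (Finset.card_le_card (t := {g₀, -g₀}) fun g hg => ?_).trans Finset.card_le_two
    by_contra hcon
    simp only [Finset.mem_insert, Finset.mem_singleton, not_or] at hcon
    simp only [Finset.mem_filter, Finset.mem_univ, true_and] at hg hg₀
    exact hT g₀ g hcon.1 hcon.2 (hg₀.trans hg.symm)

/-- Translation by `h` permutes the family without changing its quantile, so by invariance the event
for `T ω h` has the same probability for every `h`; summing over `h` gives the expected count. The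
relation `R` stands for `<` and `≤`. -/
lemma card_mul_measureReal_eq_integral {T : Ω → Signs J → ℝ≥0∞} (hT : Measurable T)
    (hinv : ∀ h : Signs J, μ.map (fun ω g => T ω (h * g)) = μ.map T) {α : ℝ} (h0 : 0 < α)
    {R : ℝ≥0∞ → ℝ≥0∞ → Prop} [∀ a b, Decidable (R a b)]
    (hR : MeasurableSet {x : ℝ≥0∞ × ℝ≥0∞ | R x.1 x.2}) :
    (2 : ℝ) ^ J * μ.real {ω | R (finQuantile (1 - α) (T ω)) (T ω 1)} =
      ∫ ω, ((Finset.univ.filter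
        (fun g => R (finQuantile (1 - α) (T ω)) (T ω g))).card : ℝ) ∂μ := by
  have hmeas : ∀ g : Signs J,
      MeasurableSet {W : Signs J → ℝ≥0∞ | R (finQuantile (1 - α) W) (W g)} := fun g =>
    ((measurable_finQuantile (by linarith)).prodMk (measurable_pi_apply g)) hR
  have hperm : ∀ h : Signs J, Measurable fun ω g => T ω (h * g) := fun h =>
    measurable_pi_lambda _ fun g => (measurable_pi_apply (h * g)).comp hT
  have key : ∀ h : Signs J, μ.real {ω | R (finQuantile (1 - α) (T ω)) (T ω h)}
      = μ.real {ω | R (finQuantile (1 - α) (T ω)) (T ω 1)} := by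
    intro h
    have h1 := congrArg (fun ν => ν {W : Signs J → ℝ≥0∞ | R (finQuantile (1 - α) W) (W 1)})
      (hinv h)
    simp only [Measure.map_apply (hperm h) (hmeas 1), Measure.map_apply hT (hmeas 1)] at h1
    have h2 := congrArg ENNReal.toReal h1
    simp only [preimage_ofPred_eq, mul_one] at h2
    simp only [Measure.real]
    rw [← h2]
    congr 2
    ext ω
    rw [mem_ofPred_eq, mem_ofPred_eq,
      ← finQuantile_comp_equiv (1 - α) (T ω) (Equiv.mulLeft h)]
    rfl
  have hsets : ∀ g, MeasurableSet {ω | R (finQuantile (1 - α) (T ω)) (T ω g)} :=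
    fun g => hT (hmeas g)
  have h3 : ∀ ω, ((Finset.univ.filter
      (fun g => R (finQuantile (1 - α) (T ω)) (T ω g))).card : ℝ)
      = ∑ g, {ω | R (finQuantile (1 - α) (T ω)) (T ω g)}.indicator (fun _ => (1 : ℝ)) ω := by
    intro ω
    rw [Finset.card_filter, Nat.cast_sum]
    refine Finset.sum_congr rfl fun g _ => ?_
    simp [indicator_apply]
  simp_rw [h3]
  rw [integral_finsetSum _ fun g _ => (integrable_const 1).indicator (hsets g)]
  simp_rw [integral_indicator_const (1 : ℝ) (hsets _), key]
  rw [Finset.sum_const, Finset.card_univ, nsmul_eq_mul, smul_eq_mul, mul_one, card_signs]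

/-- The counts of values above and not below the quantile enclose `α * 2 ^ J` and almost surely
differ by at most two, the size of a level set `{g, -g}`. Dividing the expected counts by `2 ^ J`
gives both bounds. -/
lemma measureReal_finQuantile_le_le {T : Ω → Signs J → ℝ≥0∞} (hT : Measurable T)
    (hinv : ∀ h : Signs J, μ.map (fun ω g => T ω (h * g)) = μ.map T)
    (hties : NoTies μ T) (hJ : 1 ≤ J) {α : ℝ} (hα : α ∈ Ioo (0 : ℝ) 1) :
    α - 1 / 2 ^ (J - 1) ≤ μ.real {ω | finQuantile (1 - α) (T ω) < T ω 1} ∧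
      μ.real {ω | finQuantile (1 - α) (T ω) ≤ T ω 1} ≤ α + 1 / 2 ^ (J - 1) := by
  have hcard := card_signs (J := J)
  have hpow : (2 : ℝ) ^ J = 2 * 2 ^ (J - 1) := by
    rw [← pow_succ']; congr 1; omega
  have hpos : (0 : ℝ) < 2 ^ (J - 1) := by positivity
  have hties' : ∀ᵐ ω ∂μ, ∀ g g' : Signs J, g' ≠ g → g' ≠ -g → T ω g ≠ T ω g' := by
    simp only [ae_all_iff]
    exact hties
  have hdec : ∀ ω, ((Finset.univ.filter (fun g => finQuantile (1 - α) (T ω) ≤ T ω g)).card : ℝ)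
      = (Finset.univ.filter (fun g => finQuantile (1 - α) (T ω) < T ω g)).card
        + (Finset.univ.filter (fun g => T ω g = finQuantile (1 - α) (T ω))).card := by
    intro ω
    rw [← Nat.cast_add, ← Finset.card_union_of_disjoint]
    · congr 2; ext g
      simp only [Finset.mem_filter, Finset.mem_univ, true_and, Finset.mem_union]
      rw [le_iff_lt_or_eq, eq_comm (a := T ω g)]
    · rw [Finset.disjoint_filter]
      exact fun g _ h1 h2 => h1.ne h2.symm
  have hint : ∀ (f : Ω → Finset (Signs J)), AEStronglyMeasurable (fun ω => ((f ω).card : ℝ)) μ →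
      Integrable (fun ω => ((f ω).card : ℝ)) μ := fun f hf =>
    Integrable.of_bound hf (2 ^ J) (Eventually.of_forall fun ω => by
      rw [Real.norm_of_nonneg (Nat.cast_nonneg _), ← hcard]
      exact_mod_cast Finset.card_le_univ _)
  have hmeas : ∀ (R : ℝ≥0∞ → ℝ≥0∞ → Prop) [∀ a b, Decidable (R a b)], MeasurableSet {x : ℝ≥0∞ × ℝ≥0∞ | R x.1 x.2} →
      AEStronglyMeasurable (fun ω => ((Finset.univ.filter
        (fun g => R (finQuantile (1 - α) (T ω)) (T ω g))).card : ℝ)) μ := by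
    intro R _ hR
    have h3 : ∀ ω, ((Finset.univ.filter
      (fun g => R (finQuantile (1 - α) (T ω)) (T ω g))).card : ℝ)
      = ∑ g, {ω | R (finQuantile (1 - α) (T ω)) (T ω g)}.indicator (fun _ => (1 : ℝ)) ω := by
      intro ω
      rw [Finset.card_filter, Nat.cast_sum]
      refine Finset.sum_congr rfl fun g _ => ?_
      simp [indicator_apply]
    simp_rw [h3]
    refine (Finset.measurable_sum _ fun g _ => measurable_const.indicator ?_).aestronglyMeasurable
    exact (((measurable_finQuantile (by linarith [hα.1])).comp hT).prodMk
      ((measurable_pi_apply g).comp hT)) hR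
  have hlt : MeasurableSet {x : ℝ≥0∞ × ℝ≥0∞ | x.1 < x.2} := measurableSet_lt'
  have hle : MeasurableSet {x : ℝ≥0∞ × ℝ≥0∞ | x.1 ≤ x.2} := measurableSet_le'
  constructor
  · have h1 := card_mul_measureReal_eq_integral hT hinv hα.1 (R := (· < ·)) hlt
    have h2 : ∫ _, (α * 2 ^ J - 2) ∂μ ≤ ∫ ω, ((Finset.univ.filter
        (fun g => finQuantile (1 - α) (T ω) < T ω g)).card : ℝ) ∂μ := by
      refine integral_mono_ae (integrable_const _) (hint _ (hmeas _ hlt)) ?_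
      filter_upwards [hties'] with ω hω
      have h3 := le_card_le_finQuantile hα.1.le hα.2 (T ω)
      have h4 : ((Finset.univ.filter (fun g => T ω g = finQuantile (1 - α) (T ω))).card : ℝ) ≤ 2 :=
        by exact_mod_cast card_eq_finQuantile_le_two hω _
      rw [hdec, hcard] at h3
      linarith
    rw [← h1, integral_const, probReal_univ, one_smul, hpow] at h2
    have h5 : α - 1 / 2 ^ (J - 1) = (α * (2 * 2 ^ (J - 1)) - 2) / (2 * 2 ^ (J - 1)) := by
      field_simp
    rw [h5, div_le_iff₀ (by positivity)]
    linarith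
  · have h1 := card_mul_measureReal_eq_integral hT hinv hα.1 (R := (· ≤ ·)) hle
    have h2 : ∫ ω, ((Finset.univ.filter
        (fun g => finQuantile (1 - α) (T ω) ≤ T ω g)).card : ℝ) ∂μ ≤ ∫ _, (α * 2 ^ J + 2) ∂μ := by
      refine integral_mono_ae (hint _ (hmeas _ hle)) (integrable_const _) ?_
      filter_upwards [hties'] with ω hω
      have h3 := card_finQuantile_lt_le hα.1.le (T ω)
      have h4 : ((Finset.univ.filter (fun g => T ω g = finQuantile (1 - α) (T ω))).card : ℝ) ≤ 2 :=
        by exact_mod_cast card_eq_finQuantile_le_two hω _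
      rw [hcard] at h3
      rw [hdec]
      linarith
    rw [← h1, integral_const, probReal_univ, one_smul, hpow] at h2
    have h5 : α + 1 / 2 ^ (J - 1) = (α * (2 * 2 ^ (J - 1)) + 2) / (2 * 2 ^ (J - 1)) := by
      field_simp
    rw [h5, le_div_iff₀ (by positivity)]
    linarith

/-- A test that compares a statistic with a quantile of its sign-randomized versions is
asymptotically valid if these converge jointly to an exchangeable limit without nontrivial ties. -/
theorem randomization_test {T T' : Ω → Signs J → ℝ≥0∞} (hT' : Measurable T')
    (hTT' : ∀ᵐ ω ∂μ, T ω = T' ω)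
    (hinv : ∀ h : Signs J, μ.map (fun ω g => T' ω (h * g)) = μ.map T')
    (hties : NoTies μ T) (hJ : 1 ≤ J) {α : ℝ} (hα : α ∈ Ioo (0 : ℝ) 1)
    {S : ℕ → Ω → Signs J → ℝ≥0∞} {s : ℕ → Ω → ℝ≥0∞} {κ : ℕ → ℝ≥0∞}
    (hκ : ∀ᶠ n in atTop, κ n ≠ 0 ∧ κ n ≠ ⊤)
    (happrox : ∀ ε : NNReal, 0 < ε → WithHighProb μ (fun n ω =>
      (∀ g, κ n * S n ω g ≤ T ω g + ε ∧ T ω g ≤ κ n * S n ω g + ε) ∧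
        κ n * s n ω ≤ T ω 1 + ε ∧ T ω 1 ≤ κ n * s n ω + ε)) :
    α - 1 / 2 ^ (J - 1) ≤
      liminf (fun n => μ.real {ω | finQuantile (1 - α) (S n ω) < s n ω}) atTop ∧
    liminf (fun n => μ.real {ω | finQuantile (1 - α) (S n ω) < s n ω}) atTop ≤
      limsup (fun n => μ.real {ω | finQuantile (1 - α) (S n ω) < s n ω}) atTop ∧
    limsup (fun n => μ.real {ω | finQuantile (1 - α) (S n ω) < s n ω}) atTop ≤
      α + 1 / 2 ^ (J - 1) := by
  have hp : 1 - α ≤ 1 := by linarith [hα.1]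
  have hties' : NoTies μ T' := fun g g' h h' => by
    filter_upwards [hties g g' h h', hTT'] with ω h1 h2
    rwa [← h2]
  obtain ⟨hlow, hupp⟩ := measureReal_finQuantile_le_le hT' hinv hties' hJ hα
  have hgood : ∀ ε : NNReal, 0 < ε → Tendsto (fun n => (μ {ω | ¬ (T ω = T' ω ∧
      (∀ g, κ n * S n ω g ≤ T ω g + ε ∧ T ω g ≤ κ n * S n ω g + ε) ∧
        κ n * s n ω ≤ T ω 1 + ε ∧ T ω 1 ≤ κ n * s n ω + ε)}).toReal) atTop (𝓝 0) := fun ε hε => by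
    have h := (withHighProb_of_ae (fun _ => hTT')).and (happrox ε hε)
    have h' := (ENNReal.tendsto_toReal ENNReal.zero_ne_top).comp h
    rwa [ENNReal.toReal_zero] at h'
  -- Rejection does not depend on the scale, so the unknown rate `κ n` may be applied to both sides.
  have hrej : ∀ n ω, κ n ≠ 0 ∧ κ n ≠ ⊤ → (finQuantile (1 - α) (S n ω) < s n ω ↔
      finQuantile (1 - α) (fun g => κ n * S n ω g) < κ n * s n ω) := fun n ω h => by
    rw [finQuantile_mul hp _ h.1 h.2, ENNReal.mul_lt_mul_iff_right h.1 h.2]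
  have hadd : ∀ ε : NNReal, Monotone fun x : ℝ≥0∞ => x + ε := fun ε _ _ h => by
    dsimp only; gcongr
  have hmq : Measurable fun ω => finQuantile (1 - α) (T' ω) := (measurable_finQuantile hp).comp hT'
  have hm1 : Measurable fun ω => T' ω 1 := (measurable_pi_apply 1).comp hT'
  set P : ℕ → ℝ := fun n => μ.real {ω | finQuantile (1 - α) (S n ω) < s n ω} with hP
  have hP0 : ∀ n, 0 ≤ P n := fun n => measureReal_nonneg
  have hP1 : ∀ n, P n ≤ 1 := fun n => measureReal_le_one
  have hb1 : IsBoundedUnder (· ≤ ·) atTop P := isBoundedUnder_of ⟨1, hP1⟩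
  have hb2 : IsBoundedUnder (· ≥ ·) atTop P := isBoundedUnder_of ⟨0, hP0⟩
  refine ⟨?_, liminf_le_limsup hb1 hb2, ?_⟩
  -- On the good event both the statistic and the quantile move by at most `ε`, so a margin of `2 *
  -- ε` in the limit forces rejection. The measurable version `T'` of `T` is used so that the events
  -- of the limit are measurable.
  · have hmono : ∀ ε : NNReal, 0 < ε →
        μ.real {ω | finQuantile (1 - α) (T' ω) + 2 * ε < T' ω 1} ≤ liminf P atTop := by
      intro ε hε
      have h1 : ∀ᶠ n in atTop, μ.real {ω | finQuantile (1 - α) (T' ω) + 2 * ε < T' ω 1}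
          - (μ {ω | ¬ (T ω = T' ω ∧
      (∀ g, κ n * S n ω g ≤ T ω g + ε ∧ T ω g ≤ κ n * S n ω g + ε) ∧
        κ n * s n ω ≤ T ω 1 + ε ∧ T ω 1 ≤ κ n * s n ω + ε)}).toReal ≤ P n := by
        filter_upwards [hκ] with n hn
        rw [sub_le_iff_le_add]
        refine (measureReal_mono (fun ω hω => ?_)).trans (measureReal_union_le _ _)
        by_cases hg : (T ω = T' ω ∧
          (∀ g, κ n * S n ω g ≤ T ω g + ε ∧ T ω g ≤ κ n * S n ω g + ε) ∧
          κ n * s n ω ≤ T ω 1 + ε ∧ T ω 1 ≤ κ n * s n ω + ε)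
        · left
          obtain ⟨h2, h3, h4, h5⟩ := hg
          rw [mem_ofPred_eq, ← h2] at hω
          rw [mem_ofPred_eq, hrej n ω hn]
          have h6 : finQuantile (1 - α) (fun g => κ n * S n ω g) ≤ finQuantile (1 - α) (T ω) + ε :=
            finQuantile_le_of_forall hp (hadd ε) fun g => (h3 g).1
          by_contra hcon
          have h7 : T ω 1 ≤ finQuantile (1 - α) (T ω) + 2 * ε := by
            refine h5.trans ((add_le_add_left ((not_lt.1 hcon).trans h6) _).trans_eq ?_)
            rw [add_assoc, two_mul]
          exact absurd hω (not_lt.2 h7)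
        · right; exact hg
      have h2 := (tendsto_const_nhds (x := μ.real {ω | finQuantile (1 - α) (T' ω) + 2 * ε
        < T' ω 1})).sub (hgood ε hε)
      rw [sub_zero] at h2
      rw [← h2.liminf_eq]
      exact liminf_le_liminf h1 h2.isBoundedUnder_ge hb1.isCoboundedUnder_ge
    refine hlow.trans ?_
    have hseq : Tendsto (fun k : ℕ => μ.real {ω | finQuantile (1 - α) (T' ω)
        + 2 * ((k + 1 : NNReal)⁻¹ : NNReal) < T' ω 1}) atTop
        (𝓝 (μ.real {ω | finQuantile (1 - α) (T' ω) < T' ω 1})) := by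
      have hU : {ω | finQuantile (1 - α) (T' ω) < T' ω 1} = ⋃ k : ℕ, {ω | finQuantile (1 - α) (T' ω)
        + 2 * ((k + 1 : NNReal)⁻¹ : NNReal) < T' ω 1} := by
        ext ω
        simp only [mem_ofPred_eq, mem_iUnion]
        refine ⟨fun h => ?_, fun ⟨k, hk⟩ => lt_of_le_of_lt le_self_add hk⟩
        obtain ⟨r, hr, hlt⟩ := ENNReal.lt_iff_exists_add_pos_lt.1 h
        obtain ⟨k, hk⟩ := exists_nat_gt (2 / r)
        refine ⟨k, lt_of_le_of_lt ?_ hlt⟩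
        gcongr
        have : (2 : NNReal) * (k + 1 : NNReal)⁻¹ ≤ r := by
          rw [← div_eq_mul_inv, div_le_iff₀ (by positivity)]
          rw [div_lt_iff₀ hr] at hk
          nlinarith
        exact_mod_cast this
      rw [hU]
      refine (ENNReal.tendsto_toReal (measure_ne_top _ _)).comp
        (tendsto_measure_iUnion_atTop fun a b hab ω hω => ?_)
      rw [mem_ofPred_eq] at hω ⊢
      refine lt_of_le_of_lt ?_ hω
      have hab' : (a : NNReal) ≤ b := by exact_mod_cast hab
      gcongr
    exact le_of_tendsto' hseq fun k => hmono _ (by positivity)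
  · have hmono : ∀ ε : NNReal, 0 < ε →
        limsup P atTop ≤ μ.real {ω | finQuantile (1 - α) (T' ω) ≤ T' ω 1 + 2 * ε} := by
      intro ε hε
      have h1 : ∀ᶠ n in atTop, P n ≤ μ.real {ω | finQuantile (1 - α) (T' ω) ≤ T' ω 1 + 2 * ε}
          + (μ {ω | ¬ (T ω = T' ω ∧
      (∀ g, κ n * S n ω g ≤ T ω g + ε ∧ T ω g ≤ κ n * S n ω g + ε) ∧
        κ n * s n ω ≤ T ω 1 + ε ∧ T ω 1 ≤ κ n * s n ω + ε)}).toReal := by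
        filter_upwards [hκ] with n hn
        refine (measureReal_mono (fun ω hω => ?_)).trans (measureReal_union_le _ _)
        by_cases hg : (T ω = T' ω ∧
          (∀ g, κ n * S n ω g ≤ T ω g + ε ∧ T ω g ≤ κ n * S n ω g + ε) ∧
          κ n * s n ω ≤ T ω 1 + ε ∧ T ω 1 ≤ κ n * s n ω + ε)
        · left
          obtain ⟨h2, h3, h4, h5⟩ := hg
          rw [mem_ofPred_eq, hrej n ω hn] at hω
          rw [mem_ofPred_eq, ← h2]
          have h6 : finQuantile (1 - α) (T ω) ≤ finQuantile (1 - α) (fun g => κ n * S n ω g) + ε :=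
            finQuantile_le_of_forall hp (hadd ε) fun g => (h3 g).2
          refine h6.trans ((add_le_add_left (hω.le.trans h4) _).trans_eq ?_)
          rw [add_assoc, two_mul]
        · right; exact hg
      have h2 := (tendsto_const_nhds (x := μ.real {ω | finQuantile (1 - α) (T' ω)
        ≤ T' ω 1 + 2 * ε})).add (hgood ε hε)
      rw [add_zero] at h2
      rw [← h2.limsup_eq]
      exact limsup_le_limsup h1 hb2.isCoboundedUnder_le h2.isBoundedUnder_le
    refine le_trans ?_ hupp
    -- As the margin shrinks the events decrease to the one with a weak inequality, which is why the
    -- upper bound of the limit experiment has to include ties.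
    have hseq : Tendsto (fun k : ℕ => μ.real {ω | finQuantile (1 - α) (T' ω)
        ≤ T' ω 1 + 2 * ((k + 1 : NNReal)⁻¹ : NNReal)}) atTop
        (𝓝 (μ.real {ω | finQuantile (1 - α) (T' ω) ≤ T' ω 1})) := by
      have hU : {ω | finQuantile (1 - α) (T' ω) ≤ T' ω 1} = ⋂ k : ℕ, {ω | finQuantile (1 - α) (T' ω)
        ≤ T' ω 1 + 2 * ((k + 1 : NNReal)⁻¹ : NNReal)} := by
        ext ω
        simp only [mem_ofPred_eq, mem_iInter]
        refine ⟨fun h k => h.trans le_self_add, fun h => ?_⟩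
        refine ENNReal.le_of_forall_pos_le_add fun r hr _ => ?_
        obtain ⟨k, hk⟩ := exists_nat_gt (2 / r)
        refine (h k).trans ?_
        gcongr
        have : (2 : NNReal) * (k + 1 : NNReal)⁻¹ ≤ r := by
          rw [← div_eq_mul_inv, div_le_iff₀ (by positivity)]
          rw [div_lt_iff₀ hr] at hk
          nlinarith
        exact_mod_cast this
      rw [hU]
      refine (ENNReal.tendsto_toReal (measure_ne_top _ _)).comp
        (tendsto_measure_iInter_atTop (fun k => ?_) (fun a b hab ω hω => ?_)
          ⟨0, measure_ne_top _ _⟩)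
      · exact (measurableSet_le hmq (hm1.add_const _)).nullMeasurableSet
      · rw [mem_ofPred_eq] at hω ⊢
        refine le_trans hω ?_
        have hab' : (a : NNReal) ≤ b := by exact_mod_cast hab
        gcongr
    exact ge_of_tendsto' hseq fun k => hmono _ (by positivity)

end Randomization

/-! ### Conditional quantiles and conditional densities -/

section CondDensity

variable {Ω T : Type*} [MeasurableSpace Ω] {μ : Measure Ω} [IsProbabilityMeasure μ]
  [MeasurableSpace T]

/-- Conditionally on `U` the factor `k (U ω)` is constant and the indicator has mean `τ`, so the
product integrates to zero. -/
lemma integral_quantile_mul {Y : Ω → ℝ} {U : Ω → T} (hY : Measurable Y) (hU : Measurable U) {τ : ℝ}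
    (h : μ[{ω | Y ω ≤ 0}.indicator (fun _ => (1 : ℝ)) | MeasurableSpace.comap U inferInstance]
      =ᵐ[μ] fun _ => τ) {k : T → ℝ} (hk : Measurable k) (hki : Integrable (fun ω => k (U ω)) μ) :
    ∫ ω, (τ - if Y ω ≤ 0 then 1 else 0) * k (U ω) ∂μ = 0 := by
  have hm : MeasurableSpace.comap U inferInstance ≤ (inferInstance : MeasurableSpace Ω) :=
    hU.comap_le
  have hset : MeasurableSet {ω | Y ω ≤ 0} := measurableSet_le hY measurable_const
  have hkm : StronglyMeasurable[MeasurableSpace.comap U inferInstance] fun ω => k (U ω) :=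
    (hk.comp (comap_measurable U)).stronglyMeasurable
  have hi : Integrable ({ω | Y ω ≤ 0}.indicator (fun _ => (1 : ℝ))) μ :=
    (integrable_const 1).indicator hset
  have hprod : Integrable ({ω | Y ω ≤ 0}.indicator (fun _ => (1 : ℝ)) * fun ω => k (U ω)) μ := by
    have := hki.indicator hset
    refine this.congr (Eventually.of_forall fun ω => ?_)
    simp [indicator_apply]
  have h1 := condExp_mul_of_stronglyMeasurable_right hkm hprod hi
  have h2 : ∫ ω, ({ω | Y ω ≤ 0}.indicator (fun _ => (1 : ℝ)) * fun ω => k (U ω)) ω ∂μ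
      = ∫ ω, τ * k (U ω) ∂μ := by
    rw [← integral_condExp hm]
    refine integral_congr_ae ?_
    filter_upwards [h1, h] with ω h3 h4
    rw [h3, Pi.mul_apply, h4]
  have h5 : ∀ ω, (τ - if Y ω ≤ 0 then 1 else 0) * k (U ω)
      = τ * k (U ω) - ({ω | Y ω ≤ 0}.indicator (fun _ => (1 : ℝ)) * fun ω => k (U ω)) ω := by
    intro ω
    simp only [Pi.mul_apply, indicator_apply, mem_ofPred_eq]
    ring
  simp_rw [h5]
  rw [integral_sub (hki.const_mul τ) hprod, h2, sub_self]

lemma integral_mul_indicator_sub (f : ℝ → ℝ) (p : ℝ) :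
    ∫ e, f e * ((if e ≤ p then 1 else 0) - if e ≤ 0 then 1 else 0) = ∫ e in 0..p, f e := by
  rcases le_total 0 p with hp | hp
  · rw [intervalIntegral.integral_of_le hp, ← integral_indicator measurableSet_Ioc]
    refine integral_congr_ae (Eventually.of_forall fun e => ?_)
    simp only [indicator_apply, mem_Ioc]
    split_ifs <;> grind
  · rw [intervalIntegral.integral_of_ge hp, ← integral_indicator measurableSet_Ioc,
      ← integral_neg]
    refine integral_congr_ae (Eventually.of_forall fun e => ?_)
    simp only [indicator_apply, mem_Ioc]
    split_ifs <;> grind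

/-- The substitution `e = s * p` writes the increment with densities at `s * p` for `s` in the unit
interval, which are the values entering the Jacobian at the shift `s • v`. -/
lemma integral_mul_indicator_sub_eq_unit (f : ℝ → ℝ) (p : ℝ) :
    ∫ e, f e * ((if e ≤ p then 1 else 0) - if e ≤ 0 then 1 else 0)
      = ∫ s in (0 : ℝ)..1, f (s * p) * p := by
  rw [integral_mul_indicator_sub, intervalIntegral.integral_mul_const, mul_comm,
    intervalIntegral.mul_integral_comp_mul_right, zero_mul, one_mul]

/-- A mean increment of the conditional distribution function, written with the density. -/
lemma IsCondDensity.integral_indicator_sub {Y : Ω → ℝ} {U : Ω → T} {f : ℝ → T → ℝ}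
    (hf : IsCondDensity μ Y U f) (hY : Measurable Y) (hU : Measurable U)
    {φ k : T → ℝ} (hφ : Measurable φ) (hk : Measurable k)
    (hki : Integrable (fun ω => k (U ω)) μ) {C : ℝ≥0∞} (hC : C ≠ ⊤)
    (hbd : ∀ s ∈ Icc (0 : ℝ) 1,
      ∫⁻ ω, ENNReal.ofReal (f (s * φ (U ω)) (U ω) * |φ (U ω) * k (U ω)|) ∂μ ≤ C) :
    IntervalIntegrable (fun s => ∫ ω, f (s * φ (U ω)) (U ω) * (φ (U ω) * k (U ω)) ∂μ) volume 0 1 ∧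
    ∫ ω, ((if Y ω ≤ φ (U ω) then 1 else 0) - if Y ω ≤ 0 then 1 else 0) * k (U ω) ∂μ
      = ∫ s in (0 : ℝ)..1, ∫ ω, f (s * φ (U ω)) (U ω) * (φ (U ω) * k (U ω)) ∂μ := by
  set ν := μ.map U with hν
  have : IsProbabilityMeasure ν := Measure.isProbabilityMeasure_map hU.aemeasurable
  have hYU : Measurable fun ω => (Y ω, U ω) := hY.prodMk hU
  set g : ℝ × T → ℝ := fun p => ((if p.1 ≤ φ p.2 then 1 else 0) - if p.1 ≤ 0 then 1 else 0) * k p.2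
    with hg
  have hgm : Measurable g := by
    refine Measurable.mul (Measurable.sub ?_ ?_) (hk.comp measurable_snd)
    · exact Measurable.ite (measurableSet_le measurable_fst (hφ.comp measurable_snd))
        measurable_const measurable_const
    · exact Measurable.ite (measurableSet_le measurable_fst measurable_const)
        measurable_const measurable_const
  have hfm : Measurable fun p : ℝ × T => f p.1 p.2 := hf.measurable
  have hgi : Integrable (fun ω => g (Y ω, U ω)) μ := by
    refine hki.mono (hgm.comp hYU).aestronglyMeasurable (Eventually.of_forall fun ω => ?_)
    simp only [hg, norm_mul]
    refine mul_le_of_le_one_left (norm_nonneg _) ?_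
    split_ifs <;> simp
  have hgi' : Integrable (fun p : ℝ × T => f p.1 p.2 * g p) (volume.prod ν) := by
    have h1 := (integrable_map_measure (μ := μ) hgm.aestronglyMeasurable hYU.aemeasurable).2 hgi
    rw [hf.law, integrable_withDensity_iff_integrable_smul₀'
      hfm.ennreal_ofReal.aemeasurable (Eventually.of_forall fun _ => ENNReal.ofReal_lt_top)] at h1
    refine h1.congr (Eventually.of_forall fun p => ?_)
    dsimp only
    rw [ENNReal.toReal_ofReal (hf.nonneg _ _), smul_eq_mul]
  have h1 : ∫ ω, g (Y ω, U ω) ∂μ = ∫ p, f p.1 p.2 * g p ∂(volume.prod ν) := by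
    rw [← integral_map hYU.aemeasurable hgm.aestronglyMeasurable, hf.law,
      integral_withDensity_eq_integral_toReal_smul hfm.ennreal_ofReal
      (Eventually.of_forall fun _ => ENNReal.ofReal_lt_top)]
    refine integral_congr_ae (Eventually.of_forall fun p => ?_)
    dsimp only
    rw [ENNReal.toReal_ofReal (hf.nonneg _ _), smul_eq_mul]
  have h2 : ∀ u, ∫ e, f e u * g (e, u) = ∫ s in (0 : ℝ)..1, f (s * φ u) u * (φ u * k u) := by
    intro u
    simp only [hg, ← mul_assoc]
    rw [integral_mul_const, integral_mul_indicator_sub_eq_unit (fun e => f e u),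
      ← intervalIntegral.integral_mul_const]
  have hFm : Measurable fun p : T × ℝ => f (p.2 * φ p.1) p.1 * (φ p.1 * k p.1) := by
    refine Measurable.mul ?_ ?_
    · exact hfm.comp ((measurable_snd.mul (hφ.comp measurable_fst)).prodMk measurable_fst)
    · exact (hφ.comp measurable_fst).mul (hk.comp measurable_fst)
  -- The bound `hbd` holds for each `s` with the same constant, so integrating it over the unit
  -- interval gives joint integrability and allows the order of integration to be exchanged.
  have hFi : Integrable (Function.uncurry fun u s => f (s * φ u) u * (φ u * k u))
      (ν.prod (volume.restrict (uIoc (0 : ℝ) 1))) := by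
    refine ⟨hFm.aestronglyMeasurable, ?_⟩
    rw [hasFiniteIntegral_iff_norm, lintegral_prod_symm _ (by fun_prop)]
    have h3 : ∀ s ∈ uIoc (0 : ℝ) 1, ∫⁻ u, ENNReal.ofReal
        ‖Function.uncurry (fun u s => f (s * φ u) u * (φ u * k u)) (u, s)‖ ∂ν ≤ C := by
      intro s hs
      rw [uIoc_of_le zero_le_one] at hs
      rw [hν, lintegral_map (by fun_prop) hU]
      refine le_trans (lintegral_mono fun ω => ?_) (hbd s ⟨hs.1.le, hs.2⟩)
      simp only [Function.uncurry_apply_pair, norm_mul, Real.norm_of_nonneg (hf.nonneg _ _),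
        abs_mul, Real.norm_eq_abs]
      exact le_rfl
    refine (setLIntegral_mono' measurableSet_uIoc h3).trans_lt ?_
    rw [setLIntegral_const, uIoc_of_le zero_le_one, Real.volume_Ioc]
    exact ENNReal.mul_lt_top (lt_top_iff_ne_top.2 hC) ENNReal.ofReal_lt_top
  have h5 : ∀ s, ∫ ω, f (s * φ (U ω)) (U ω) * (φ (U ω) * k (U ω)) ∂μ
      = ∫ u, f (s * φ u) u * (φ u * k u) ∂ν := by
    intro s
    rw [hν, integral_map hU.aemeasurable]
    exact ((hFm.comp (measurable_id.prodMk measurable_const) : Measurable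
      fun u => f (s * φ u) u * (φ u * k u))).aestronglyMeasurable
  simp_rw [h5]
  constructor
  · rw [intervalIntegrable_iff]
    exact hFi.integral_prod_right
  · change ∫ ω, g (Y ω, U ω) ∂μ = _
    rw [h1, integral_prod_symm _ hgi']
    simp_rw [h2]
    exact (intervalIntegral_integral_swap (μ := ν) (a := (0 : ℝ)) (b := 1)
      (f := fun s u => f (s * φ u) u * (φ u * k u)) hFi.swap).symm

/-- The part of the score with threshold zero has mean zero by the quantile restriction, so only the
increment of the indicator contributes. -/
lemma IsCondDensity.integral_quantile_sub_indicator {Y : Ω → ℝ} {U : Ω → T} {f : ℝ → T → ℝ}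
    (hf : IsCondDensity μ Y U f) (hY : Measurable Y) (hU : Measurable U) {τ : ℝ}
    (h : μ[{ω | Y ω ≤ 0}.indicator (fun _ => (1 : ℝ)) | MeasurableSpace.comap U inferInstance]
      =ᵐ[μ] fun _ => τ)
    {φ k : T → ℝ} (hφ : Measurable φ) (hk : Measurable k)
    (hki : Integrable (fun ω => k (U ω)) μ) {C : ℝ≥0∞} (hC : C ≠ ⊤)
    (hbd : ∀ s ∈ Icc (0 : ℝ) 1,
      ∫⁻ ω, ENNReal.ofReal (f (s * φ (U ω)) (U ω) * |φ (U ω) * k (U ω)|) ∂μ ≤ C) :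
    IntervalIntegrable (fun s => ∫ ω, f (s * φ (U ω)) (U ω) * (φ (U ω) * k (U ω)) ∂μ) volume 0 1 ∧
    ∫ ω, (τ - if Y ω ≤ φ (U ω) then 1 else 0) * k (U ω) ∂μ
      = -∫ s in (0 : ℝ)..1, ∫ ω, f (s * φ (U ω)) (U ω) * (φ (U ω) * k (U ω)) ∂μ := by
  obtain ⟨hint, heq⟩ := hf.integral_indicator_sub hY hU hφ hk hki hC hbd
  refine ⟨hint, ?_⟩
  rw [← heq]
  have hi : ∀ ψ : Ω → ℝ, Measurable ψ →
      Integrable (fun ω => (if Y ω ≤ ψ ω then (1 : ℝ) else 0) * k (U ω)) μ := fun ψ hψ => by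
    refine (hki.indicator (measurableSet_le hY hψ)).congr (Eventually.of_forall fun ω => ?_)
    simp [indicator_apply]
  have h1 := integral_quantile_mul hY hU h hk hki
  have h2 := hi _ (hφ.comp hU)
  have h3 := hi _ (measurable_const (a := (0 : ℝ)))
  simp only [sub_mul, Function.comp_apply] at h1 h2 h3 ⊢
  rw [integral_sub (hki.const_mul τ) h3] at h1
  rw [integral_sub (hki.const_mul τ) h2, integral_sub h2 h3]
  linarith

end CondDensity

/-! ### Matrices as operators on Euclidean space -/

section MatOp

variable {k : Type*} [Fintype k] [DecidableEq k]

/-- A square matrix as an operator on Euclidean space. -/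
noncomputable abbrev matOp (A : Matrix k k ℝ) : EuclideanSpace ℝ k →L[ℝ] EuclideanSpace ℝ k :=
  Matrix.toEuclideanCLM (𝕜 := ℝ) A

lemma matOp_add (A B : Matrix k k ℝ) : matOp (A + B) = matOp A + matOp B := map_add _ _ _

lemma matOp_smul (c : ℝ) (A : Matrix k k ℝ) : matOp (c • A) = c • matOp A := map_smul _ _ _

lemma norm_matOp (A : Matrix k k ℝ) : ‖matOp A‖ = ‖A‖ := Matrix.l2_opNorm_toEuclideanCLM A

lemma norm_matOp_apply_le (A : Matrix k k ℝ) (x : EuclideanSpace ℝ k) :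
    ‖matOp A x‖ ≤ ‖A‖ * ‖x‖ := by
  rw [← norm_matOp]; exact (matOp A).le_opNorm x

lemma inner_matOp_outerProd (ψ x y : EuclideanSpace ℝ k) :
    inner ℝ x (matOp (outerProd ψ) y) = inner ℝ x ψ * inner ℝ ψ y := by
  rw [Matrix.inner_toEuclideanCLM, outerProd, Matrix.vecMulVec_mulVec]
  simp only [EuclideanSpace.inner_eq_star_dotProduct, star_trivial, dotProduct_smul,
    MulOpposite.smul_eq_mul_unop, MulOpposite.unop_op, dotProduct_comm]

/-- The bilinear form `xᵀ A y` as a continuous linear function of `A`. -/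
noncomputable def bilinEval (x y : EuclideanSpace ℝ k) : Matrix k k ℝ →L[ℝ] ℝ :=
  LinearMap.mkContinuous
    { toFun := fun A => inner ℝ x (matOp A y)
      map_add' := fun A B => by rw [matOp_add, add_apply, inner_add_right]
      map_smul' := fun c A => by rw [matOp_smul, smul_apply, inner_smul_right]; rfl }
    (‖x‖ * ‖y‖) fun A => by
      change ‖inner ℝ x (matOp A y)‖ ≤ _
      refine (norm_inner_le_norm x _).trans ?_
      calc ‖x‖ * ‖matOp A y‖ ≤ ‖x‖ * (‖A‖ * ‖y‖) := by gcongr; exact norm_matOp_apply_le A y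
        _ = _ := by ring

lemma bilinEval_apply (x y : EuclideanSpace ℝ k) (A : Matrix k k ℝ) :
    bilinEval x y A = inner ℝ x (matOp A y) := rfl

lemma abs_bilinEval_le (x y : EuclideanSpace ℝ k) (A : Matrix k k ℝ) :
    |bilinEval x y A| ≤ ‖A‖ * (‖x‖ * ‖y‖) := by
  rw [bilinEval_apply]
  refine (abs_real_inner_le_norm x _).trans ?_
  calc ‖x‖ * ‖matOp A y‖ ≤ ‖x‖ * (‖A‖ * ‖y‖) := by gcongr; exact norm_matOp_apply_le A y
        _ = _ := by ring

end MatOp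

/-! ### Stacked vectors -/

section Stack

variable {dw dφ : ℕ}

lemma inner_stack (r r' : Vec dw) (t t' : Vec dφ) :
    inner ℝ (stack r t) (stack r' t') = inner ℝ r r' + inner ℝ t t' := by
  simp [stack, PiLp.inner_apply]

lemma measurable_stack : Measurable fun p : Vec dw × Vec dφ => stack p.1 p.2 := by
  refine (WithLp.measurable_toLp 2 _).comp (measurable_pi_iff.2 fun a => ?_)
  rcases a with a | a
  · exact (by fun_prop : Measurable fun p : Vec dw × Vec dφ => p.1 a)
  · exact (by fun_prop : Measurable fun p : Vec dw × Vec dφ => p.2 a)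

end Stack

/-! ### Linear expansion of the cluster scores -/

namespace IVQR

variable {Ω : Type*} {J dw dz dφ : ℕ} {Υ : Set ℝ} {M : IVQR Ω J dw dz dφ Υ}

section Algebra

lemma resid_stack_add (φ : InstrFun J dw dz dφ Υ) (j : Fin J) (τ : Υ) (n i : ℕ) (ω : Ω)
    (v : StackVec dw dφ) :
    resid φ j τ (M.obs n j i ω) (M.βn n τ) (stack (M.γn n τ) 0 + v)
      = M.err n j i τ ω - inner ℝ (regressor φ j τ (M.obs n j i ω)) v := by
  rw [resid, inner_add_right, err]
  have : inner ℝ (regressor φ j τ (M.obs n j i ω)) (stack (M.γn n τ) 0)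
      = inner ℝ (M.obs n j i ω).w (M.γn n τ) := by
    rw [regressor, inner_stack, inner_zero_right, add_zero]
  rw [this]; ring

lemma shift_smul_toLp (φ : InstrFun J dw dz dφ Υ) (j : Fin J) (τ : Υ) (d : Obs dw dz) (s : ℝ)
    (v : StackVec dw dφ) :
    shift φ j τ d (s • WithLp.toLp 2 ((0 : ℝ), v)) = s * inner ℝ (regressor φ j τ d) v := by
  simp [shift, inner_smul_right]

lemma bilinEval_jacΨΨ (φ : InstrFun J dw dz dφ Υ) (V : WeightFun J dw dz Υ) (j : Fin J) (τ : Υ)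
    (f : ℝ → Vec dw × Vec dz → ℝ) (δ : ℝ) (d : Obs dw dz) (x y : StackVec dw dφ) :
    bilinEval x y (jacΨΨ φ V j τ f δ d) = f δ (d.w, d.z) * V j τ d.w d.z *
      (inner ℝ (regressor φ j τ d) x * inner ℝ (regressor φ j τ d) y) := by
  rw [jacΨΨ, map_smul, bilinEval_apply, inner_matOp_outerProd, smul_eq_mul,
    real_inner_comm (regressor φ j τ d) x]

lemma avg_sub {E : Type*} [AddCommGroup E] [Module ℝ E] (n : ℕ) (j : Fin J)
    (h h' : Obs dw dz → E) (ω : Ω) :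
    M.avg n j (fun d => h d - h' d) ω = M.avg n j h ω - M.avg n j h' ω := by
  rw [avg, avg, avg, ← smul_sub, ← Finset.sum_sub_distrib]

lemma inner_score (φ : InstrFun J dw dz dφ Υ) (V : WeightFun J dw dz Υ) (n : ℕ) (j : Fin J) (i : ℕ)
    (τ : Υ) (ω : Ω) (v x : StackVec dw dφ) :
    inner ℝ x (score φ V j τ (M.obs n j i ω) (M.βn n τ) (stack (M.γn n τ) 0 + v))
      = ((τ : ℝ) - if M.err n j i τ ω ≤ inner ℝ (regressor φ j τ (M.obs n j i ω)) v then 1 else 0) *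
        (V j τ (M.obs n j i ω).w (M.obs n j i ω).z
          * inner ℝ (regressor φ j τ (M.obs n j i ω)) x) := by
  rw [score, inner_smul_right, resid_stack_add, real_inner_comm x]
  simp only [sub_nonpos]
  ring

end Algebra

variable [MeasurableSpace Ω] {μ : Measure Ω}

lemma popAvg'_clm {E F : Type*} [NormedAddCommGroup E] [NormedSpace ℝ E] [CompleteSpace E]
    [NormedAddCommGroup F] [NormedSpace ℝ F] [CompleteSpace F] (L : E →L[ℝ] F) {n : ℕ} {j : Fin J}
    {h : ℕ → Obs dw dz → E} (hi : M.PopInt' μ n j h) :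
    L (M.popAvg' μ n j h) = M.popAvg' μ n j (fun i d => L (h i d)) := by
  rw [popAvg', popAvg', map_smul, map_sum]
  congr 1
  exact Finset.sum_congr rfl fun i hi' =>
    (L.integral_comp_comm (hi i (Finset.mem_range.1 hi'))).symm

lemma popAvg_clm {E F : Type*} [NormedAddCommGroup E] [NormedSpace ℝ E] [CompleteSpace E]
    [NormedAddCommGroup F] [NormedSpace ℝ F] [CompleteSpace F] (L : E →L[ℝ] F) {n : ℕ} {j : Fin J}
    {h : Obs dw dz → E} (hi : M.PopInt μ n j h) :
    L (M.popAvg μ n j h) = M.popAvg μ n j (fun d => L (h d)) :=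
  popAvg'_clm L (h := fun _ => h) hi

lemma popAvg_sub {E : Type*} [NormedAddCommGroup E] [NormedSpace ℝ E] {n : ℕ} {j : Fin J}
    {h h' : Obs dw dz → E} (hi : M.PopInt μ n j h) (hi' : M.PopInt μ n j h') :
    M.popAvg μ n j (fun d => h d - h' d) = M.popAvg μ n j h - M.popAvg μ n j h' := by
  rw [popAvg, popAvg, popAvg, ← smul_sub, ← Finset.sum_sub_distrib]
  congr 1
  exact Finset.sum_congr rfl fun i hi'' => integral_sub (hi i (Finset.mem_range.1 hi''))
    (hi' i (Finset.mem_range.1 hi''))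

lemma Setup.measurable_err (hM : M.Setup μ) (n : ℕ) (j : Fin J) (i : ℕ) (τ : Υ) : Measurable (M.err n j i τ) := by
  have h := hM.measurable_obs n j i
  have hy : Measurable fun ω => (M.obs n j i ω).y := measurable_fst.comp h
  have hx : Measurable fun ω => (M.obs n j i ω).x := (measurable_fst.comp measurable_snd).comp h
  have hw : Measurable fun ω => (M.obs n j i ω).w :=
    ((measurable_fst.comp measurable_snd).comp measurable_snd).comp h
  exact (hy.sub (hx.mul_const _)).sub (hw.inner measurable_const)

lemma Setup.measurable_exog (hM : M.Setup μ) (n : ℕ) (j : Fin J) (i : ℕ) : Measurable (M.exog n j i) := by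
  have h := hM.measurable_obs n j i
  exact (((measurable_fst.comp measurable_snd).comp measurable_snd).comp h).prodMk
    (((measurable_snd.comp measurable_snd).comp measurable_snd).comp h)

lemma measurable_instr_stack {φ : InstrFun J dw dz dφ Υ} {j : Fin J} {τ : Υ}
    (hφ : Measurable (Function.uncurry (φ j τ))) :
    Measurable fun u : Vec dw × Vec dz => stack u.1 (φ j τ u.1 u.2) :=
  measurable_stack.comp (measurable_fst.prodMk hφ)

/-- The factor `τ - 1{·}` is bounded away from zero by `min τ (1 - τ)`, so integrability of the
score passes to the regressor times weight. -/
lemma integrable_of_quantile_mul {Y : Ω → ℝ} {τ : ℝ} (hτ : τ ∈ Ioo (0 : ℝ) 1) {k : Ω → ℝ}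
    (hk : AEStronglyMeasurable k μ) {p : Ω → ℝ}
    (h : Integrable (fun ω => (τ - if Y ω ≤ p ω then 1 else 0) * k ω) μ) : Integrable k μ := by
  have hm : 0 < min τ (1 - τ) := lt_min hτ.1 (by linarith [hτ.2])
  refine (h.const_mul (min τ (1 - τ))⁻¹).mono hk (Eventually.of_forall fun ω => ?_)
  rw [norm_mul, norm_mul, norm_inv, Real.norm_of_nonneg hm.le, ← mul_assoc]
  refine le_mul_of_one_le_left (norm_nonneg _) ?_
  rw [inv_mul_eq_div, one_le_div hm, Real.norm_eq_abs]
  split_ifs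
  · rw [abs_of_neg (by linarith [hτ.2])]; exact (min_le_right _ _).trans (by linarith)
  · rw [sub_zero, abs_of_pos hτ.1]; exact min_le_left _ _

lemma ModelAssumption.quantile_err {𝓑 : Set ℝ} {𝓡 : Set (Vec dw)} {𝓣 : Set (Vec dφ)}
    (hmodel : M.ModelAssumption μ 𝓑 𝓡 𝓣) {n : ℕ} {j : Fin J} {i : ℕ} (hi : i < M.size n j) (τ : Υ) :
    μ[{ω | M.err n j i τ ω ≤ 0}.indicator (fun _ => (1 : ℝ)) |
      MeasurableSpace.comap (M.exog n j i) inferInstance] =ᵐ[μ] fun _ => (τ : ℝ) := by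
  have := hmodel.quantile n j i hi τ
  convert this using 5 with ω
  rw [err]
  constructor <;> intro h <;> linarith

section Linearization

variable [IsProbabilityMeasure μ] {𝓑 : Set ℝ} {𝓡 : Set (Vec dw)} {𝓣 : Set (Vec dφ)}
  {fε : ℕ → Fin J → ℕ → Υ → ℝ → Vec dw × Vec dz → ℝ}

lemma popAvg_score_eq_zero (hM : M.Setup μ) (hmodel : M.ModelAssumption μ 𝓑 𝓡 𝓣) (n : ℕ)
    (j : Fin J) (τ : Υ) :
    M.popAvg μ n j (fun d => score M.Φ M.V j τ d (M.βn n τ) (stack (M.γn n τ) 0)) = 0 := by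
  rw [popAvg, Finset.sum_eq_zero, smul_zero]
  intro i hi
  have hi' := Finset.mem_range.1 hi
  have hint := hM.integrable_score n j (M.βn n τ) τ (stack (M.γn n τ) 0) i hi'
  refine ext_inner_left ℝ fun x => ?_
  rw [← integral_inner hint, inner_zero_right]
  have hint' := hint.const_inner (𝕜 := ℝ) x
  have hsc := fun ω => inner_score (M := M) M.Φ M.V n j i τ ω 0 x
  simp only [add_zero, inner_zero_right] at hsc
  simp_rw [hsc] at hint' ⊢
  set k : Vec dw × Vec dz → ℝ := fun u => M.V j τ u.1 u.2 * inner ℝ (stack u.1 (M.Φ j τ u.1 u.2)) x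
  have hk : Measurable k := (hM.measurable_V j τ).mul
    ((measurable_instr_stack (hM.measurable_Φ j τ)).inner measurable_const)
  exact integral_quantile_mul (hM.measurable_err n j i τ) (hM.measurable_exog n j i)
    (hmodel.quantile_err hi' τ) hk (integrable_of_quantile_mul (hM.subset τ.2)
      (hk.comp (hM.measurable_exog n j i)).aestronglyMeasurable hint')

/-- The population score with (frozen) instruments `φ` and weights `V` is approximately linear
if its Jacobians are close to a fixed matrix. -/
lemma norm_popAvg_score_add_le (hM : M.Setup μ) (hmodel : M.ModelAssumption μ 𝓑 𝓡 𝓣)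
    {φ : InstrFun J dw dz dφ Υ} {V : WeightFun J dw dz Υ} {n : ℕ} {j : Fin J} {τ : Υ}
    (hφ : Measurable (Function.uncurry (φ j τ))) (hV : Measurable (Function.uncurry (V j τ)))
    (hV0 : ∀ w z, 0 ≤ V j τ w z)
    (hf : ∀ i < M.size n j, IsCondDensity μ (M.err n j i τ) (M.exog n j i) (fε n j i τ))
    {Q : Matrix (Fin dw ⊕ Fin dφ) (Fin dw ⊕ Fin dφ) ℝ} {ε : ℝ} {v : StackVec dw dφ}
    (hjac : ∀ s ∈ Icc (0 : ℝ) 1,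
      M.PopInt' μ n j (fun i d => jacΨΨ φ V j τ (fε n j i τ)
        (shift φ j τ d (s • WithLp.toLp 2 ((0 : ℝ), v))) d) ∧
      ‖M.popAvg' μ n j (fun i d => jacΨΨ φ V j τ (fε n j i τ)
        (shift φ j τ d (s • WithLp.toLp 2 ((0 : ℝ), v))) d) - Q‖ < ε)
    (hint : M.PopInt μ n j
      (fun d => score φ V j τ d (M.βn n τ) (stack (M.γn n τ) 0 + v))) :
    ‖M.popAvg μ n j (fun d => score φ V j τ d (M.βn n τ) (stack (M.γn n τ) 0 + v))
      + matOp Q v‖ ≤ ε * ‖v‖ := by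
  have : CompleteSpace (Matrix (Fin dw ⊕ Fin dφ) (Fin dw ⊕ Fin dφ) ℝ) :=
    FiniteDimensional.complete ℝ _
  set jac : ℝ → ℕ → Obs dw dz → Matrix (Fin dw ⊕ Fin dφ) (Fin dw ⊕ Fin dφ) ℝ := fun s i d =>
    jacΨΨ φ V j τ (fε n j i τ) (shift φ j τ d (s • WithLp.toLp 2 ((0 : ℝ), v))) d with hjacdef
  have hε : 0 < ε := (norm_nonneg _).trans_lt (hjac 0 (by simp)).2
  -- The norm is recovered from the inner products by taking `x` to be the vector itself; scalar
  -- forms are needed to apply the lemma on conditional densities.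
  suffices h : ∀ x, inner ℝ x (M.popAvg μ n j
      (fun d => score φ V j τ d (M.βn n τ) (stack (M.γn n τ) 0 + v)) + matOp Q v)
        ≤ ε * (‖x‖ * ‖v‖) by
    set y := M.popAvg μ n j (fun d => score φ V j τ d (M.βn n τ) (stack (M.γn n τ) 0 + v))
      + matOp Q v
    have h1 := h y
    rw [real_inner_self_eq_norm_sq] at h1
    rcases eq_or_lt_of_le (norm_nonneg y) with h0 | h0
    · rw [← h0]; positivity
    · nlinarith
  intro x
  -- Only the cluster average of the Jacobian is controlled. Its diagonal forms are nonnegative, so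
  -- the expectation of one unit is at most the cluster size times the average form, itself at most
  -- `(‖Q‖ + ε) * ‖y‖ ^ 2`.
  have hjac0 : ∀ s ∈ Icc (0 : ℝ) 1, ∀ i < M.size n j, ∀ y : StackVec dw dφ,
      ∫⁻ ω, ENNReal.ofReal (bilinEval y y (jac s i (M.obs n j i ω))) ∂μ
        ≤ ENNReal.ofReal (M.size n j * ((‖Q‖ + ε) * (‖y‖ * ‖y‖))) := by
    intro s hs i hi y
    have hnn : ∀ i < M.size n j, ∀ ω, 0 ≤ bilinEval y y (jac s i (M.obs n j i ω)) := by
      intro i hi ω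
      rw [hjacdef, bilinEval_jacΨΨ]
      exact mul_nonneg (mul_nonneg ((hf i hi).nonneg _ _) (hV0 _ _)) (mul_self_nonneg _)
    have hI : ∀ i < M.size n j, Integrable (fun ω => bilinEval y y (jac s i (M.obs n j i ω))) μ :=
      fun i hi => (bilinEval y y).integrable_comp ((hjac s hs).1 i hi)
    rw [← ofReal_integral_eq_lintegral_ofReal (hI i hi) (Eventually.of_forall (hnn i hi))]
    refine ENNReal.ofReal_le_ofReal ?_
    have h1 := popAvg'_clm (bilinEval y y) (hjac s hs).1
    have h2 : bilinEval y y (M.popAvg' μ n j (jac s)) ≤ (‖Q‖ + ε) * (‖y‖ * ‖y‖) := by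
      refine (le_abs_self _).trans ((abs_bilinEval_le _ _ _).trans ?_)
      gcongr
      have := norm_add_le (M.popAvg' μ n j (jac s) - Q) Q
      rw [sub_add_cancel] at this
      linarith [(hjac s hs).2]
    have hsz : (0 : ℝ) < M.size n j := by exact_mod_cast (Nat.zero_le i).trans_lt hi
    rw [h1, popAvg', smul_eq_mul, inv_mul_le_iff₀ hsz] at h2
    refine le_trans ?_ h2
    exact Finset.single_le_sum (f := fun i => ∫ ω, bilinEval y y (jac s i (M.obs n j i ω)) ∂μ)
      (fun i hi => integral_nonneg (hnn i (Finset.mem_range.1 hi))) (Finset.mem_range.2 hi)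
  -- the score in each unit as an integral of Jacobians
  have hunit : ∀ i < M.size n j,
      IntervalIntegrable (fun s => ∫ ω, bilinEval x v (jac s i (M.obs n j i ω)) ∂μ) volume 0 1 ∧
      ∫ ω, inner ℝ x (score φ V j τ (M.obs n j i ω) (M.βn n τ) (stack (M.γn n τ) 0 + v)) ∂μ
        = -∫ s in (0 : ℝ)..1, ∫ ω, bilinEval x v (jac s i (M.obs n j i ω)) ∂μ := by
    intro i hi
    set p : Vec dw × Vec dz → ℝ := fun u => inner ℝ (stack u.1 (φ j τ u.1 u.2)) v with hp
    set k : Vec dw × Vec dz → ℝ := fun u => V j τ u.1 u.2 * inner ℝ (stack u.1 (φ j τ u.1 u.2)) x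
      with hk
    have hpm : Measurable p := (measurable_instr_stack hφ).inner measurable_const
    have hkm : Measurable k := hV.mul ((measurable_instr_stack hφ).inner measurable_const)
    have hsc := fun ω => inner_score (M := M) φ V n j i τ ω v x
    have hint' := (hint i hi).const_inner (𝕜 := ℝ) x
    simp_rw [hsc] at hint' ⊢
    have hjk : ∀ s ω, bilinEval x v (jac s i (M.obs n j i ω))
        = fε n j i τ (s * p (M.exog n j i ω)) (M.exog n j i ω)
          * (p (M.exog n j i ω) * k (M.exog n j i ω)) := by
      intro s ω
      simp only [hjacdef, bilinEval_jacΨΨ, shift_smul_toLp, hp, hk, exog, regressor]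
      ring
    simp_rw [hjk]
    refine (hf i hi).integral_quantile_sub_indicator (hM.measurable_err n j i τ)
      (hM.measurable_exog n j i) (hmodel.quantile_err hi τ) hpm hkm
      (integrable_of_quantile_mul (hM.subset τ.2)
        (hkm.comp (hM.measurable_exog n j i)).aestronglyMeasurable hint')
      (C := ENNReal.ofReal (M.size n j * ((‖Q‖ + ε) * (‖x‖ * ‖x‖)))
        + ENNReal.ofReal (M.size n j * ((‖Q‖ + ε) * (‖v‖ * ‖v‖)))) (by finiteness) ?_
    intro s hs
    -- The mixed form in `x` and `v` is dominated by the two diagonal ones, since `|a| * |b| ≤ b * b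
    -- + a * a`.
    refine le_trans ?_ (add_le_add (hjac0 s hs i hi x) (hjac0 s hs i hi v))
    have hxm : AEMeasurable (fun ω => ENNReal.ofReal (bilinEval x x (jac s i (M.obs n j i ω)))) μ :=
      ((bilinEval x x).integrable_comp
        ((hjac s hs).1 i hi)).aestronglyMeasurable.aemeasurable.ennreal_ofReal
    rw [← lintegral_add_left' hxm]
    refine lintegral_mono fun ω => ?_
    rw [← ENNReal.ofReal_add]
    · refine ENNReal.ofReal_le_ofReal ?_
      simp only [hjacdef, bilinEval_jacΨΨ, shift_smul_toLp, hp, hk, exog, regressor]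
      set ψ := stack (M.obs n j i ω).w (φ j τ (M.obs n j i ω).w (M.obs n j i ω).z)
      have h1 := (hf i hi).nonneg (s * inner ℝ ψ v) ((M.obs n j i ω).w, (M.obs n j i ω).z)
      have h2 := hV0 (M.obs n j i ω).w (M.obs n j i ω).z
      rw [abs_mul, abs_mul, abs_of_nonneg h2]
      set a := inner ℝ ψ v
      set b := inner ℝ ψ x
      have h3 : |a| * |b| ≤ b * b + a * a := by
        nlinarith [sq_nonneg (|a| - |b|), abs_mul_abs_self a, abs_mul_abs_self b,
          mul_self_nonneg a, mul_self_nonneg b]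
      have h4 := mul_le_mul_of_nonneg_left h3 (mul_nonneg h1 h2)
      linarith
    · rw [hjacdef, bilinEval_jacΨΨ]
      exact mul_nonneg (mul_nonneg ((hf i hi).nonneg _ _) (hV0 _ _)) (mul_self_nonneg _)
    · rw [hjacdef, bilinEval_jacΨΨ]
      exact mul_nonneg (mul_nonneg ((hf i hi).nonneg _ _) (hV0 _ _)) (mul_self_nonneg _)
  have hjacint : ∀ s ∈ Icc (0 : ℝ) 1, bilinEval x v (M.popAvg' μ n j (jac s))
      = (M.size n j : ℝ)⁻¹ * ∑ i ∈ Finset.range (M.size n j),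
        ∫ ω, bilinEval x v (jac s i (M.obs n j i ω)) ∂μ := fun s hs =>
    popAvg'_clm (bilinEval x v) (hjac s hs).1
  have hleft : inner ℝ x (M.popAvg μ n j
      (fun d => score φ V j τ d (M.βn n τ) (stack (M.γn n τ) 0 + v)))
      = -∫ s in (0 : ℝ)..1, (M.size n j : ℝ)⁻¹ * ∑ i ∈ Finset.range (M.size n j),
        ∫ ω, bilinEval x v (jac s i (M.obs n j i ω)) ∂μ := by
    have h1 := popAvg_clm (innerSL ℝ x) hint
    simp only [innerSL_apply_apply] at h1
    rw [h1, popAvg, smul_eq_mul, intervalIntegral.integral_const_mul,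
      intervalIntegral.integral_finsetSum fun i hi => (hunit i (Finset.mem_range.1 hi)).1,
      ← mul_neg, ← Finset.sum_neg_distrib]
    congr 1
    exact Finset.sum_congr rfl fun i hi => (hunit i (Finset.mem_range.1 hi)).2
  have hii : IntervalIntegrable (fun s => (M.size n j : ℝ)⁻¹ * ∑ i ∈ Finset.range (M.size n j),
        ∫ ω, bilinEval x v (jac s i (M.obs n j i ω)) ∂μ) volume 0 1 := by
    refine IntervalIntegrable.const_mul ?_ _
    have := IntervalIntegrable.sum (Finset.range (M.size n j))
      fun i hi => (hunit i (Finset.mem_range.1 hi)).1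
    refine this.congr fun s _ => ?_
    simp
  have hright : inner ℝ x (matOp Q v) = ∫ _ in (0 : ℝ)..1, bilinEval x v Q := by
    rw [intervalIntegral.integral_const, bilinEval_apply]; simp
  -- Writing `⟨x, Q v⟩` as an integral of a constant over the unit interval reduces the claim to
  -- comparing `Q` with the average Jacobian at each point of the segment.
  rw [inner_add_right, hleft, hright, neg_add_eq_sub,
    ← intervalIntegral.integral_sub intervalIntegrable_const hii]
  have hconst : ε * (‖x‖ * ‖v‖) = ∫ _ in (0 : ℝ)..1, ε * (‖x‖ * ‖v‖) := by simp
  rw [hconst]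
  refine intervalIntegral.integral_mono_on zero_le_one (intervalIntegrable_const.sub hii)
    intervalIntegrable_const fun s hs => ?_
  rw [← hjacint s hs, ← map_sub]
  refine (le_abs_self _).trans ((abs_bilinEval_le _ _ _).trans ?_)
  rw [norm_sub_rev]
  gcongr
  exact (hjac s hs).2.le

/-- Linear expansion of the estimated cluster scores. -/
lemma norm_avg_score_sub_add_le (hM : M.Setup μ) (hmodel : M.ModelAssumption μ 𝓑 𝓡 𝓣)
    (hf : ∀ n j, ∀ i < M.size n j, ∀ τ,
      IsCondDensity μ (M.err n j i τ) (M.exog n j i) (fε n j i τ))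
    {Q : Fin J → Υ → Matrix (Fin dw ⊕ Fin dφ) (Fin dw ⊕ Fin dφ) ℝ} {ε δ : ℝ} {n : ℕ} {ω : Ω}
    (hinc : ∀ j τ v, ‖v‖ ≤ δ → M.ScoreIncrementLT μ ε n ω j τ v)
    (hjac : ∀ j τ v, ‖v‖ ≤ δ → M.JacΨΨClose μ fε (Q j τ) ε n ω j τ v)
    (j : Fin J) (τ : Υ) {v : StackVec dw dφ} (hv : ‖v‖ ≤ δ) :
    ‖M.avg n j (fun d => score (M.Φhat n ω) (M.Vhat n ω) j τ d (M.βn n τ)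
        (stack (M.γn n τ) 0 + v)) ω
      - M.avg n j (fun d => score M.Φ M.V j τ d (M.βn n τ) (stack (M.γn n τ) 0)) ω
      + matOp (Q j τ) v‖ ≤ ε * (1 / M.r n + ‖v‖) := by
  have hr := hM.r_pos n
  have hnorm : ‖(WithLp.toLp 2 ((0 : ℝ), v) : WithLp 2 (ℝ × StackVec dw dφ))‖ = ‖v‖ :=
    by simp
  -- Only directions with `v_b = 0` are used: the coefficient of the endogenous regressor stays
  -- fixed, so no identification of it is required.
  have hinc' := hinc j τ (WithLp.toLp 2 ((0 : ℝ), v)) (hnorm ▸ hv)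
  simp only [ScoreIncrementLT, WithLp.toLp_fst, WithLp.toLp_snd, add_zero] at hinc'
  obtain ⟨hi, hlt⟩ := hinc'
  have hi0 := hM.integrable_score n j (M.βn n τ) τ (stack (M.γn n τ) 0)
  have hi1 : M.PopInt μ n j (fun d => score (M.Φhat n ω) (M.Vhat n ω) j τ d (M.βn n τ)
      (stack (M.γn n τ) 0 + v)) := fun i hin => by
    have := (hi i hin).add (hi0 i hin)
    refine this.congr (Eventually.of_forall fun ω' => ?_)
    simp
  rw [avg_sub, popAvg_sub hi1 hi0, popAvg_score_eq_zero hM hmodel, sub_zero, norm_smul,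
    Real.norm_of_nonneg hr.le] at hlt
  have hpop := norm_popAvg_score_add_le (Q := Q j τ) (ε := ε) (v := v) (fε := fε) hM hmodel
    (hM.measurable_Φhat n ω j τ) (hM.measurable_Vhat n ω j τ) (hM.Vhat_nonneg n ω j τ)
    (fun i hi => hf n j i hi τ) (fun s hs => by
      refine hjac j τ (s • WithLp.toLp 2 ((0 : ℝ), v)) ?_
      rw [norm_smul, hnorm, Real.norm_of_nonneg hs.1]
      exact (mul_le_of_le_one_left (norm_nonneg _) hs.2).trans hv) hi1
  set a := M.avg n j (fun d => score (M.Φhat n ω) (M.Vhat n ω) j τ d (M.βn n τ)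
        (stack (M.γn n τ) 0 + v)) ω
  set b := M.avg n j (fun d => score M.Φ M.V j τ d (M.βn n τ) (stack (M.γn n τ) 0)) ω
  set P := M.popAvg μ n j (fun d => score (M.Φhat n ω) (M.Vhat n ω) j τ d (M.βn n τ)
        (stack (M.γn n τ) 0 + v))
  have h1 : ‖a - b - P‖ ≤ ε * (1 / M.r n) := by
    rw [mul_one_div, le_div_iff₀ hr, mul_comm]
    exact hlt.le
  calc ‖a - b + matOp (Q j τ) v‖ = ‖(a - b - P) + (P + matOp (Q j τ) v)‖ := by congr 1; abel
    _ ≤ ε * (1 / M.r n) + ε * ‖v‖ := (norm_add_le _ _).trans (add_le_add h1 hpop)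
    _ = _ := by ring

end Linearization

end IVQR

/-! ### Symmetric and positive definite matrices -/

section PosDef

variable {k : Type*} [Fintype k] [DecidableEq k]

lemma rayleighBounds_iff {c C : ℝ} {A : Matrix k k ℝ} : RayleighBounds c C A ↔
    ∀ x : EuclideanSpace ℝ k, c * ‖x‖ ^ 2 ≤ inner ℝ x (matOp A x) ∧
      inner ℝ x (matOp A x) ≤ C * ‖x‖ ^ 2 := by
  have hx : ∀ x : EuclideanSpace ℝ k, x.ofLp ⬝ᵥ x.ofLp = ‖x‖ ^ 2 := fun x => by
    rw [← real_inner_self_eq_norm_sq, EuclideanSpace.inner_eq_star_dotProduct, star_trivial]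
  constructor
  · intro h x
    rw [Matrix.inner_toEuclideanCLM, ← hx]
    exact h x.ofLp
  · intro h x
    have := h (WithLp.toLp 2 x)
    rwa [Matrix.inner_toEuclideanCLM, ← hx] at this

lemma inner_matOp_comm {A : Matrix k k ℝ} (hA : A.IsSymm) (x y : EuclideanSpace ℝ k) :
    inner ℝ x (matOp A y) = inner ℝ y (matOp A x) := by
  rw [Matrix.inner_toEuclideanCLM, Matrix.inner_toEuclideanCLM, Matrix.dotProduct_mulVec,
    ← Matrix.mulVec_transpose, hA.eq, dotProduct_comm]

lemma isSymm_of_inner_matOp_comm {A : Matrix k k ℝ}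
    (h : ∀ x y : EuclideanSpace ℝ k, inner ℝ x (matOp A y) = inner ℝ y (matOp A x)) :
    A.IsSymm := by
  ext a b
  have := h (EuclideanSpace.single b 1) (EuclideanSpace.single a 1)
  simpa [Matrix.inner_toEuclideanCLM] using this

/-- By polarization `4 * ⟨y, A x⟩` is the difference of the quadratic forms at `x + y` and `x - y`.
With `y` the multiple of `A x` of norm `‖x‖`, the parallelogram law turns the bound on the forms
into a bound on `‖A x‖`. -/
lemma norm_le_of_isSymm {A : Matrix k k ℝ} (hA : A.IsSymm) {C : ℝ}
    (h : ∀ x : EuclideanSpace ℝ k, |inner ℝ x (matOp A x)| ≤ C * ‖x‖ ^ 2) (hC : 0 ≤ C) :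
    ‖A‖ ≤ C := by
  rw [← norm_matOp]
  refine ContinuousLinearMap.opNorm_le_bound _ hC fun x => ?_
  rcases eq_or_ne (matOp A x) 0 with h0 | h0
  · rw [h0, norm_zero]; positivity
  have hn : 0 < ‖matOp A x‖ := norm_pos_iff.2 h0
  set y := (‖x‖ / ‖matOp A x‖) • matOp A x with hy
  have hyn : ‖y‖ = ‖x‖ := by
    rw [hy, norm_smul, Real.norm_of_nonneg (by positivity)]; field_simp
  have h1 : inner ℝ y (matOp A x) = ‖x‖ * ‖matOp A x‖ := by
    rw [hy, real_inner_smul_left, real_inner_self_eq_norm_sq]; field_simp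
  have h2 : 4 * inner ℝ y (matOp A x)
      = inner ℝ (x + y) (matOp A (x + y)) - inner ℝ (x - y) (matOp A (x - y)) := by
    have := inner_matOp_comm hA x y
    simp only [map_add, map_sub, inner_add_left, inner_add_right, inner_sub_left, inner_sub_right]
    linarith
  have h3 := (le_abs_self _).trans (h (x + y))
  have h4 := (neg_le_abs _).trans (h (x - y))
  have h5 := parallelogram_law_with_norm ℝ x y
  have h6 : 4 * (‖x‖ * ‖matOp A x‖) ≤ 4 * (C * ‖x‖ ^ 2) := by
    rw [← h1, h2]
    rw [hyn] at h5
    nlinarith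
  rcases eq_or_lt_of_le (norm_nonneg x) with hx | hx
  · have : x = 0 := norm_eq_zero.1 hx.symm
    rw [this, map_zero] at h0
    exact absurd rfl h0
  · exact le_of_mul_le_mul_left (by linarith : ‖x‖ * ‖matOp A x‖ ≤ ‖x‖ * (C * ‖x‖)) hx

lemma RayleighBounds.norm_le {c C : ℝ} {A : Matrix k k ℝ} (h : RayleighBounds c C A)
    (hA : A.IsSymm) (hc : 0 ≤ c) : ‖A‖ ≤ |C| := by
  rw [rayleighBounds_iff] at h
  refine norm_le_of_isSymm hA (fun x => ?_) (abs_nonneg C)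
  have h0 : 0 ≤ inner ℝ x (matOp A x) := le_trans (by positivity) (h x).1
  rw [abs_of_nonneg h0]
  exact (h x).2.trans (by gcongr; exact le_abs_self C)

lemma norm_le_of_coercive {A : Matrix k k ℝ} {c : ℝ}
    (h : ∀ x : EuclideanSpace ℝ k, c * ‖x‖ ^ 2 ≤ inner ℝ x (matOp A x)) (x : EuclideanSpace ℝ k) :
    c * ‖x‖ ≤ ‖matOp A x‖ := by
  rcases eq_or_lt_of_le (norm_nonneg x) with hx | hx
  · rw [← hx, mul_zero]; exact norm_nonneg _
  · have h1 := (h x).trans (real_inner_le_norm x _)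
    exact le_of_mul_le_mul_left (by linarith : ‖x‖ * (c * ‖x‖) ≤ ‖x‖ * ‖matOp A x‖) hx

lemma isUnit_det_of_le_norm_matOp {A : Matrix k k ℝ} {c : ℝ} (hc : 0 < c)
    (h : ∀ x : EuclideanSpace ℝ k, c * ‖x‖ ≤ ‖matOp A x‖) : IsUnit A.det := by
  rw [isUnit_iff_ne_zero]
  intro hdet
  obtain ⟨v, hv, hAv⟩ := Matrix.exists_mulVec_eq_zero_iff.2 hdet
  have h1 := h (WithLp.toLp 2 v)
  rw [Matrix.toEuclideanCLM_toLp, hAv, WithLp.toLp_zero, norm_zero] at h1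
  have h2 : WithLp.toLp 2 v = (0 : EuclideanSpace ℝ k) := by
    rw [← norm_le_zero_iff]; nlinarith
  exact hv (by simpa using congrArg WithLp.ofLp h2)

lemma matOp_mul (A B : Matrix k k ℝ) (x : EuclideanSpace ℝ k) :
    matOp (A * B) x = matOp A (matOp B x) := by
  rw [matOp, map_mul]; rfl

lemma matOp_one (x : EuclideanSpace ℝ k) : matOp (1 : Matrix k k ℝ) x = x := by
  rw [matOp, map_one]; rfl

lemma norm_inv_le_of_le_norm_matOp {A : Matrix k k ℝ} {c : ℝ} (hc : 0 < c)
    (h : ∀ x : EuclideanSpace ℝ k, c * ‖x‖ ≤ ‖matOp A x‖) : ‖A⁻¹‖ ≤ 1 / c := by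
  rw [← norm_matOp]
  refine ContinuousLinearMap.opNorm_le_bound _ (by positivity) fun x => ?_
  have h1 := h (matOp A⁻¹ x)
  rw [← matOp_mul, Matrix.mul_nonsing_inv _ (isUnit_det_of_le_norm_matOp hc h), matOp_one] at h1
  rw [one_div, inv_mul_eq_div, le_div_iff₀ hc]
  linarith

/-- An approximate solution of a coercive linear equation is close to the exact one, the error being
divided by `c`. -/
lemma norm_sub_inv_apply_le {A : Matrix k k ℝ} {c : ℝ} (hc : 0 < c)
    (h : ∀ x : EuclideanSpace ℝ k, c * ‖x‖ ^ 2 ≤ inner ℝ x (matOp A x))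
    {a b : EuclideanSpace ℝ k} {e : ℝ} (hab : ‖matOp A a - b‖ ≤ e) :
    ‖a - matOp A⁻¹ b‖ ≤ e / c := by
  have h' := norm_le_of_coercive h
  have h1 := h' (a - matOp A⁻¹ b)
  rw [map_sub, ← matOp_mul, Matrix.mul_nonsing_inv _ (isUnit_det_of_le_norm_matOp hc h'),
    matOp_one] at h1
  rw [le_div_iff₀ hc]
  linarith

end PosDef

lemma matApply_eq {d : ℕ} (A : Matrix (Fin d) (Fin d) ℝ) (x : Vec d) : matApply A x = matOp A x :=
  rfl

/-! ### Blocks -/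

section Blocks

variable {dw dφ : ℕ}

/-- The projection on the second block as a linear map. -/
def lowerL : StackVec dw dφ →ₗ[ℝ] Vec dφ where
  toFun := lower
  map_add' _ _ := rfl
  map_smul' _ _ := rfl

lemma lowerL_apply (π : StackVec dw dφ) : lowerL π = lower π := rfl

@[simp] lemma lower_stack (r : Vec dw) (t : Vec dφ) : lower (stack r t) = t := rfl

@[simp] lemma stack_upper_lower (π : StackVec dw dφ) : stack (upper π) (lower π) = π := by
  ext a
  rcases a with a | a <;> rfl

lemma norm_sq_stack (r : Vec dw) (t : Vec dφ) : ‖stack r t‖ ^ 2 = ‖r‖ ^ 2 + ‖t‖ ^ 2 := by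
  rw [← real_inner_self_eq_norm_sq, inner_stack, real_inner_self_eq_norm_sq,
    real_inner_self_eq_norm_sq]

lemma norm_lower_le (π : StackVec dw dφ) : ‖lower π‖ ≤ ‖π‖ := by
  refine le_of_sq_le_sq ?_ (norm_nonneg _)
  conv_rhs => rw [← stack_upper_lower π, norm_sq_stack]
  exact le_add_of_nonneg_left (by positivity)

lemma norm_stack_upper_le (π : StackVec dw dφ) : ‖stack (upper π) (0 : Vec dφ)‖ ≤ ‖π‖ := by
  refine le_of_sq_le_sq ?_ (norm_nonneg _)
  conv_rhs => rw [← stack_upper_lower π, norm_sq_stack]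
  rw [norm_sq_stack, norm_zero]
  nlinarith [sq_nonneg ‖lower π‖]

/-- Orthogonality of controls and instruments acts through this identity: the instrument block of
the linearized score does not see the coefficients of the controls. -/
lemma lower_matOp {Q : Matrix (Fin dw ⊕ Fin dφ) (Fin dw ⊕ Fin dφ) ℝ} (hQ : Q.toBlocks₂₁ = 0)
    (π : StackVec dw dφ) : lower (matOp Q π) = matOp Q.toBlocks₂₂ (lower π) := by
  ext a
  have h0 : ∀ b, Q (Sum.inr a) (Sum.inl b) = 0 := fun b => congrFun (congrFun hQ a) b
  simp [_root_.lower, Matrix.ofLp_toEuclideanCLM, Matrix.mulVec, dotProduct, h0, Matrix.toBlocks₂₂]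

lemma toBlocks₂₁_eq_zero {Q : Matrix (Fin dw ⊕ Fin dφ) (Fin dw ⊕ Fin dφ) ℝ} (hs : Q.IsSymm)
    (hQ : Q.toBlocks₁₂ = 0) : Q.toBlocks₂₁ = 0 := by
  ext a b
  have h1 := congrFun (congrFun hQ b) a
  have h2 := hs.apply (Sum.inl b) (Sum.inr a)
  simp only [Matrix.toBlocks₁₂, Matrix.toBlocks₂₁, Matrix.of_apply] at h1 ⊢
  rw [h2]; exact h1

end Blocks

/-! ### Joint expansion of an estimator and of its gradient bootstrap -/

section Expansion

variable {dw dφ J : ℕ}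

lemma abs_sgn (g : Signs J) (j : Fin J) : |sgn g j| = 1 := by
  rcases Int.units_eq_one_or (g j) with h | h <;> simp [sgn, h]

lemma norm_sum_sub_sum_le {E : Type*} [NormedAddCommGroup E] [NormedSpace ℝ E] {f f' : Fin J → E}
    {e : ℝ} (h : ∀ j, ‖f j - f' j‖ ≤ e) : ‖∑ j, f j - ∑ j, f' j‖ ≤ J * e := by
  rw [← Finset.sum_sub_distrib]
  refine (norm_sum_le _ _).trans ((Finset.sum_le_sum fun j _ => h j).trans_eq ?_)
  simp

/-- Constants and hypotheses for a simultaneous expansion at one quantile. -/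
structure ScoreExpansion (π₀ : StackVec dw dφ) (S : Fin J → StackVec dw dφ → StackVec dw dφ)
    (s : Fin J → StackVec dw dφ) (Q : Fin J → Matrix (Fin dw ⊕ Fin dφ) (Fin dw ⊕ Fin dφ) ℝ)
    (p ξ : Fin J → ℝ) (z : Fin J → Vec dφ) (c C ε δ r K : ℝ) : Prop where
  expansion : ∀ j v, ‖v‖ ≤ δ → ‖S j (π₀ + v) - s j + matOp (Q j) v‖ ≤ ε * (1 / r + ‖v‖)
  score_le : ∀ j, r * ‖s j‖ ≤ K
  approx : ∀ j, ‖r • lower (s j) - z j‖ ≤ ε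
  norm_le : ∀ j, ‖Q j‖ ≤ C
  block : ∀ j, (Q j).toBlocks₂₁ = 0
  p_nonneg : ∀ j, 0 ≤ p j
  p_sum : ∑ j, p j = 1
  p_sub : ∀ j, |p j - ξ j| ≤ ε
  coercive : ∀ x, c * ‖x‖ ^ 2 ≤ inner ℝ x (matOp (∑ j, ξ j • Q j) x)
  r_pos : 0 < r
  ε_pos : 0 < ε
  c_pos : 0 < c

namespace ScoreExpansion

variable {π₀ : StackVec dw dφ} {S : Fin J → StackVec dw dφ → StackVec dw dφ}
    {s : Fin J → StackVec dw dφ} {Q : Fin J → Matrix (Fin dw ⊕ Fin dφ) (Fin dw ⊕ Fin dφ) ℝ}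
    {p ξ : Fin J → ℝ} {z : Fin J → Vec dφ} {c C ε δ r K : ℝ}
    (h : ScoreExpansion π₀ S s Q p ξ z c C ε δ r K)

include h

lemma p_le_one (j : Fin J) : p j ≤ 1 := by
  rw [← h.p_sum]
  exact Finset.single_le_sum (fun j _ => h.p_nonneg j) (Finset.mem_univ j)

lemma norm_z_le (j : Fin J) : ‖z j‖ ≤ K + ε := by
  have h1 : ‖r • lower (s j)‖ ≤ K := by
    rw [norm_smul, Real.norm_of_nonneg h.r_pos.le]
    exact (mul_le_mul_of_nonneg_left (norm_lower_le _) h.r_pos.le).trans (h.score_le j)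
  have h2 := norm_sub_norm_le (z j) (r • lower (s j))
  rw [norm_sub_rev] at h2
  linarith [h.approx j]

lemma C_nonneg (j : Fin J) : 0 ≤ C := (norm_nonneg _).trans (h.norm_le j)

lemma K_nonneg (j : Fin J) : 0 ≤ K :=
  (mul_nonneg h.r_pos.le (norm_nonneg _)).trans (h.score_le j)

lemma exists_index : Nonempty (Fin J) := by
  by_contra hJ
  rw [not_nonempty_iff] at hJ
  have := h.p_sum
  simp at this

/-- Two errors add up: the expansion in each cluster, averaged with the shares `p j`, and the
replacement of `p j` by `ξ j` in front of `Q j`, which costs at most `ε * C * ‖v‖` per cluster.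
Hence the factor `1 + J * C`. -/
lemma norm_sum_score_le {v : StackVec dw dφ} (hv : ‖v‖ ≤ δ) :
    ‖∑ j, p j • S j (π₀ + v) - ∑ j, p j • s j + matOp (∑ j, ξ j • Q j) v‖
      ≤ ε * (1 + J * C) * (1 / r + ‖v‖) := by
  have h0 : 0 < 1 / r := one_div_pos.2 h.r_pos
  have hQ : matOp (∑ j, ξ j • Q j) v = ∑ j, ξ j • matOp (Q j) v := by
    rw [matOp, map_sum, sum_apply]
    exact Finset.sum_congr rfl fun j _ => by rw [map_smul, smul_apply]
  have h1 : ∑ j, p j • S j (π₀ + v) - ∑ j, p j • s j + matOp (∑ j, ξ j • Q j) v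
      = ∑ j, p j • (S j (π₀ + v) - s j + matOp (Q j) v) - ∑ j, (p j - ξ j) • matOp (Q j) v := by
    rw [hQ, ← Finset.sum_sub_distrib, ← Finset.sum_sub_distrib, ← Finset.sum_add_distrib]
    refine Finset.sum_congr rfl fun j _ => ?_
    module
  rw [h1]
  have h2 : ‖∑ j, p j • (S j (π₀ + v) - s j + matOp (Q j) v)‖ ≤ ε * (1 / r + ‖v‖) := by
    calc _ ≤ ∑ j, p j * (ε * (1 / r + ‖v‖)) := by
          refine (norm_sum_le _ _).trans (Finset.sum_le_sum fun j _ => ?_)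
          rw [norm_smul, Real.norm_of_nonneg (h.p_nonneg j)]
          exact mul_le_mul_of_nonneg_left (h.expansion j v hv) (h.p_nonneg j)
      _ = _ := by rw [← Finset.sum_mul, h.p_sum, one_mul]
  have h3 : ‖∑ j, (p j - ξ j) • matOp (Q j) v‖ ≤ J * (ε * (C * ‖v‖)) := by
    refine (norm_sum_le _ _).trans ((Finset.sum_le_sum (g := fun _ => ε * (C * ‖v‖))
      fun j _ => ?_).trans_eq (by simp))
    rw [norm_smul, Real.norm_eq_abs]
    have := h.ε_pos.le
    have := (norm_matOp_apply_le (Q j) v).trans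
      (mul_le_mul_of_nonneg_right (h.norm_le j) (norm_nonneg v))
    exact mul_le_mul (h.p_sub j) this (norm_nonneg _) h.ε_pos.le
  obtain ⟨j₀⟩ := h.exists_index
  have hC := h.C_nonneg j₀
  have h4 : (0 : ℝ) ≤ J * (ε * (C * (1 / r))) := by have := h.ε_pos; positivity
  calc _ ≤ ε * (1 / r + ‖v‖) + J * (ε * (C * ‖v‖)) := (norm_sub_le _ _).trans (add_le_add h2 h3)
    _ ≤ ε * (1 / r + ‖v‖) + J * (ε * (C * ‖v‖)) + J * (ε * (C * (1 / r))) := by linarith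
    _ = _ := by ring

lemma norm_sum_Q_le : ‖∑ j, ξ j • Q j‖ ≤ (∑ j, |ξ j|) * C := by
  rw [Finset.sum_mul]
  refine (norm_sum_le _ _).trans (Finset.sum_le_sum fun j _ => ?_)
  rw [norm_smul, Real.norm_eq_abs]
  exact mul_le_mul_of_nonneg_left (h.norm_le j) (abs_nonneg _)

/-- Expansion of a minimizer of a convex function whose subgradient is, up to the factor `N`,
the weighted score shifted by `a`. -/
lemma argInf {F : StackVec dw dφ → ℝ} {N : ℝ} (hN : 0 < N) (hF : Continuous F)
    {a : StackVec dw dφ} (hsub : ∀ x y, -(N * inner ℝ (∑ j, p j • S j x + a) (y - x)) ≤ F y - F x)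
    {K' R : ℝ} (ha : ‖a‖ ≤ K' / r) (hK' : 0 ≤ K') (hR : R = 2 * (K + K' + 2) / c)
    (hε1 : ε * (1 + J * C) ≤ 1) (hεc : ε * (1 + J * C) ≤ c / 2) (hδ : (R + 1) / r ≤ δ)
    {x : StackVec dw dφ} (hx : IsArgInf F x) :
    ‖x - π₀‖ ≤ R / r ∧ ‖matOp (∑ j, ξ j • Q j) (x - π₀) - (∑ j, p j • s j + a)‖
      ≤ ε * ((1 + J * C) * ((∑ j, |ξ j|) * C + 2 + R)) / r := by
  obtain ⟨j₀⟩ := h.exists_index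
  have hC := h.C_nonneg j₀
  have hK := h.K_nonneg j₀
  have hr := h.r_pos
  have hc := h.c_pos
  have hε := h.ε_pos
  set ε₁ := ε * (1 + J * C) with hε₁
  have hε₁0 : 0 < ε₁ := by positivity
  have hR0 : 0 < R := by rw [hR]; positivity
  -- Since the total error `ε₁` is at most `c / 2`, `(c - ε₁) * R ≥ c * R / 2 = K + K' + 2`, which
  -- exceeds `K + K' + ε₁` because `ε₁ ≤ 1`. This is the radius condition of `IsArgInf.approx`.
  have hcR : c * R = 2 * (K + K' + 2) := by rw [hR]; field_simp
  have hs : ‖∑ j, p j • s j‖ ≤ K / r := by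
    calc _ ≤ ∑ j, p j * (K / r) := by
          refine (norm_sum_le _ _).trans (Finset.sum_le_sum fun j _ => ?_)
          rw [norm_smul, Real.norm_of_nonneg (h.p_nonneg j)]
          refine mul_le_mul_of_nonneg_left ?_ (h.p_nonneg j)
          rw [le_div_iff₀ hr, mul_comm]; exact h.score_le j
      _ = _ := by rw [← Finset.sum_mul, h.p_sum, one_mul]
  have key := IsArgInf.approx hN hF hsub (π₀ := π₀) (k := ∑ j, p j • s j + a)
    (q := matOp (∑ j, ξ j • Q j)) (c := c) (C := (∑ j, |ξ j|) * C) (ε := ε₁) (r := r)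
    (K := K + K') (R := R) (δ := δ) hr hε₁0 h.coercive
    (by rw [norm_matOp]; exact h.norm_sum_Q_le)
    (by rw [add_div]; exact (norm_add_le _ _).trans (add_le_add hs ha))
    (by nlinarith) hR0 (le_trans (by gcongr) hδ)
    (fun v hv => by
      have := h.norm_sum_score_le hv
      rw [← hε₁] at this
      rwa [add_sub_add_right_eq_sub]) hx
  refine ⟨key.1, key.2.trans ?_⟩
  gcongr
  have : 0 ≤ (∑ j, |ξ j|) * C := mul_nonneg (Finset.sum_nonneg fun _ _ => abs_nonneg _) hC
  calc _ ≤ (∑ j, |ξ j|) * C * ε₁ + ε₁ * (1 + R + 1) := by gcongr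
    _ = _ := by rw [hε₁]; ring

end ScoreExpansion

end Expansion

section Expansion

variable {dw dφ J : ℕ}

lemma toBlocks₂₁_sum_smul {ξ : Fin J → ℝ} {Q : Fin J → Matrix (Fin dw ⊕ Fin dφ) (Fin dw ⊕ Fin dφ) ℝ}
    (hQ : ∀ j, (Q j).toBlocks₂₁ = 0) : (∑ j, ξ j • Q j).toBlocks₂₁ = 0 := by
  ext a b
  have : ∀ j, Q j (Sum.inr a) (Sum.inl b) = 0 := fun j => congrFun (congrFun (hQ j) a) b
  simp [Matrix.toBlocks₂₁, Matrix.sum_apply, this]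

lemma coercive_toBlocks₂₂ {A : Matrix (Fin dw ⊕ Fin dφ) (Fin dw ⊕ Fin dφ) ℝ} {c : ℝ}
    (h : ∀ x, c * ‖x‖ ^ 2 ≤ inner ℝ x (matOp A x)) (x : Vec dφ) :
    c * ‖x‖ ^ 2 ≤ inner ℝ x (matOp A.toBlocks₂₂ x) := by
  have h1 := h (stack 0 x)
  rw [norm_sq_stack, norm_zero] at h1
  have h2 : inner ℝ (stack (0 : Vec dw) x) (matOp A (stack 0 x))
      = inner ℝ x (matOp A.toBlocks₂₂ x) := by
    rw [Matrix.inner_toEuclideanCLM, Matrix.inner_toEuclideanCLM]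
    simp [stack, dotProduct, Matrix.mulVec, Matrix.toBlocks₂₂]
  rw [h2] at h1
  nlinarith

namespace ScoreExpansion

variable {γ : Vec dw} {S : Fin J → StackVec dw dφ → StackVec dw dφ}
    {s : Fin J → StackVec dw dφ} {Q : Fin J → Matrix (Fin dw ⊕ Fin dφ) (Fin dw ⊕ Fin dφ) ℝ}
    {p ξ : Fin J → ℝ} {z : Fin J → Vec dφ} {c C ε δ r K : ℝ}

/-- The test statistic, its bootstrap versions and the null-restricted cluster scores are linear
in the limit scores `z`, up to a multiple of `ε`. -/
theorem statistics (h : ScoreExpansion (stack γ 0) S s Q p ξ z c C ε δ r K)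
    {L : StackVec dw dφ → ℝ} {N : ℝ} (hN : 0 < N) (hL : Continuous L)
    (hsub : ∀ x y, -(N * inner ℝ (∑ j, p j • S j x) (y - x)) ≤ L y - L x)
    {x : StackVec dw dφ} (hx : IsArgInf L x) {xb : Signs J → StackVec dw dφ}
    (hxb : ∀ g, IsArgInf (fun π => L π
      - ∑ j, sgn g j * inner ℝ ((N * p j) • S j (stack (upper x) 0)) π) (xb g))
    {R₁ K₂ R₂ : ℝ} (hR₁ : R₁ = 2 * (K + 0 + 2) / c) (hK₂ : K₂ = K + C * R₁ + 1 + R₁)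
    (hR₂ : R₂ = 2 * (K + K₂ + 2) / c) (hε1 : ε * (1 + J * C) ≤ 1) (hεc : ε * (1 + J * C) ≤ c / 2)
    (hδ₁ : (R₁ + 1) / r ≤ δ) (hδ₂ : (R₂ + 1) / r ≤ δ) :
    (∀ j, ‖(r * p j) • lower (S j (stack (upper x) 0)) - ξ j • z j‖ ≤ ε * (R₁ + K + 3)) ∧
    ‖r • lower x - matOp (∑ j, ξ j • Q j).toBlocks₂₂⁻¹ (∑ j, ξ j • z j)‖
      ≤ ε * ((1 + J * C) * ((∑ j, |ξ j|) * C + 2 + R₁) + J * (R₁ + K + 3)) / c ∧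
    ∀ g, ‖r • (lower (xb g) - lower x)
        - matOp (∑ j, ξ j • Q j).toBlocks₂₂⁻¹ (∑ j, (ξ j * sgn g j) • z j)‖
      ≤ ε * ((1 + J * C) * ((∑ j, |ξ j|) * C + 2 + R₁) + (1 + J * C) * ((∑ j, |ξ j|) * C + 2 + R₂)
        + J * (R₁ + K + 3)) / c := by
  obtain ⟨j₀⟩ := h.exists_index
  have hC := h.C_nonneg j₀
  have hK := h.K_nonneg j₀
  have hr := h.r_pos
  have hc := h.c_pos
  have hε := h.ε_pos
  have hR₁0 : 0 ≤ R₁ := by rw [hR₁]; positivity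
  have hK₂0 : 0 ≤ K₂ := by rw [hK₂]; positivity
  have hε_one : ε ≤ 1 := by
    refine le_trans ?_ hε1
    exact le_mul_of_one_le_right hε.le (le_add_of_nonneg_right (by positivity))
  set Qt := ∑ j, ξ j • Q j with hQt
  have hblock : Qt.toBlocks₂₁ = 0 := toBlocks₂₁_sum_smul h.block
  have hcoer := coercive_toBlocks₂₂ h.coercive
  -- the estimator
  obtain ⟨hx1, hx2⟩ := h.argInf hN hL (a := 0) (by simpa using hsub) (K' := 0) (by simp) le_rfl
    hR₁ hε1 hεc hδ₁ hx
  rw [add_zero] at hx2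
  set B₁ := (1 + J * C) * ((∑ j, |ξ j|) * C + 2 + R₁) with hB₁
  set B₂ := (1 + J * C) * ((∑ j, |ξ j|) * C + 2 + R₂) with hB₂
  -- the null-restricted scores
  set u : StackVec dw dφ := stack (upper (x - stack γ 0)) 0 with hu
  have hu' : stack (upper x) 0 = stack γ 0 + u := by
    ext a
    rcases a with a | a <;> simp [hu, stack, _root_.upper]
  have hun : ‖u‖ ≤ R₁ / r := (norm_stack_upper_le _).trans hx1
  have huδ : ‖u‖ ≤ δ := hun.trans (le_trans (by gcongr; linarith) hδ₁)
  have hS : ∀ j, ‖S j (stack (upper x) 0) - s j + matOp (Q j) u‖ ≤ ε * (1 + R₁) / r := fun j => by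
    rw [hu']
    refine (h.expansion j u huδ).trans ?_
    calc ε * (1 / r + ‖u‖) ≤ ε * (1 / r + R₁ / r) := by gcongr
      _ = _ := by ring
  -- `K₂` adds the bound `K` on the true scores, the linear term `C * R₁` and the remainder `1 +
  -- R₁`. It bounds the bootstrap perturbation of the score and so determines the second radius
  -- `R₂`.
  have hSn : ∀ j, ‖S j (stack (upper x) 0)‖ ≤ K₂ / r := fun j => by
    have h1 : S j (stack (upper x) 0)
        = (S j (stack (upper x) 0) - s j + matOp (Q j) u) + s j - matOp (Q j) u := by abel
    rw [h1]
    have h2 : ‖s j‖ ≤ K / r := by rw [le_div_iff₀ hr, mul_comm]; exact h.score_le j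
    have h3 : ‖matOp (Q j) u‖ ≤ C * (R₁ / r) :=
      (norm_matOp_apply_le _ _).trans (mul_le_mul (h.norm_le j) hun (norm_nonneg _) hC)
    have h4 : ε * (1 + R₁) / r ≤ 1 * (1 + R₁) / r := by gcongr
    calc _ ≤ ε * (1 + R₁) / r + K / r + C * (R₁ / r) :=
          (norm_sub_le _ _).trans (add_le_add ((norm_add_le _ _).trans (add_le_add (hS j) h2)) h3)
      _ ≤ 1 * (1 + R₁) / r + K / r + C * (R₁ / r) := by linarith
      _ = K₂ / r := by rw [hK₂]; ring
  have hz : ∀ j, ‖z j‖ ≤ K + 1 := fun j => (h.norm_z_le j).trans (by linarith)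
  have hpz : ∀ j (y : Vec dφ) (e : ℝ), ‖y - z j‖ ≤ e →
      ‖p j • y - ξ j • z j‖ ≤ e + ε * (K + 1) := fun j y e hy => by
    have h1 : p j • y - ξ j • z j = p j • (y - z j) + (p j - ξ j) • z j := by module
    rw [h1]
    refine (norm_add_le _ _).trans (add_le_add ?_ ?_)
    · rw [norm_smul, Real.norm_of_nonneg (h.p_nonneg j)]
      exact (mul_le_of_le_one_left (norm_nonneg _) (h.p_le_one j)).trans hy
    · rw [norm_smul, Real.norm_eq_abs]
      exact mul_le_mul (h.p_sub j) (hz j) (norm_nonneg _) hε.le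
  have hSz : ∀ j, ‖(r * p j) • lower (S j (stack (upper x) 0)) - ξ j • z j‖
      ≤ ε * (R₁ + K + 3) := fun j => by
    -- The deviation `u` has no instrument part and `Q j` is block triangular, so estimating `γ`
    -- leaves the instrument block of the score unchanged to leading order.
    have hlow : lower (matOp (Q j) u) = 0 := by
      rw [lower_matOp (h.block j), hu, lower_stack, map_zero]
    have h1 : ‖lower (S j (stack (upper x) 0)) - lower (s j)‖ ≤ ε * (1 + R₁) / r := by
      refine le_trans (le_of_eq_of_le ?_ (norm_lower_le _)) (hS j)
      rw [← lowerL_apply, ← lowerL_apply, ← lowerL_apply, map_add, map_sub, lowerL_apply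
        (matOp (Q j) u), hlow, add_zero]
    have h2 : ‖r • lower (S j (stack (upper x) 0)) - z j‖ ≤ ε * (1 + R₁) + ε := by
      have h3 : r • lower (S j (stack (upper x) 0)) - z j
          = r • (lower (S j (stack (upper x) 0)) - lower (s j)) + (r • lower (s j) - z j) := by
        module
      rw [h3]
      refine (norm_add_le _ _).trans (add_le_add ?_ (h.approx j))
      rw [norm_smul, Real.norm_of_nonneg hr.le]
      calc _ ≤ r * (ε * (1 + R₁) / r) := by gcongr
        _ = _ := by field_simp
    have h4 := hpz j _ _ h2
    rw [mul_comm, mul_smul]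
    linarith
  -- expansion of the second block
  have hlowQ : ∀ {y w : StackVec dw dφ} {e : ℝ}, ‖matOp Qt y - w‖ ≤ e / r →
      ‖matOp Qt.toBlocks₂₂ (r • lower y) - r • lower w‖ ≤ e := fun {y w e} hyw => by
    rw [map_smul, ← lower_matOp hblock, ← smul_sub, norm_smul, Real.norm_of_nonneg hr.le]
    have h1 : ‖lower (matOp Qt y) - lower w‖ ≤ e / r := by
      rw [← lowerL_apply, ← lowerL_apply, ← map_sub]
      exact (norm_lower_le _).trans hyw
    rw [le_div_iff₀ hr] at h1
    linarith
  refine ⟨hSz, ?_, fun g => ?_⟩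
  · refine norm_sub_inv_apply_le hc hcoer ?_
    have h1 := hlowQ hx2
    have h2 : lower (x - stack γ 0) = lower x := by
      rw [← lowerL_apply, map_sub, lowerL_apply, lowerL_apply, lower_stack, sub_zero]
    have h3 : r • lower (∑ j, p j • s j) = ∑ j, p j • (r • lower (s j)) := by
      rw [← lowerL_apply, map_sum, Finset.smul_sum]
      refine Finset.sum_congr rfl fun j _ => ?_
      rw [map_smul, lowerL_apply, smul_comm]
    rw [h2, h3] at h1
    have h4 := norm_sum_sub_sum_le fun j => hpz j _ _ (h.approx j)
    refine (norm_sub_le_norm_sub_add_norm_sub _ _ _).trans ((add_le_add h1 h4).trans ?_)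
    have h5 : ε + ε * (K + 1) ≤ ε * (R₁ + K + 3) := by nlinarith
    calc ε * B₁ + J * (ε + ε * (K + 1)) ≤ ε * B₁ + J * (ε * (R₁ + K + 3)) := by gcongr
      _ = _ := by ring
  -- The bootstrap objective differs from `L` by the linear function `N * ⟨a, π⟩`, so its averaged
  -- score is the original one shifted by `a`, and the expansion for shifted scores applies.
  · set a := ∑ j, (p j * sgn g j) • S j (stack (upper x) 0) with ha
    have han : ‖a‖ ≤ K₂ / r := by
      calc _ ≤ ∑ j, p j * (K₂ / r) := by
            refine (norm_sum_le _ _).trans (Finset.sum_le_sum fun j _ => ?_)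
            rw [norm_smul, norm_mul, Real.norm_of_nonneg (h.p_nonneg j), Real.norm_eq_abs,
              abs_sgn, mul_one]
            exact mul_le_mul_of_nonneg_left (hSn j) (h.p_nonneg j)
        _ = _ := by rw [← Finset.sum_mul, h.p_sum, one_mul]
    have hlin : ∀ y, ∑ j, sgn g j * inner ℝ ((N * p j) • S j (stack (upper x) 0)) y
        = N * inner ℝ a y := fun y => by
      rw [ha, sum_inner, Finset.mul_sum]
      refine Finset.sum_congr rfl fun j _ => ?_
      rw [real_inner_smul_left, real_inner_smul_left]; ring
    have hxg := hxb g
    simp_rw [hlin] at hxg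
    obtain ⟨hb1, hb2⟩ := h.argInf hN (F := fun π => L π - N * inner ℝ a π)
      (hL.sub (by fun_prop)) (a := a) (fun y w => by
        have := hsub y w
        rw [inner_add_left]
        have h2 : inner ℝ a (w - y) = inner ℝ a w - inner ℝ a y := inner_sub_right _ _ _
        nlinarith) han hK₂0 hR₂ hε1 hεc hδ₂ hxg
    refine norm_sub_inv_apply_le hc hcoer ?_
    -- Subtracting the expansions of the bootstrap minimizer and of the estimator cancels the common
    -- score `∑ j, p j • s j` and leaves the signed sum alone.
    have h1 : ‖matOp Qt (xb g - x) - a‖ ≤ ε * (B₁ + B₂) / r := by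
      have h2 : matOp Qt (xb g - x) - a = (matOp Qt (xb g - stack γ 0) - (∑ j, p j • s j + a))
          - (matOp Qt (x - stack γ 0) - ∑ j, p j • s j) := by
        simp only [map_sub]; abel
      rw [h2]
      refine (norm_sub_le _ _).trans ((add_le_add hb2 hx2).trans_eq ?_)
      ring
    have h3 := hlowQ h1
    have h4 : lower (xb g - x) = lower (xb g) - lower x := rfl
    have h5 : r • lower a = ∑ j, sgn g j • ((r * p j) • lower (S j (stack (upper x) 0))) := by
      rw [← lowerL_apply, ha, map_sum, Finset.smul_sum]
      refine Finset.sum_congr rfl fun j _ => ?_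
      rw [map_smul, lowerL_apply]; module
    have h6 : ∑ j, (ξ j * sgn g j) • z j = ∑ j, sgn g j • (ξ j • z j) :=
      Finset.sum_congr rfl fun j _ => by module
    rw [h4, h5] at h3
    rw [h6]
    have h7 : ∀ j, ‖sgn g j • ((r * p j) • lower (S j (stack (upper x) 0)))
        - sgn g j • (ξ j • z j)‖ ≤ ε * (R₁ + K + 3) := fun j => by
      rw [← smul_sub, norm_smul, Real.norm_eq_abs, abs_sgn, one_mul]
      exact hSz j
    refine (norm_sub_le_norm_sub_add_norm_sub _ _ _).trans
      ((add_le_add h3 (norm_sum_sub_sum_le h7)).trans_eq ?_)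
    ring

end ScoreExpansion

end Expansion

/-! ### Uniform expansion of estimator and bootstrap over quantiles -/

namespace IVQR

variable {Ω : Type*} {J dw dz dφ : ℕ} {Υ : Set ℝ} {M : IVQR Ω J dw dz dφ Υ}

lemma sum_eq_size_smul_avg {E : Type*} [AddCommGroup E] [Module ℝ E] (n : ℕ) (j : Fin J)
    (h : Obs dw dz → E) (ω : Ω) :
    ∑ i ∈ Finset.range (M.size n j), h (M.obs n j i ω) = (M.size n j : ℝ) • M.avg n j h ω := by
  rcases Nat.eq_zero_or_pos (M.size n j) with h0 | h0
  · simp [h0]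
  · rw [avg, smul_smul, mul_inv_cancel₀ (by positivity), one_smul]

lemma continuous_objective (n : ℕ) (ω : Ω) (b : ℝ) (τ : Υ) : Continuous (M.objective n ω b τ) := by
  unfold objective loss resid
  refine continuous_finsetSum _ fun j _ => continuous_finsetSum _ fun i _ => ?_
  exact ((continuous_checkFun _).comp (by fun_prop)).mul_const _

/-- The residual is affine in `π` and `V̂` is nonnegative, so the subgradient inequality of the
check function passes to the weighted sum. It holds also at kinks, with the convention `1{u ≤ 0}` of
the score. -/
lemma objective_subgradient [MeasurableSpace Ω] {μ : Measure Ω} (hM : M.Setup μ) {n : ℕ}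
    (hn : 0 < n) (ω : Ω) (b : ℝ) (τ : Υ) (x y : StackVec dw dφ) :
    -((n : ℝ) * inner ℝ (∑ j, ((M.size n j : ℝ) / n) • M.avg n j
      (fun d => score (M.Φhat n ω) (M.Vhat n ω) j τ d b x) ω) (y - x))
      ≤ M.objective n ω b τ y - M.objective n ω b τ x := by
  have hn' : (n : ℝ) ≠ 0 := by positivity
  have h1 : (n : ℝ) * inner ℝ (∑ j, ((M.size n j : ℝ) / n) • M.avg n j
      (fun d => score (M.Φhat n ω) (M.Vhat n ω) j τ d b x) ω) (y - x)
      = ∑ j, ∑ i ∈ Finset.range (M.size n j),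
        inner ℝ (score (M.Φhat n ω) (M.Vhat n ω) j τ (M.obs n j i ω) b x) (y - x) := by
    rw [← real_inner_smul_left, Finset.smul_sum, sum_inner]
    refine Finset.sum_congr rfl fun j _ => ?_
    rw [smul_smul, mul_div_cancel₀ _ hn', ← sum_eq_size_smul_avg, sum_inner]
  rw [h1, objective, objective, ← Finset.sum_sub_distrib, ← Finset.sum_neg_distrib]
  refine Finset.sum_le_sum fun j _ => ?_
  rw [← Finset.sum_sub_distrib, ← Finset.sum_neg_distrib]
  refine Finset.sum_le_sum fun i _ => ?_
  rw [loss, loss, ← sub_mul, score, real_inner_smul_left]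
  set φ := M.Φhat n ω
  set V := M.Vhat n ω j τ (M.obs n j i ω).w (M.obs n j i ω).z
  have hV : 0 ≤ V := hM.Vhat_nonneg _ _ _ _ _ _
  have h2 := checkFun_subgradient τ (resid φ j τ (M.obs n j i ω) b x)
    (resid φ j τ (M.obs n j i ω) b y)
  have h3 : resid φ j τ (M.obs n j i ω) b y - resid φ j τ (M.obs n j i ω) b x
      = -inner ℝ (regressor φ j τ (M.obs n j i ω)) (y - x) := by
    rw [resid, resid, inner_sub_right]; ring
  rw [h3] at h2
  have h4 := mul_le_mul_of_nonneg_right h2 hV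
  linarith

variable [MeasurableSpace Ω] {μ : Measure Ω}

lemma LocallyUniformly.exists_radius {P : ℕ → Ω → Fin J → Υ → WithLp 2 (ℝ × StackVec dw dφ) → Prop}
    (h : LocallyUniformly μ P) {η : ℝ≥0∞} (hη : 0 < η) :
    ∃ δ : ℝ, 0 < δ ∧ ∀ᶠ n in atTop, μ {ω | ¬ ∀ j τ v, ‖v‖ ≤ δ → P n ω j τ v} ≤ η := by
  have h1 := (Tendsto.eventually h (gt_mem_nhds hη)).and self_mem_nhdsWithin
  obtain ⟨δ, hlt, hδ⟩ := h1.exists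
  exact ⟨δ, hδ, (eventually_lt_of_limsup_lt hlt).mono fun _ h => h.le⟩

lemma LocallyUniformly.mono_radius
    {P : ℕ → Ω → Fin J → Υ → WithLp 2 (ℝ × StackVec dw dφ) → Prop}
    {δ δ' : ℝ} (hδ : δ' ≤ δ) {n : ℕ} :
    μ {ω | ¬ ∀ j τ v, ‖v‖ ≤ δ' → P n ω j τ v} ≤ μ {ω | ¬ ∀ j τ v, ‖v‖ ≤ δ → P n ω j τ v} :=
  measure_mono fun _ hω h => hω fun j τ v hv => h j τ v (hv.trans hδ)

lemma measure_exists_le {K : ℕ} {ι : Type*} {f : Fin K → ι → Ω → ℝ} {m : Fin K → ℝ} {η : ℝ≥0∞}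
    (h : ∀ j, μ {ω | ∃ i, m j < f j i ω} ≤ η / K) : μ {ω | ¬ ∀ j i, f j i ω ≤ m j} ≤ η := by
  calc _ ≤ μ (⋃ j ∈ (Finset.univ : Finset (Fin K)), {ω | ∃ i, m j < f j i ω}) := by
        refine measure_mono fun ω hω => ?_
        simp only [mem_ofPred_eq, not_forall, not_le] at hω
        obtain ⟨j, i, hji⟩ := hω
        exact mem_biUnion (Finset.mem_coe.2 (Finset.mem_univ j)) ⟨i, hji⟩
    _ ≤ ∑ _j : Fin K, η / K :=
        (measure_biUnion_finset_le _ _).trans (Finset.sum_le_sum fun j _ => h j)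
    _ ≤ η := by
        rw [Finset.sum_const, Finset.card_univ, Fintype.card_fin, nsmul_eq_mul]
        exact ENNReal.mul_div_le

lemma measure_not_le_of_imp {P₁ P₂ P₃ P₄ C : Ω → Prop} {η : ℝ≥0∞}
    (h₁ : μ {ω | ¬ P₁ ω} ≤ η / 4) (h₂ : μ {ω | ¬ P₂ ω} ≤ η / 4) (h₃ : μ {ω | ¬ P₃ ω} ≤ η / 4)
    (h₄ : μ {ω | ¬ P₄ ω} ≤ η / 4) (h : ∀ ω, P₁ ω → P₂ ω → P₃ ω → P₄ ω → C ω) :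
    μ {ω | ¬ C ω} ≤ η := by
  calc μ {ω | ¬ C ω} ≤ μ (({ω | ¬ P₁ ω} ∪ {ω | ¬ P₂ ω}) ∪ ({ω | ¬ P₃ ω} ∪ {ω | ¬ P₄ ω})) := by
        refine measure_mono fun ω hω => ?_
        by_contra hcon
        simp only [mem_union, mem_ofPred_eq, not_or, not_not] at hcon
        exact hω (h ω hcon.1.1 hcon.1.2 hcon.2.1 hcon.2.2)
    _ ≤ (η / 4 + η / 4) + (η / 4 + η / 4) := by
        refine (measure_union_le _ _).trans (add_le_add ?_ ?_)
        · exact (measure_union_le _ _).trans (add_le_add h₁ h₂)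
        · exact (measure_union_le _ _).trans (add_le_add h₃ h₄)
    _ = 4 * (η / 4) := by ring
    _ ≤ η := ENNReal.mul_div_le

section Limits

variable {𝓑 : Set ℝ} {𝓡 : Set (Vec dw)} {𝓣 : Set (Vec dφ)}
  {fε : ℕ → Fin J → ℕ → Υ → ℝ → Vec dw × Vec dz → ℝ}
  {QΨΨ : Fin J → Υ → Matrix (Fin dw ⊕ Fin dφ) (Fin dw ⊕ Fin dφ) ℝ}
  {QΨX : Fin J → Υ → StackVec dw dφ} {ξ : Fin J → ℝ} {𝒵 : Fin J → Υ → Ω → Vec dφ}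

lemma AsymptoticAssumption.tendsto_bilin
    (hasym : M.AsymptoticAssumption μ 𝓑 𝓡 𝓣 fε QΨΨ QΨX ξ) (j : Fin J) (τ : Υ)
    (x y : StackVec dw dφ) :
    Tendsto (fun n => M.popAvg' μ n j
      (fun i d => bilinEval x y (jacΨΨ M.Φ M.V j τ (fε n j i τ) 0 d))) atTop
      (𝓝 (inner ℝ x (matOp (QΨΨ j τ) y))) := by
  have : CompleteSpace (Matrix (Fin dw ⊕ Fin dφ) (Fin dw ⊕ Fin dφ) ℝ) :=
    FiniteDimensional.complete ℝ _
  have h := ((bilinEval x y).continuous.tendsto _).comp (hasym.QΨΨ_limit j τ)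
  refine h.congr fun n => ?_
  exact popAvg'_clm (bilinEval x y) (hasym.QΨΨ_integrable n j τ)

lemma AsymptoticAssumption.isSymm (hasym : M.AsymptoticAssumption μ 𝓑 𝓡 𝓣 fε QΨΨ QΨX ξ)
    (j : Fin J) (τ : Υ) : (QΨΨ j τ).IsSymm := by
  refine isSymm_of_inner_matOp_comm fun x y => ?_
  refine tendsto_nhds_unique (hasym.tendsto_bilin j τ x y)
    ((hasym.tendsto_bilin j τ y x).congr fun n => ?_)
  congr 1; ext i d
  rw [bilinEval_jacΨΨ, bilinEval_jacΨΨ]; ring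

lemma AsymptoticAssumption.inner_nonneg (hM : M.Setup μ)
    (hasym : M.AsymptoticAssumption μ 𝓑 𝓡 𝓣 fε QΨΨ QΨX ξ) (j : Fin J) (τ : Υ)
    (x : StackVec dw dφ) : 0 ≤ inner ℝ x (matOp (QΨΨ j τ) x) := by
  refine ge_of_tendsto' (hasym.tendsto_bilin j τ x x) fun n => ?_
  rw [popAvg']
  refine smul_nonneg (by positivity) (Finset.sum_nonneg fun i hi => integral_nonneg fun ω => ?_)
  rw [bilinEval_jacΨΨ]
  exact mul_nonneg (mul_nonneg ((hasym.density n j i (Finset.mem_range.1 hi) τ).nonneg _ _)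
    (hM.V_nonneg _ _ _ _)) (mul_self_nonneg _)

/-- Eigenvalues are bounded only for the weighted sum. Each `QΨΨ j τ` is a limit of positive
semidefinite matrices, so `ξ j • QΨΨ j τ` is dominated by that sum, and symmetry turns this into a
norm bound. -/
lemma AsymptoticAssumption.exists_norm_le (hM : M.Setup μ)
    (hasym : M.AsymptoticAssumption μ 𝓑 𝓡 𝓣 fε QΨΨ QΨX ξ) : ∃ C, ∀ j τ, ‖QΨΨ j τ‖ ≤ C := by
  obtain ⟨c, C, hc, hbd⟩ := hasym.eigenvalues
  refine ⟨∑ j, |C| / ξ j, fun j τ => ?_⟩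
  have hξ := hasym.ξ_pos
  have h1 : ‖QΨΨ j τ‖ ≤ |C| / ξ j := by
    refine norm_le_of_isSymm (hasym.isSymm j τ) (fun x => ?_)
      (div_nonneg (abs_nonneg _) (hξ j).le)
    rw [abs_of_nonneg (hasym.inner_nonneg hM j τ x)]
    have h2 := ((rayleighBounds_iff.1 (hbd τ)) x).2
    have h3 : inner ℝ x (matOp (∑ j, ξ j • QΨΨ j τ) x)
        = ∑ j, ξ j * inner ℝ x (matOp (QΨΨ j τ) x) := by
      rw [matOp, map_sum, sum_apply, inner_sum]
      refine Finset.sum_congr rfl fun j _ => ?_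
      rw [map_smul, smul_apply, inner_smul_right]
    rw [h3] at h2
    have h4 := Finset.single_le_sum (f := fun j => ξ j * inner ℝ x (matOp (QΨΨ j τ) x))
      (fun j _ => mul_nonneg (hξ j).le (hasym.inner_nonneg hM j τ x)) (Finset.mem_univ j)
    rw [div_mul_eq_mul_div, le_div_iff₀ (hξ j)]
    have h5 : C * ‖x‖ ^ 2 ≤ |C| * ‖x‖ ^ 2 := by gcongr; exact le_abs_self C
    linarith
  exact h1.trans (Finset.single_le_sum (f := fun j => |C| / ξ j)
    (fun j _ => div_nonneg (abs_nonneg _) (hξ j).le) (Finset.mem_univ j))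

lemma AsymptoticAssumption.eventually_score_le
    (hasym : M.AsymptoticAssumption μ 𝓑 𝓡 𝓣 fε QΨΨ QΨX ξ) {η : ℝ≥0∞} (hη : 0 < η) :
    ∃ K : ℝ, ∀ᶠ n in atTop, μ {ω | ¬ ∀ j (τ : Υ), M.r n *
      ‖M.avg n j (fun d => score M.Φ M.V j τ d (M.βn n τ) (stack (M.γn n τ) 0)) ω‖ ≤ K} ≤ η := by
  have hη' : 0 < η / J := ENNReal.div_pos hη.ne' (ENNReal.natCast_ne_top J)
  choose m hm using fun j => hasym.score_rate j (η / J) hη'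
  refine ⟨∑ j, |m j|, ?_⟩
  filter_upwards [eventually_all.2 hm] with n hn
  have h1 := measure_exists_le hn
  refine le_trans (measure_mono ?_) h1
  intro ω hω h
  refine hω fun j τ => ?_
  exact (h j τ).trans ((le_abs_self _).trans
    (Finset.single_le_sum (f := fun j => |m j|) (fun _ _ => abs_nonneg _) (Finset.mem_univ j)))

lemma BootstrapAssumption.withHighProb (hboot : M.BootstrapAssumption μ QΨΨ 𝒵) {ε : ℝ}
    (hε : 0 < ε) : WithHighProb μ (fun n ω => ∀ j (τ : Υ), ‖M.r n • lower (M.avg n j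
      (fun d => score M.Φ M.V j τ d (M.βn n τ) (stack (M.γn n τ) 0)) ω) - 𝒵 j τ ω‖ ≤ ε) :=
  WithHighProb.forall fun j => (hboot.approx j).withHighProb hε

/-- At one large sample size the process lies within distance one of a scaled score that is bounded
in probability, so the bound is inherited from the scores. The two events are repeated below to fill
the four slots of the union bound. -/
lemma BootstrapAssumption.exists_norm_le
    (hasym : M.AsymptoticAssumption μ 𝓑 𝓡 𝓣 fε QΨΨ QΨX ξ) (hboot : M.BootstrapAssumption μ QΨΨ 𝒵)
    (hM : M.Setup μ) {η : ℝ≥0∞} (hη : 0 < η) :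
    ∃ B : ℝ, μ {ω | ¬ ∀ j τ, ‖𝒵 j τ ω‖ ≤ B} ≤ η := by
  have hη4 : 0 < η / 4 := ENNReal.div_pos hη.ne' (by simp)
  obtain ⟨K, hK⟩ := hasym.eventually_score_le hη4
  have h1 := withHighProb_iff.1 (hboot.withHighProb one_pos) _ hη4
  obtain ⟨n, hn1, hn2⟩ := (hK.and h1).exists
  refine ⟨K + 1, measure_not_le_of_imp hn1 hn2 hn1 hn2 fun ω h1 h2 _ _ j τ => ?_⟩
  have h3 := h2 j τ
  have h4 := norm_sub_norm_le (𝒵 j τ ω) (M.r n • lower (M.avg n j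
      (fun d => score M.Φ M.V j τ d (M.βn n τ) (stack (M.γn n τ) 0)) ω))
  rw [norm_sub_rev, norm_smul, Real.norm_of_nonneg (hM.r_pos n).le] at h4
  have h5 := (mul_le_mul_of_nonneg_left (norm_lower_le (M.avg n j
      (fun d => score M.Φ M.V j τ d (M.βn n τ) (stack (M.γn n τ) 0)) ω)) (hM.r_pos n).le).trans
        (h1 j τ)
  linarith

/-- Uniform approximation of the test statistic, its bootstrap versions and the null-restricted
cluster scores by linear functions of the limit processes. -/
theorem withHighProb_expansion [IsProbabilityMeasure μ]
    {est : ℕ → Ω → ℝ → Υ → StackVec dw dφ} {boot : ℕ → Ω → Signs J → ℝ → Υ → StackVec dw dφ}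
    (hM : M.Setup μ) (hmodel : M.ModelAssumption μ 𝓑 𝓡 𝓣)
    (hasym : M.AsymptoticAssumption μ 𝓑 𝓡 𝓣 fε QΨΨ QΨX ξ)
    (hboot : M.BootstrapAssumption μ QΨΨ 𝒵) (hnull : ∀ n τ, M.βn n τ = M.β₀ τ)
    (hest : M.IsEstimator est) (hbootest : M.IsBootEstimator est boot) {e : ℝ} (he : 0 < e) :
    WithHighProb μ (fun n ω => ∀ τ : Υ,
      (∀ j, ‖(M.r n / n) • lower (M.nullScore est n ω j τ) - ξ j • 𝒵 j τ ω‖ ≤ e) ∧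
      ‖M.r n • lower (est n ω (M.β₀ τ) τ) - matOp (QΦΦ QΨΨ ξ τ)⁻¹ (∑ j, ξ j • 𝒵 j τ ω)‖ ≤ e ∧
      ∀ g, ‖M.r n • (lower (boot n ω g (M.β₀ τ) τ) - lower (est n ω (M.β₀ τ) τ))
        - matOp (QΦΦ QΨΨ ξ τ)⁻¹ (∑ j, (ξ j * sgn g j) • 𝒵 j τ ω)‖ ≤ e) := by
  rw [withHighProb_iff]
  intro η hη
  have hη4 : 0 < η / 4 := ENNReal.div_pos hη.ne' (by simp)
  obtain ⟨c, C', hc, hbd⟩ := hasym.eigenvalues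
  obtain ⟨C, hC⟩ := hasym.exists_norm_le hM
  obtain ⟨K, hK⟩ := hasym.eventually_score_le hη4
  set R₁ := 2 * (K + 0 + 2) / c with hR₁
  set K₂ := K + C * R₁ + 1 + R₁ with hK₂
  set R₂ := 2 * (K + K₂ + 2) / c with hR₂
  set B := |R₁ + K + 3| + |((1 + J * C) * ((∑ j, |ξ j|) * C + 2 + R₁) + J * (R₁ + K + 3)) / c|
    + |((1 + J * C) * ((∑ j, |ξ j|) * C + 2 + R₁) + (1 + J * C) * ((∑ j, |ξ j|) * C + 2 + R₂)
        + J * (R₁ + K + 3)) / c| with hB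
  have habs : ∀ x y z : ℝ, |x| ≤ |x| + |y| + |z| ∧ |y| ≤ |x| + |y| + |z| ∧ |z| ≤ |x| + |y| + |z| :=
    fun x y z => by
      have := abs_nonneg x
      have := abs_nonneg y
      have := abs_nonneg z
      refine ⟨?_, ?_, ?_⟩ <;> linarith
  -- The order of choices matters: `K`, `C`, the radii and the error coefficient `B` do not depend
  -- on `ε`. The radius `δ` is chosen after `ε`, and `n` is taken so large that both balls, of order
  -- `1 / r_n`, fit inside it.
  obtain ⟨ε, hε, hεB, hε1, hεc⟩ : ∃ ε : ℝ, 0 < ε ∧ ε * B ≤ e ∧ ε * (1 + J * C) ≤ 1 ∧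
      ε * (1 + J * C) ≤ c / 2 := by
    have hlim : ∀ a : ℝ, Tendsto (fun ε : ℝ => ε * a) (𝓝[>] 0) (𝓝 0) := fun a => by
      have : Tendsto (fun ε : ℝ => ε * a) (𝓝 0) (𝓝 (0 * a)) := tendsto_id.mul_const a
      rw [zero_mul] at this
      exact this.mono_left nhdsWithin_le_nhds
    have h1 := (hlim B).eventually (ge_mem_nhds he)
    have h2 := (hlim (1 + J * C)).eventually (ge_mem_nhds one_pos)
    have h3 := (hlim (1 + J * C)).eventually (ge_mem_nhds (half_pos hc))
    obtain ⟨ε, h⟩ := (h1.and (h2.and (h3.and self_mem_nhdsWithin))).exists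
    exact ⟨ε, h.2.2.2, h.1, h.2.1, h.2.2.1⟩
  obtain ⟨δ₁, hδ₁, hinc⟩ := (hasym.equicontinuity ε hε).exists_radius hη4
  obtain ⟨δ₂, hδ₂, hjac⟩ := (hasym.jacobianΨΨ ε hε).exists_radius hη4
  have happ := withHighProb_iff.1 (hboot.withHighProb hε) _ hη4
  set δ := min δ₁ δ₂ with hδ
  have hδ0 : 0 < δ := lt_min hδ₁ hδ₂
  have hrad : ∀ R : ℝ, ∀ᶠ n in atTop, (R + 1) / M.r n ≤ δ := fun R =>
    (Tendsto.div_atTop tendsto_const_nhds hM.r_tendsto).eventually (ge_mem_nhds hδ0)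
  have hsize : ∀ᶠ n in atTop, ∀ j, |(M.size n j : ℝ) / n - ξ j| ≤ ε := by
    refine eventually_all.2 fun j => ?_
    have h1 := ((hasym.cluster_size j).sub_const (ξ j)).abs
    rw [sub_self, abs_zero] at h1
    exact h1.eventually (ge_mem_nhds hε)
  filter_upwards [hinc, hjac, hK, happ, hrad R₁, hrad R₂, hsize, eventually_gt_atTop 0]
    with n h1 h2 h3 h4 hr₁ hr₂ hs hn
  refine measure_not_le_of_imp ((LocallyUniformly.mono_radius (min_le_left δ₁ δ₂)).trans h1)
    ((LocallyUniformly.mono_radius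
    (P := fun n ω j τ v => M.JacΨΨClose μ fε (QΨΨ j τ) ε n ω j τ v) (min_le_right δ₁ δ₂)).trans h2)
    h3 h4
    fun ω g1 g2 g3 g4 τ => ?_
  have hn' : (n : ℝ) ≠ 0 := by positivity
  have hexp : ScoreExpansion (stack (M.γn n τ) 0)
      (fun j π => M.avg n j (fun d => score (M.Φhat n ω) (M.Vhat n ω) j τ d (M.β₀ τ) π) ω)
      (fun j => M.avg n j (fun d => score M.Φ M.V j τ d (M.βn n τ) (stack (M.γn n τ) 0)) ω)
      (fun j => QΨΨ j τ) (fun j => (M.size n j : ℝ) / n) ξ (fun j => 𝒵 j τ ω)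
      c C ε δ (M.r n) K :=
    -- The null hypothesis enters here: the estimated scores are computed at `β₀` and the expansion
    -- is centered at `βn`.
    { expansion := fun j v hv => by
        have := norm_avg_score_sub_add_le hM hmodel hasym.density g1 g2 j τ hv
        rwa [hnull] at this ⊢
      score_le := fun j => g3 j τ
      approx := fun j => g4 j τ
      norm_le := fun j => hC j τ
      block := fun j => toBlocks₂₁_eq_zero (hasym.isSymm j τ) (hboot.orthogonal j τ)
      p_nonneg := fun j => by positivity
      p_sum := by
        rw [← Finset.sum_div, div_eq_one_iff_eq hn']
        exact_mod_cast hM.total n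
      p_sub := hs
      coercive := fun x => ((rayleighBounds_iff.1 (hbd τ)) x).1
      r_pos := hM.r_pos n
      ε_pos := hε
      c_pos := hc }
  have hnullscore : ∀ j, M.nullScore est n ω j τ = ((n : ℝ) * ((M.size n j : ℝ) / n)) •
      M.avg n j (fun d => score (M.Φhat n ω) (M.Vhat n ω) j τ d (M.β₀ τ)
        (stack (upper (est n ω (M.β₀ τ) τ)) 0)) ω := fun j => by
    rw [mul_div_cancel₀ _ hn', ← sum_eq_size_smul_avg]; rfl
  have hQΦ : (∑ j, ξ j • QΨΨ j τ).toBlocks₂₂ = QΦΦ QΨΨ ξ τ := by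
    ext a b
    simp [QΦΦ, Matrix.toBlocks₂₂, Matrix.sum_apply]
  obtain ⟨r1, r2, r3⟩ := hexp.statistics (N := n) (by positivity)
    (M.continuous_objective n ω (M.β₀ τ) τ) (objective_subgradient hM hn ω (M.β₀ τ) τ)
    (hest n ω (M.β₀ τ) τ) (xb := fun g => boot n ω g (M.β₀ τ) τ) (fun g => by
      have := hbootest n ω g (M.β₀ τ) τ
      unfold bootObjective at this
      simp_rw [hnullscore] at this
      exact this) hR₁ hK₂ hR₂ hε1 hεc hr₁ hr₂
  rw [hQΦ] at r2 r3
  have hBe : ∀ b : ℝ, |b| ≤ B → ε * b ≤ e := fun b hb =>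
    (mul_le_mul_of_nonneg_left ((le_abs_self b).trans hb) hε.le).trans hεB
  refine ⟨fun j => ?_, ?_, fun g => ?_⟩
  · have h5 : (M.r n / n) • lower (M.nullScore est n ω j τ)
        = (M.r n * ((M.size n j : ℝ) / n)) • lower (M.avg n j
          (fun d => score (M.Φhat n ω) (M.Vhat n ω) j τ d (M.β₀ τ)
            (stack (upper (est n ω (M.β₀ τ) τ)) 0)) ω) := by
      rw [hnullscore, ← lowerL_apply, map_smul, lowerL_apply, smul_smul]
      congr 1
      field_simp
    rw [h5]
    exact (r1 j).trans (hBe _ (habs _ _ _).1)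
  · refine r2.trans ?_
    rw [mul_div_assoc]
    exact hBe _ (habs _ _ _).2.1
  · refine (r3 g).trans ?_
    rw [mul_div_assoc]
    exact hBe _ (habs _ _ _).2.2

end Limits

end IVQR

/-! ### Countable determination of tight processes -/

section Separability

variable {Ω : Type*} [MeasurableSpace Ω] {μ : Measure Ω} {ι E : Type*} [NormedAddCommGroup E]

lemma IsTightProcess.ae_mem {Z : ι → Ω → E} (hZ : IsTightProcess μ Z) :
    ∃ K : ℕ → Set (ι →ᵤ E), (∀ m, IsCompact (K m)) ∧
      ∀ᵐ ω ∂μ, ∃ m, UniformFun.ofFun (fun i => Z i ω) ∈ K m := by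
  choose K hK _ hμ using fun m : ℕ => hZ ((m + 1 : ℝ≥0∞)⁻¹) (by simp)
  refine ⟨K, hK, ?_⟩
  rw [ae_iff]
  refine le_antisymm (le_of_forall_gt fun ε hε => ?_) zero_le
  obtain ⟨m, hm⟩ := ENNReal.exists_inv_nat_lt hε.ne'
  refine lt_of_le_of_lt ?_ hm
  calc _ ≤ μ {ω | UniformFun.ofFun (fun i => Z i ω) ∉ K m} := by
        refine measure_mono ?_
        intro ω hω hm
        exact hω ⟨m, hm⟩
    _ ≤ (m + 1 : ℝ≥0∞)⁻¹ := hμ m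
    _ ≤ _ := ENNReal.inv_le_inv.2 le_self_add

/-- Compact sets are totally bounded for the uniform distance; the centers of finite covers at the
scales `1 / (l + 1)` form a countable approximating family. -/
lemma IsCompact.exists_countable_dense_uniformFun {K : Set (ι →ᵤ E)} (hK : IsCompact K) :
    ∃ T : Set (ι → E), T.Countable ∧
      ∀ f ∈ K, ∀ ε > 0, ∃ g ∈ T, ∀ i, dist (UniformFun.toFun f i) (g i) < ε := by
  have hV : ∀ l : ℕ, UniformFun.gen ι E {p : E × E | dist p.1 p.2 < 1 / (l + 1 : ℝ)}
      ∈ uniformity (ι →ᵤ E) := fun l =>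
    (UniformFun.hasBasis_uniformity ι E).mem_of_mem (Metric.dist_mem_uniformity (by positivity))
  choose t ht htK using fun l => hK.totallyBounded _ (hV l)
  refine ⟨⋃ l, UniformFun.toFun '' (t l), countable_iUnion fun l => (ht l).countable.image _,
    fun f hf ε hε => ?_⟩
  obtain ⟨l, hl⟩ := exists_nat_one_div_lt hε
  have := htK l hf
  simp only [mem_iUnion] at this
  obtain ⟨y, hy, hfy⟩ := this
  refine ⟨UniformFun.toFun y, mem_iUnion.2 ⟨l, mem_image_of_mem _ hy⟩, fun i => ?_⟩
  exact (UniformFun.mem_gen.1 hfy i).trans hl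

/-- The joint path of finitely many tight processes and of a deterministic function is determined,
up to closure, by countably many indices. -/
lemma exists_countable_closure [SecondCountableTopology E] {J : ℕ} {X : Type*} [TopologicalSpace X]
    [SecondCountableTopology X] {Z : Fin J → ι → Ω → E} (hZ : ∀ j, IsTightProcess μ (Z j))
    (e : ι → X) : ∃ D : Set ι, D.Countable ∧ ∀ᵐ ω ∂μ, ∀ i,
      ((fun j => Z j i ω, e i) : (Fin J → E) × X) ∈ closure ((fun i => (fun j => Z j i ω, e i)) '' D) := by
  choose K hK hae using fun j => (hZ j).ae_mem
  choose T hT hTK using fun j m => (hK j m).exists_countable_dense_uniformFun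
  set F : Set (ι → E) := ⋃ j, ⋃ m, T j m with hF
  have hFc : Countable F := (countable_iUnion fun j => countable_iUnion fun m => hT j m).to_subtype
  -- The index set receives the coarsest topology making the countably many approximating functions
  -- and `e` continuous. It is second countable, hence separable, and the paths, being uniform
  -- limits of continuous functions, are almost surely continuous for it.
  let Φ : ι → (F → E) × X := fun i => (fun f => f.1 i, e i)
  let _ : TopologicalSpace ι := TopologicalSpace.induced Φ inferInstance
  have : SecondCountableTopology ι := TopologicalSpace.secondCountableTopology_induced ι _ Φ
  obtain ⟨D, hD, hdense⟩ := TopologicalSpace.exists_countable_dense ι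
  have hΦ : Continuous Φ := continuous_induced_dom
  have hFcont : ∀ f ∈ F, Continuous f := fun f hf =>
    (continuous_apply (⟨f, hf⟩ : F)).comp (continuous_fst.comp hΦ)
  have he : Continuous e := continuous_snd.comp hΦ
  refine ⟨D, hD, ?_⟩
  filter_upwards [ae_all_iff.2 hae] with ω hω i
  have hcont : ∀ j, Continuous fun i => Z j i ω := fun j => by
    obtain ⟨m, hm⟩ := hω j
    refine continuous_of_uniform_approx_of_continuous fun u hu => ?_
    obtain ⟨ε, hε, hεu⟩ := Metric.mem_uniformity_dist.1 hu
    obtain ⟨g, hg, hgd⟩ := hTK j m _ hm ε hε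
    exact ⟨g, hFcont g (mem_iUnion.2 ⟨j, mem_iUnion.2 ⟨m, hg⟩⟩), fun i => hεu (hgd i)⟩
  have hpair : Continuous fun i => ((fun j => Z j i ω, e i) : (Fin J → E) × X) :=
    (continuous_pi hcont).prodMk he
  exact hpair.range_subset_closure_image_dense hdense (mem_range_self i)

end Separability

/-! ### Sign symmetry of independent centered Gaussian processes -/

section SignSymmetry

variable {Ω : Type*} [MeasurableSpace Ω] {μ : Measure Ω} [IsProbabilityMeasure μ]

/-- A Gaussian law is determined by the means and variances of its functionals. The means vanish and
negation does not change variances. -/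
lemma HasGaussianLaw.map_neg_eq {E : Type*} [NormedAddCommGroup E] [NormedSpace ℝ E]
    [MeasurableSpace E] [BorelSpace E] [CompleteSpace E] [SecondCountableTopology E] {X : Ω → E}
    (hX : HasGaussianLaw X μ) (h0 : ∫ ω, X ω ∂μ = 0) : μ.map (fun ω => -X ω) = μ.map X := by
  have hX' := hX.fun_neg
  have := Measure.isFiniteMeasure_map μ X
  have := Measure.isFiniteMeasure_map μ (fun ω => -X ω)
  refine Measure.ext_of_charFunDual ?_
  ext L
  rw [hX.charFunDual_map_eq_fun, hX'.charFunDual_map_eq_fun]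
  have h1 : ∫ ω, L (X ω) ∂μ = 0 := by
    rw [L.integral_comp_comm hX.integrable, h0, map_zero]
  have h2 : ∫ ω, L (-X ω) ∂μ = 0 := by
    simp_rw [map_neg]; rw [integral_neg, h1, neg_zero]
  have h3 : Var[fun ω => L (-X ω); μ] = Var[fun ω => L (X ω); μ] := by
    simp_rw [map_neg]; exact variance_fun_neg
  rw [h1, h2, h3]

lemma IsGaussianProcess.map_neg_eq {ι : Type*} {d : ℕ} {Z : ι → Ω → Vec d}
    (hZ : IsGaussianProcess Z μ) (hm : ∀ i, Measurable (Z i)) (h0 : ∀ i, ∫ ω, Z i ω ∂μ = 0) :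
    μ.map (fun ω i => -Z i ω) = μ.map (fun ω i => Z i ω) := by
  refine (map_eq_iff_forall_finset_map_restrict_eq (X := fun i ω => -Z i ω) (Y := Z)
    (measurable_pi_lambda _ fun i => (hm i).neg).aemeasurable
    (measurable_pi_lambda _ hm).aemeasurable).2 fun I => ?_
  have hI := hZ.hasGaussianLaw I
  have := HasGaussianLaw.map_neg_eq hI (by
    ext1 i
    rw [eval_integral fun i => ?_]
    · exact h0 i
    · exact (hZ.hasGaussianLaw_eval i).integrable)
  exact this

/-- By independence the joint law is a product of path laws, and each factor is invariant under
negation. -/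
lemma map_sgn_smul_eq {ι : Type*} {d J : ℕ} {Z : Fin J → ι → Ω → Vec d}
    (hZ : ∀ j, IsGaussianProcess (Z j) μ) (hm : ∀ j i, Measurable (Z j i))
    (h0 : ∀ j i, ∫ ω, Z j i ω ∂μ = 0) (hind : iIndepFun (fun j ω i => Z j i ω) μ) (h : Signs J) :
    μ.map (fun ω j i => sgn h j • Z j i ω) = μ.map (fun ω j i => Z j i ω) := by
  have hmeas : ∀ j, Measurable fun ω i => Z j i ω := fun j => measurable_pi_lambda _ (hm j)
  have hsm : ∀ j, Measurable fun (f : ι → Vec d) (i : ι) => sgn h j • f i := fun j =>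
    measurable_pi_lambda _ fun i => (measurable_const_smul (sgn h j)).comp (measurable_pi_apply i)
  have hind' := hind.comp (fun j f i => sgn h j • f i) hsm
  rw [(iIndepFun_iff_map_fun_eq_pi_map fun j => (hmeas j).aemeasurable).1 hind]
  have := (iIndepFun_iff_map_fun_eq_pi_map fun j => ((hsm j).comp (hmeas j)).aemeasurable).1 hind'
  refine this.trans ?_
  congr 1
  ext1 j
  rcases Int.units_eq_one_or (h j) with hj | hj
  · simp [sgn, hj, Function.comp_def]
  · have := IsGaussianProcess.map_neg_eq (hZ j) (hm j) (h0 j)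
    simpa [sgn, hj, Function.comp_def] using this

end SignSymmetry

/-! ### Null sets of polynomial functions -/

section PolyFun

open Polynomial

/-- `f` is a polynomial function of one real variable. -/
def IsPolyFun (f : ℝ → ℝ) : Prop := ∃ p : ℝ[X], ∀ t, f t = p.eval t

lemma IsPolyFun.const (a : ℝ) : IsPolyFun fun _ => a := ⟨C a, by simp⟩

lemma IsPolyFun.affine (a b : ℝ) : IsPolyFun fun t => a + t * b := ⟨C a + X * C b, fun t => by
  simp only [eval_add, eval_mul, eval_C, eval_X]⟩

lemma IsPolyFun.mul {f g : ℝ → ℝ} (hf : IsPolyFun f) (hg : IsPolyFun g) :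
    IsPolyFun fun t => f t * g t := by
  obtain ⟨p, hp⟩ := hf; obtain ⟨q, hq⟩ := hg
  exact ⟨p * q, fun t => by rw [eval_mul, ← hp, ← hq]⟩

lemma IsPolyFun.sum {ι : Type*} {s : Finset ι} {f : ι → ℝ → ℝ} (hf : ∀ i, IsPolyFun (f i)) :
    IsPolyFun fun t => ∑ i ∈ s, f i t := by
  choose p hp using hf
  exact ⟨∑ i ∈ s, p i, fun t => by rw [eval_finsetSum]; simp_rw [hp]⟩

lemma IsPolyFun.det {k : Type*} [Fintype k] [DecidableEq k] {A : ℝ → Matrix k k ℝ}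
    (hA : ∀ a b, IsPolyFun fun t => A t a b) : IsPolyFun fun t => (A t).det := by
  choose p hp using hA
  refine ⟨(Matrix.of p).det, fun t => ?_⟩
  rw [← coe_evalRingHom, RingHom.map_det]
  exact congrArg Matrix.det (Matrix.ext fun a b => by simp [hp])

lemma IsPolyFun.adjugate {k : Type*} [Fintype k] [DecidableEq k] {A : ℝ → Matrix k k ℝ}
    (hA : ∀ a b, IsPolyFun fun t => A t a b) (a b : k) :
    IsPolyFun fun t => (A t).adjugate a b := by
  simp_rw [Matrix.adjugate_apply]
  refine IsPolyFun.det fun a' b' => ?_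
  by_cases h : a' = b
  · subst h
    simpa using IsPolyFun.const _
  · simpa [Matrix.updateRow_ne h] using hA a' b'

lemma IsPolyFun.finite_zeros {f : ℝ → ℝ} (hf : IsPolyFun f) {t₀ : ℝ} (h : f t₀ ≠ 0) :
    {t | f t = 0}.Finite := by
  obtain ⟨p, hp⟩ := hf
  have hp0 : p ≠ 0 := by
    rintro rfl
    exact h (by simp [hp])
  refine (p.roots.toFinset.finite_toSet).subset fun t ht => ?_
  rw [mem_ofPred_eq, hp] at ht
  simp [hp0, ht]

/-- A function that is polynomial along all lines through a point where it does not vanish, is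
almost everywhere nonzero. -/
lemma addHaar_zeros_eq_zero {E : Type*} [NormedAddCommGroup E] [NormedSpace ℝ E]
    [FiniteDimensional ℝ E] [MeasurableSpace E] [BorelSpace E] (ν : Measure E)
    [ν.IsAddHaarMeasure] {F : E → ℝ} (hF : Measurable F) {z₀ : E} (h0 : F z₀ ≠ 0)
    (hline : ∀ z, IsPolyFun fun t => F (z₀ + t • z)) : ν {z | F z = 0} = 0 := by
  have := FiniteDimensional.proper ℝ E
  set N : Set E := {z | F (z₀ + z) = 0} with hN
  have hNm : MeasurableSet N := (hF.comp (measurable_const_add z₀)) (measurableSet_singleton 0)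
  have htrans : ν {z | F z = 0} = ν N := (measure_preimage_add ν z₀ {z | F z = 0}).symm
  rw [htrans]
  -- For fixed `z` only finitely many `t` satisfy `t • z ∈ N`, so `S` is null by Fubini. Some slice
  -- at a `t ≠ 0` is then null, and this slice is a dilate of `N`.
  set S : Set (ℝ × E) := {p | p.1 • p.2 ∈ N} with hS
  have hSm : MeasurableSet S := (measurable_fst.smul measurable_snd) hNm
  have hS0 : ((volume : Measure ℝ).prod ν) S = 0 := by
    rw [Measure.prod_apply_symm hSm]
    simp only [lintegral_eq_zero_iff' (measurable_measure_prodMk_right hSm).aemeasurable]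
    refine Eventually.of_forall fun z => ?_
    refine Set.Countable.measure_zero (Set.Finite.countable ?_) volume
    have := (hline z).finite_zeros (t₀ := 0) (by simpa using h0)
    exact this
  have h1 := Measure.ae_ae_of_ae_prod (p := fun p => p ∉ S) (by
    rw [ae_iff]; simpa using hS0)
  have h2 : ∀ᵐ t : ℝ, t ≠ 0 := by
    rw [ae_iff]; simp
  obtain ⟨t, ht, ht0⟩ := (h1.and h2).exists
  rw [ae_iff] at ht
  have h3 : {z | ¬ (t, z) ∉ S} = (fun z => t • z) ⁻¹' N := by
    ext z; simp [hS]
  rw [h3, Measure.addHaar_preimage_smul ν ht0] at ht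
  rcases mul_eq_zero.1 ht with h | h
  · rw [ENNReal.ofReal_eq_zero, abs_nonpos_iff, inv_eq_zero] at h
    exact absurd h (pow_ne_zero _ ht0)
  · exact h

end PolyFun

/-! ### Absolute continuity of nondegenerate Gaussian laws -/

section AbsCont

lemma Measure.pi_absolutelyContinuous {α : Type*} [MeasurableSpace α] : ∀ {n : ℕ}
    {μ ν : Fin n → Measure α} [∀ i, SigmaFinite (μ i)] [∀ i, SigmaFinite (ν i)],
    (∀ i, μ i ≪ ν i) → Measure.pi μ ≪ Measure.pi ν
  | 0, μ, ν, _, _, _ => by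
    rw [Measure.pi_of_empty, Measure.pi_of_empty]
  | n + 1, μ, ν, _, _, h => by
    have h1 := (measurePreserving_piFinSuccAbove μ 0).symm
    have h2 := (measurePreserving_piFinSuccAbove ν 0).symm
    rw [← h1.map_eq, ← h2.map_eq]
    refine Measure.AbsolutelyContinuous.map ?_ (MeasurableEquiv.measurable _)
    exact Measure.AbsolutelyContinuous.prod (h 0) (Measure.pi_absolutelyContinuous fun i => h _)

lemma stdGaussian_absolutelyContinuous (d : ℕ) :
    stdGaussian (Vec d) ≪ (volume : Measure (Vec d)) := by
  rw [← map_pi_eq_stdGaussian, ← (PiLp.volume_preserving_toLp (Fin d)).map_eq]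
  refine Measure.AbsolutelyContinuous.map ?_ (by fun_prop)
  exact Measure.pi_absolutelyContinuous fun _ => gaussianReal_absolutelyContinuous 0 one_ne_zero

open scoped MatrixOrder in
-- The law is the image of the standard Gaussian under the square root of `S`, which is invertible
-- and so preserves null sets.
lemma multivariateGaussian_absolutelyContinuous {d : ℕ} {S : Matrix (Fin d) (Fin d) ℝ}
    (hS : S.PosDef) : multivariateGaussian 0 S ≪ (volume : Measure (Vec d)) := by
  have hsq : CFC.sqrt S * CFC.sqrt S = S := CFC.sqrt_mul_sqrt_self _ hS.posSemidef.nonneg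
  have hunit : IsUnit (CFC.sqrt S) := by
    rw [Matrix.isUnit_iff_isUnit_det, isUnit_iff_ne_zero]
    intro h0
    have := congrArg Matrix.det hsq
    rw [Matrix.det_mul, h0, zero_mul] at this
    exact hS.det_pos.ne this
  have hdet : LinearMap.det (matOp (CFC.sqrt S)).toLinearMap ≠ 0 := by
    have h1 := (hunit.map (Matrix.toEuclideanCLM (𝕜 := ℝ) (n := Fin d))).map
      (ContinuousLinearMap.toLinearMapRingHom (R₁ := ℝ) (M₁ := Vec d))
    exact ((LinearMap.isUnit_iff_isUnit_det _).1 h1).ne_zero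
  have h2 := Measure.map_linearMap_addHaar_eq_smul_addHaar (volume : Measure (Vec d)) hdet
  have h3 := (stdGaussian_absolutelyContinuous d).map (f := matOp (CFC.sqrt S)) (by fun_prop)
  unfold multivariateGaussian
  simp only [zero_add]
  refine h3.trans ?_
  have h4 : Measure.map (matOp (CFC.sqrt S)) (volume : Measure (Vec d)) = _ := h2
  rw [h4]
  exact Measure.smul_absolutelyContinuous

lemma HasGaussianLaw.absolutelyContinuous {Ω : Type*} [MeasurableSpace Ω] {μ : Measure Ω}
    {d : ℕ} {X : Ω → Vec d} (hX : HasGaussianLaw X μ) (h0 : ∫ ω, X ω ∂μ = 0) {c C : ℝ} (hc : 0 < c)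
    (h : RayleighBounds c C (IVQR.secondMoment μ X)) : μ.map X ≪ (volume : Measure (Vec d)) := by
  have := hX.isGaussian_map
  set S := IVQR.secondMoment μ X with hSdef
  have hS : S.PosDef := by
    refine Matrix.PosDef.of_dotProduct_mulVec_pos ?_ fun x hx => ?_
    · ext a b
      simp [hSdef, IVQR.secondMoment, mul_comm]
    · rw [star_trivial]
      refine lt_of_lt_of_le ?_ (h x).1
      exact mul_pos hc (by simpa using Matrix.dotProduct_star_self_pos_iff.2 hx)
  have hmem : ∀ a, MemLp (fun ω => X ω a) 2 μ := fun a => by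
    have := hX.map_fun (EuclideanSpace.proj (𝕜 := ℝ) a)
    exact this.memLp_two
  have hint : ∀ a b, Integrable (fun ω => X ω a * X ω b) μ := fun a b =>
    (hmem a).integrable_mul (hmem b)
  have heq : μ.map X = multivariateGaussian 0 S := by
    refine IsGaussian.ext ?_ ?_
    · rw [integral_id_multivariateGaussian', integral_map hX.aemeasurable (by fun_prop)]
      exact h0
    · ext x y
      rw [covarianceBilin_multivariateGaussian hS.posSemidef,
        covarianceBilin_apply IsGaussian.memLp_two_id]
      have hm : ∫ z, z ∂(μ.map X) = 0 := by
        rw [integral_map hX.aemeasurable (by fun_prop)]; exact h0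
      simp only [id_eq, hm, sub_zero]
      rw [integral_map hX.aemeasurable (by fun_prop)]
      have h1 : ∀ ω, inner ℝ x (X ω) * inner ℝ y (X ω)
          = ∑ a, ∑ b, x a * y b * (X ω a * X ω b) := fun ω => by
        simp only [PiLp.inner_apply, RCLike.inner_apply, conj_trivial, Finset.sum_mul_sum]
        refine Finset.sum_congr rfl fun a _ => Finset.sum_congr rfl fun b _ => by ring
      simp_rw [h1]
      rw [integral_finsetSum _ fun a _ => integrable_finsetSum _ fun b _ =>
        (hint a b).const_mul _]
      simp only [dotProduct, Matrix.mulVec]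
      refine Finset.sum_congr rfl fun a _ => ?_
      rw [integral_finsetSum _ fun b _ => (hint a b).const_mul _,
        Finset.mul_sum]
      refine Finset.sum_congr rfl fun b _ => ?_
      rw [integral_const_mul]
      simp only [hSdef, IVQR.secondMoment, Matrix.of_apply]
      ring
  rw [heq]
  exact multivariateGaussian_absolutelyContinuous hS

end AbsCont

/-! ### Perturbation of weighted norms -/

section WeightedNorm

variable {d : ℕ}

lemma matOp_sub (A B : Matrix (Fin d) (Fin d) ℝ) (x : Vec d) :
    matOp (A - B) x = matOp A x - matOp B x := by
  rw [matOp, map_sub]; rfl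

lemma wnorm_eq (A : Matrix (Fin d) (Fin d) ℝ) (u : Vec d) :
    wnorm A u = √(inner ℝ u (matOp A u)) := by
  rw [wnorm, Matrix.inner_toEuclideanCLM]

lemma wnorm_smul_smul (A : Matrix (Fin d) (Fin d) ℝ) (u : Vec d) {a b : ℝ} (ha : 0 ≤ a)
    (hb : 0 ≤ b) : wnorm (a • A) (b • u) = b * √a * wnorm A u := by
  have h : inner ℝ (b • u) (matOp (a • A) (b • u)) = b ^ 2 * a * inner ℝ u (matOp A u) := by
    rw [matOp_smul, smul_apply, map_smul, real_inner_smul_left, real_inner_smul_right, real_inner_smul_right]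
    ring
  rw [wnorm_eq, wnorm_eq, h, Real.sqrt_mul (by positivity), Real.sqrt_mul (by positivity),
    Real.sqrt_sq hb]

lemma Real.sqrt_le_sqrt_add_sqrt_abs_sub (a b : ℝ) : √a ≤ √b + √|a - b| := by
  rw [Real.sqrt_le_left (by positivity), add_sq, Real.sq_sqrt (abs_nonneg _)]
  rcases le_total 0 b with hb | hb
  · rw [Real.sq_sqrt hb]
    have := le_abs_self (a - b)
    have : 0 ≤ 2 * √b * √|a - b| := by positivity
    linarith
  · have := le_abs_self (a - b)
    rw [Real.sqrt_eq_zero_of_nonpos hb]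
    nlinarith

lemma abs_inner_matOp_sub_le {A A' : Matrix (Fin d) (Fin d) ℝ} {u u' : Vec d} {e B C : ℝ}
    (hA : ‖A' - A‖ ≤ e) (hu : ‖u' - u‖ ≤ e) (he1 : e ≤ 1) (hB : ‖u‖ ≤ B)
    (hC : ‖A‖ ≤ C) :
    |inner ℝ u' (matOp A' u') - inner ℝ u (matOp A u)| ≤ e * ((B + 1) ^ 2 + C * (2 * B + 1)) := by
  have he : 0 ≤ e := (norm_nonneg _).trans hA
  have hB0 : 0 ≤ B := (norm_nonneg _).trans hB
  have hC0 : 0 ≤ C := (norm_nonneg _).trans hC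
  have hu' : ‖u'‖ ≤ B + 1 := by
    have := norm_le_norm_add_norm_sub' u' u
    linarith
  have key : inner ℝ u' (matOp A' u') - inner ℝ u (matOp A u)
      = inner ℝ u' (matOp (A' - A) u') + inner ℝ (u' - u) (matOp A u')
        + inner ℝ u (matOp A (u' - u)) := by
    rw [matOp_sub, (matOp A).map_sub]
    simp only [inner_sub_left, inner_sub_right]
    ring
  have h1 : |inner ℝ u' (matOp (A' - A) u')| ≤ (B + 1) * (e * (B + 1)) :=
    (abs_real_inner_le_norm _ _).trans (by
      have := norm_matOp_apply_le (A' - A) u'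
      have : ‖A' - A‖ * ‖u'‖ ≤ e * (B + 1) := by gcongr
      gcongr
      linarith)
  have h2 : |inner ℝ (u' - u) (matOp A u')| ≤ e * (C * (B + 1)) :=
    (abs_real_inner_le_norm _ _).trans (by
      have := norm_matOp_apply_le A u'
      have : ‖A‖ * ‖u'‖ ≤ C * (B + 1) := by gcongr
      gcongr
      linarith)
  have h3 : |inner ℝ u (matOp A (u' - u))| ≤ B * (C * e) :=
    (abs_real_inner_le_norm _ _).trans (by
      have := norm_matOp_apply_le A (u' - u)
      have : ‖A‖ * ‖u' - u‖ ≤ C * e := by gcongr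
      gcongr
      linarith)
  rw [key]
  have h4 := abs_add_three (inner ℝ u' (matOp (A' - A) u')) (inner ℝ (u' - u) (matOp A u'))
    (inner ℝ u (matOp A (u' - u)))
  nlinarith

/-- The comparison is made on quadratic forms with tolerance `ε ^ 2`. Estimated weights need not be
positive semidefinite, but the inequality for square roots behind it holds for all reals, with
negative values truncated at zero. -/
lemma supNorm_le_supNorm_add {Υ : Set ℝ} {A A' : Υ → Matrix (Fin d) (Fin d) ℝ} {u u' : Υ → Vec d}
    {ε : NNReal}
    (h : ∀ τ, |inner ℝ (u τ) (matOp (A τ) (u τ)) - inner ℝ (u' τ) (matOp (A' τ) (u' τ))|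
      ≤ (ε : ℝ) ^ 2) : supNorm A u ≤ supNorm A' u' + ε := by
  refine iSup_le fun τ => ?_
  have h1 : wnorm (A τ) (u τ) ≤ wnorm (A' τ) (u' τ) + ε := by
    rw [wnorm_eq, wnorm_eq]
    refine (Real.sqrt_le_sqrt_add_sqrt_abs_sub _ (inner ℝ (u' τ) (matOp (A' τ) (u' τ)))).trans ?_
    gcongr
    exact Real.sqrt_le_iff.2 ⟨ε.2, h τ⟩
  calc ENNReal.ofReal (wnorm (A τ) (u τ)) ≤ ENNReal.ofReal (wnorm (A' τ) (u' τ) + ε) :=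
        ENNReal.ofReal_le_ofReal h1
    _ ≤ ENNReal.ofReal (wnorm (A' τ) (u' τ)) + ENNReal.ofReal ε := ENNReal.ofReal_add_le
    _ ≤ supNorm A' u' + ε := by
        rw [ENNReal.ofReal_coe_nnreal]
        gcongr
        exact le_iSup (fun τ => ENNReal.ofReal (wnorm (A' τ) (u' τ))) τ

lemma ofReal_mul_supNorm {Υ : Set ℝ} (A : Υ → Matrix (Fin d) (Fin d) ℝ) (u : Υ → Vec d) {s r : ℝ}
    (hs : 0 < s) (hr : 0 ≤ r) : ENNReal.ofReal (r / √s) * supNorm A u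
      = supNorm (fun τ => s⁻¹ • A τ) (fun τ => r • u τ) := by
  rw [supNorm, ENNReal.mul_iSup, supNorm]
  congr 1
  ext1 τ
  rw [wnorm_smul_smul _ _ (inv_nonneg.2 hs.le) hr, ← ENNReal.ofReal_mul (by positivity),
    Real.sqrt_inv, div_eq_mul_inv]

end WeightedNorm

/-! ### Outer products and inverses -/

section Perturbation

variable {d : ℕ}

lemma matOp_outerProd (x y : Vec d) : matOp (outerProd x) y = (inner ℝ x y : ℝ) • x := by
  ext a
  have h : inner ℝ x y = x.ofLp ⬝ᵥ y.ofLp := by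
    rw [EuclideanSpace.inner_eq_star_dotProduct, star_trivial, dotProduct_comm]
  rw [PiLp.smul_apply, h, smul_eq_mul]
  simp [outerProd, Matrix.ofLp_toEuclideanCLM, Matrix.vecMulVec_mulVec, mul_comm]

lemma outerProd_smul (a : ℝ) (x : Vec d) : outerProd (a • x) = a ^ 2 • outerProd x := by
  ext i j
  simp [outerProd, Matrix.vecMulVec_apply]
  ring

lemma norm_outerProd_sub_le (x y : Vec d) :
    ‖outerProd x - outerProd y‖ ≤ ‖x - y‖ * (‖x‖ + ‖y‖) := by
  rw [← norm_matOp]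
  refine ContinuousLinearMap.opNorm_le_bound _ (by positivity) fun z => ?_
  have h : matOp (outerProd x - outerProd y) z
      = (inner ℝ (x - y) z : ℝ) • x + (inner ℝ y z : ℝ) • (x - y) := by
    rw [matOp_sub, matOp_outerProd, matOp_outerProd, inner_sub_left]
    module
  rw [h]
  refine (norm_add_le _ _).trans ?_
  rw [norm_smul, norm_smul]
  have h1 := norm_inner_le_norm (𝕜 := ℝ) (x - y) z
  have h2 := norm_inner_le_norm (𝕜 := ℝ) y z
  calc _ ≤ ‖x - y‖ * ‖z‖ * ‖x‖ + ‖y‖ * ‖z‖ * ‖x - y‖ := by gcongr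
    _ = _ := by ring

lemma norm_outerProd_le (x : Vec d) : ‖outerProd x‖ ≤ ‖x‖ ^ 2 := by
  have h0 : outerProd (0 : Vec d) = 0 := by ext i j; simp [outerProd, Matrix.vecMulVec_apply]
  simpa [h0, sq] using norm_outerProd_sub_le x 0

/-- A perturbation of size at most `k / 2` leaves `B'` bounded below by `k / 2`, and the resolvent
identity gives the factor `1 / (k / 2) * (1 / k)`. -/
lemma norm_inv_sub_inv_le {B B' : Matrix (Fin d) (Fin d) ℝ} {k e : ℝ} (hk : 0 < k)
    (hB : ∀ x : Vec d, k * ‖x‖ ≤ ‖matOp B x‖) (he : ‖B' - B‖ ≤ e) (hek : e ≤ k / 2) :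
    ‖B'⁻¹ - B⁻¹‖ ≤ 2 / k ^ 2 * e := by
  have hB' : ∀ x : Vec d, k / 2 * ‖x‖ ≤ ‖matOp B' x‖ := fun x => by
    have h1 := norm_matOp_apply_le (B' - B) x
    have h2 : ‖B' - B‖ * ‖x‖ ≤ k / 2 * ‖x‖ := by gcongr; linarith
    have h3 : matOp (B' - B) x = matOp B' x - matOp B x := by
      rw [matOp_sub]
    have h4 := norm_sub_norm_le (matOp B x) (matOp B' x)
    rw [h3, norm_sub_rev] at h1
    have := hB x
    linarith
  have hk2 : 0 < k / 2 := by positivity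
  have hu := isUnit_det_of_le_norm_matOp hk hB
  have hu' := isUnit_det_of_le_norm_matOp hk2 hB'
  have heq : B'⁻¹ - B⁻¹ = -(B'⁻¹ * (B' - B) * B⁻¹) := by
    rw [mul_sub, sub_mul, Matrix.nonsing_inv_mul _ hu', one_mul, mul_assoc,
      Matrix.mul_nonsing_inv _ hu, mul_one, neg_sub]
  rw [heq, norm_neg]
  have h1 := norm_inv_le_of_le_norm_matOp hk hB
  have h2 := norm_inv_le_of_le_norm_matOp hk2 hB'
  have he0 : 0 ≤ e := (norm_nonneg _).trans he
  calc ‖B'⁻¹ * (B' - B) * B⁻¹‖ ≤ ‖B'⁻¹‖ * ‖B' - B‖ * ‖B⁻¹‖ :=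
        (norm_mul_le _ _).trans (by gcongr; exact norm_mul_le _ _)
    _ ≤ 1 / (k / 2) * e * (1 / k) := by gcongr
    _ = _ := by field_simp

lemma norm_conj_sub_conj_le {H H' S S' : Matrix (Fin d) (Fin d) ℝ} {e h m : ℝ} (he1 : e ≤ 1)
    (hH : ‖H' - H‖ ≤ e) (hS : ‖S' - S‖ ≤ e) (hh : ‖H‖ ≤ h) (hm : ‖S‖ ≤ m) :
    ‖H' * S' * H' - H * S * H‖ ≤ e * ((m + 1) * (h + 1) + h * (h + 1) + h * m) := by
  have hh0 : 0 ≤ h := (norm_nonneg _).trans hh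
  have hm0 : 0 ≤ m := (norm_nonneg _).trans hm
  have he0 : 0 ≤ e := (norm_nonneg _).trans hH
  have hH' : ‖H'‖ ≤ h + 1 := by
    have := norm_le_norm_add_norm_sub' H' H
    linarith
  have hS' : ‖S'‖ ≤ m + 1 := by
    have := norm_le_norm_add_norm_sub' S' S
    linarith
  have key : H' * S' * H' - H * S * H
      = (H' - H) * S' * H' + H * (S' - S) * H' + H * S * (H' - H) := by noncomm_ring
  have hmul : ∀ A B C : Matrix (Fin d) (Fin d) ℝ, ‖A * B * C‖ ≤ ‖A‖ * ‖B‖ * ‖C‖ := fun A B C =>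
    (norm_mul_le _ _).trans (by gcongr; exact norm_mul_le _ _)
  rw [key]
  refine norm_add₃_le.trans ?_
  calc _ ≤ ‖H' - H‖ * ‖S'‖ * ‖H'‖ + ‖H‖ * ‖S' - S‖ * ‖H'‖ + ‖H‖ * ‖S‖ * ‖H' - H‖ :=
        add_le_add (add_le_add (hmul _ _ _) (hmul _ _ _)) (hmul _ _ _)
    _ ≤ e * (m + 1) * (h + 1) + h * e * (h + 1) + h * m * e := by gcongr
    _ = _ := by ring

/-- Coercivity of `H S H` for symmetric `H`. -/
lemma coercive_conj {H S : Matrix (Fin d) (Fin d) ℝ} (hH : H.IsSymm) {c c' : ℝ} (hc : 0 ≤ c)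
    (hS : ∀ x : Vec d, c * ‖x‖ ^ 2 ≤ inner ℝ x (matOp S x))
    (hHH : ∀ x : Vec d, c' * ‖x‖ ^ 2 ≤ ‖matOp H x‖ ^ 2) (x : Vec d) :
    c * c' * ‖x‖ ^ 2 ≤ inner ℝ x (matOp (H * S * H) x) := by
  rw [matOp_mul, matOp_mul, inner_matOp_comm hH, real_inner_comm]
  have h1 := hS (matOp H x)
  have h2 := mul_le_mul_of_nonneg_left (hHH x) hc
  linarith

lemma inner_matOp_transpose_mul (H : Matrix (Fin d) (Fin d) ℝ) (x : Vec d) :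
    inner ℝ x (matOp (H.transpose * H) x) = ‖matOp H x‖ ^ 2 := by
  rw [← real_inner_self_eq_norm_sq, Matrix.inner_toEuclideanCLM, ← Matrix.mulVec_mulVec,
    Matrix.dotProduct_mulVec, Matrix.vecMul_transpose, EuclideanSpace.inner_eq_star_dotProduct,
    star_trivial, Matrix.ofLp_toEuclideanCLM]

end Perturbation

/-! ### Approximation of the statistics by their limits -/

namespace IVQR

variable {Ω : Type*} {J dw dz dφ : ℕ} {Υ : Set ℝ} {M : IVQR Ω J dw dz dφ Υ}
  {QΨΨ : Fin J → Υ → Matrix (Fin dw ⊕ Fin dφ) (Fin dw ⊕ Fin dφ) ℝ}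
  {ξ : Fin J → ℝ} {𝒵 : Fin J → Υ → Ω → Vec dφ}

lemma coercive_QΦΦ {c C : ℝ} (h : ∀ τ, RayleighBounds c C (∑ j, ξ j • QΨΨ j τ)) (τ : Υ)
    (x : Vec dφ) : c * ‖x‖ ^ 2 ≤ inner ℝ x (matOp (QΦΦ QΨΨ ξ τ) x) := by
  have h22 : (∑ j, ξ j • QΨΨ j τ).toBlocks₂₂ = QΦΦ QΨΨ ξ τ := by
    ext a b; simp [QΦΦ, Matrix.toBlocks₂₂, Matrix.sum_apply]
  rw [← h22]
  exact coercive_toBlocks₂₂ (fun y => ((rayleighBounds_iff.1 (h τ)) y).1) x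

lemma norm_sum_smul_le {z : Fin J → Vec dφ} {B : ℝ} (hz : ∀ j, ‖z j‖ ≤ B) (g : Signs J) :
    ‖∑ j, (ξ j * sgn g j) • z j‖ ≤ (∑ j, |ξ j|) * B := by
  rw [Finset.sum_mul]
  refine norm_sum_le_of_le _ fun j _ => ?_
  rw [norm_smul, Real.norm_eq_abs, abs_mul, abs_sgn, mul_one]
  exact mul_le_mul_of_nonneg_left (hz j) (abs_nonneg _)

lemma inner_limitCRVE (ω : Ω) (τ : Υ) (x : Vec dφ) :
    inner ℝ x (matOp (limitCRVE ξ 𝒵 ω τ) x) = ∑ j, (ξ j * inner ℝ (𝒵 j τ ω) x) ^ 2 := by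
  have h : matOp (limitCRVE ξ 𝒵 ω τ) x = ∑ j, ξ j ^ 2 • (inner ℝ (𝒵 j τ ω) x : ℝ) • 𝒵 j τ ω := by
    rw [limitCRVE, matOp, map_sum, sum_apply]
    refine Finset.sum_congr rfl fun j _ => ?_
    rw [← matOp_outerProd, ← smul_apply]
    exact congrArg (fun F : Vec dφ →L[ℝ] Vec dφ => F x) (matOp_smul _ _)
  rw [h, inner_sum]
  refine Finset.sum_congr rfl fun j _ => ?_
  rw [real_inner_smul_right, real_inner_smul_right, real_inner_comm x]
  ring

lemma limitCRVE_eq (ω : Ω) (τ : Υ) : limitCRVE ξ 𝒵 ω τ = ∑ j, outerProd (ξ j • 𝒵 j τ ω) := by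
  simp_rw [limitCRVE, outerProd_smul]

lemma norm_limitCRVE_le {ω : Ω} {τ : Υ} {B : ℝ} (hB : ∀ j, ‖𝒵 j τ ω‖ ≤ B) :
    ‖limitCRVE ξ 𝒵 ω τ‖ ≤ ∑ j, (|ξ j| * B) ^ 2 := by
  rw [limitCRVE_eq]
  refine norm_sum_le_of_le _ fun j _ => (norm_outerProd_le _).trans ?_
  rw [norm_smul, Real.norm_eq_abs]
  gcongr
  exact hB j

lemma scaled_nullCRVE_eq (M : IVQR Ω J dw dz dφ Υ) (est : ℕ → Ω → ℝ → Υ → StackVec dw dφ)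
    {n : ℕ} (hn : 0 < n) (ω : Ω) (τ : Υ) :
    (M.r n ^ 2 / n) • M.nullCRVE est n ω τ
      = ∑ j, outerProd ((M.r n / n) • lower (M.nullScore est n ω j τ)) := by
  have hn' : (n : ℝ) ≠ 0 := by positivity
  simp_rw [outerProd_smul]
  rw [nullCRVE, smul_smul, ← Finset.smul_sum]
  congr 1
  field_simp

lemma norm_scaled_nullCRVE_sub_le {est : ℕ → Ω → ℝ → Υ → StackVec dw dφ} {n : ℕ} (hn : 0 < n)
    {ω : Ω} {τ : Υ} {B e : ℝ} (he1 : e ≤ 1) (hB : ∀ j, ‖𝒵 j τ ω‖ ≤ B)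
    (he : ∀ j, ‖(M.r n / n) • lower (M.nullScore est n ω j τ) - ξ j • 𝒵 j τ ω‖ ≤ e) :
    ‖(M.r n ^ 2 / n) • M.nullCRVE est n ω τ - limitCRVE ξ 𝒵 ω τ‖
      ≤ e * ∑ j, (2 * (|ξ j| * B) + 1) := by
  rw [scaled_nullCRVE_eq M est hn, limitCRVE_eq, ← Finset.sum_sub_distrib, Finset.mul_sum]
  refine norm_sum_le_of_le _ fun j _ => (norm_outerProd_sub_le _ _).trans ?_
  have h1 : ‖ξ j • 𝒵 j τ ω‖ ≤ |ξ j| * B := by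
    rw [norm_smul, Real.norm_eq_abs]
    exact mul_le_mul_of_nonneg_left (hB j) (abs_nonneg _)
  have h2 := norm_le_norm_add_norm_sub' ((M.r n / n) • lower (M.nullScore est n ω j τ))
    (ξ j • 𝒵 j τ ω)
  have h3 := he j
  have he0 : 0 ≤ e := (norm_nonneg _).trans h3
  refine mul_le_mul h3 ?_ (by positivity) he0
  linarith

/-- No invertibility is required: in the singular case both inverses are zero by convention. -/
lemma scaled_weightCR_eq (M : IVQR Ω J dw dz dφ Υ) (est : ℕ → Ω → ℝ → Υ → StackVec dw dφ)
    (Hhat : ℕ → Ω → Υ → Matrix (Fin dφ) (Fin dφ) ℝ) {n : ℕ} {ω : Ω} {τ : Υ} {a : ℝ}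
    (ha : a ≠ 0) : a⁻¹ • M.weightCR est Hhat n ω τ
      = (Hhat n ω τ * (a • M.nullCRVE est n ω τ) * Hhat n ω τ)⁻¹ := by
  rw [mul_smul_comm, smul_mul_assoc, weightCR]
  set S := Hhat n ω τ * M.nullCRVE est n ω τ * Hhat n ω τ
  by_cases h : IsUnit S.det
  · exact (Matrix.inv_smul' S (Units.mk0 a ha) h).symm
  · rw [Matrix.nonsing_inv_apply_not_isUnit _ h, smul_zero, Matrix.nonsing_inv_apply_not_isUnit]
    rw [Matrix.det_smul]
    intro h'
    exact h (isUnit_of_mul_isUnit_right h')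

lemma norm_limitWeightCR_le {H : Υ → Matrix (Fin dφ) (Fin dφ) ℝ} {ω : Ω} {τ : Υ} {c c' : ℝ}
    (hH : (H τ).IsSymm) (hc : 0 < c) (hc' : 0 < c')
    (hHc : ∀ x, c * ‖x‖ ^ 2 ≤ ‖matOp (H τ) x‖ ^ 2)
    (hlow : ∀ x : Vec dφ, c' * ‖x‖ ^ 2 ≤ inner ℝ x (matOp (limitCRVE ξ 𝒵 ω τ) x)) :
    ‖limitWeightCR ξ 𝒵 H ω τ‖ ≤ 1 / (c' * c) :=
  norm_inv_le_of_le_norm_matOp (by positivity)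
    (norm_le_of_coercive (coercive_conj hH hc'.le hlow hHc))

variable [MeasurableSpace Ω] {μ : Measure Ω} {𝓑 : Set ℝ} {𝓡 : Set (Vec dw)} {𝓣 : Set (Vec dφ)}
  {fε : ℕ → Fin J → ℕ → Υ → ℝ → Vec dw × Vec dz → ℝ} {QΨX : Fin J → Υ → StackVec dw dφ}

/-- The sequence `s` normalizes the weight: it is constant for a deterministic limit and `r_n ^ 2 /
n` for the cluster-robust one. Statistic and bootstrap statistics are multiplied by the same factor
`r_n / √(s n)`. -/
theorem withHighProb_limitAR [IsProbabilityMeasure μ]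
    {est : ℕ → Ω → ℝ → Υ → StackVec dw dφ} {boot : ℕ → Ω → Signs J → ℝ → Υ → StackVec dw dφ}
    (hM : M.Setup μ) (hmodel : M.ModelAssumption μ 𝓑 𝓡 𝓣)
    (hasym : M.AsymptoticAssumption μ 𝓑 𝓡 𝓣 fε QΨΨ QΨX ξ)
    (hboot : M.BootstrapAssumption μ QΨΨ 𝒵) (hnull : ∀ n τ, M.βn n τ = M.β₀ τ)
    (hest : M.IsEstimator est) (hbootest : M.IsBootEstimator est boot)
    {Ahat : ℕ → Ω → Υ → Matrix (Fin dφ) (Fin dφ) ℝ} {A : Ω → Υ → Matrix (Fin dφ) (Fin dφ) ℝ}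
    {s : ℕ → ℝ} (hs : ∀ᶠ n in atTop, 0 < s n)
    (hA : ∀ e : ℝ, 0 < e →
      WithHighProb μ (fun n ω => ∀ τ : Υ, ‖(s n)⁻¹ • Ahat n ω τ - A ω τ‖ ≤ e))
    (hAb : ∀ η : ℝ≥0∞, 0 < η → ∃ C : ℝ, μ {ω | ¬ ∀ τ : Υ, ‖A ω τ‖ ≤ C} ≤ η)
    {ε : NNReal} (hε : 0 < ε) :
    WithHighProb μ (fun n ω =>
      (∀ g, ENNReal.ofReal (M.r n / √(s n)) * M.ARboot est boot Ahat n ω g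
            ≤ limitAR QΨΨ ξ 𝒵 A ω g + ε ∧
          limitAR QΨΨ ξ 𝒵 A ω g
            ≤ ENNReal.ofReal (M.r n / √(s n)) * M.ARboot est boot Ahat n ω g + ε) ∧
        ENNReal.ofReal (M.r n / √(s n)) * M.AR est Ahat n ω ≤ limitAR QΨΨ ξ 𝒵 A ω 1 + ε ∧
        limitAR QΨΨ ξ 𝒵 A ω 1 ≤ ENNReal.ofReal (M.r n / √(s n)) * M.AR est Ahat n ω + ε) := by
  rw [withHighProb_iff]
  intro η hη
  have hη4 : 0 < η / 4 := ENNReal.div_pos hη.ne' (by simp)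
  obtain ⟨c, C', hc, hbd⟩ := hasym.eigenvalues
  obtain ⟨B, hB⟩ := hboot.exists_norm_le hasym hM hη4
  obtain ⟨C, hC⟩ := hAb _ hη4
  set U := 1 / c * ((∑ j, |ξ j|) * B) with hU
  set K := |(U + 1) ^ 2 + C * (2 * U + 1)| with hK
  -- The error in the quadratic forms is `e * K` and must stay below `ε ^ 2`; `K + 1` avoids
  -- division by zero, and the perturbation bound requires `e ≤ 1`.
  set e := min 1 ((ε : ℝ) ^ 2 / (K + 1)) with he
  have he0 : 0 < e := lt_min one_pos (by positivity)
  have heK : e * K ≤ (ε : ℝ) ^ 2 := by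
    have h1 : e ≤ (ε : ℝ) ^ 2 / (K + 1) := min_le_right _ _
    rw [le_div_iff₀ (by positivity)] at h1
    linarith
  have h1 := withHighProb_iff.1
    (withHighProb_expansion hM hmodel hasym hboot hnull hest hbootest he0) _ hη4
  have h2 := withHighProb_iff.1 (hA e he0) _ hη4
  filter_upwards [h1, h2, hs] with n hn1 hn2 hsn
  refine measure_not_le_of_imp hn1 hn2 hB hC fun ω h1 h2 h3 h4 => ?_
  have hu : ∀ g τ, ‖matOp (QΦΦ QΨΨ ξ τ)⁻¹ (∑ j, (ξ j * sgn g j) • 𝒵 j τ ω)‖ ≤ U := fun g τ => by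
    refine (norm_matOp_apply_le _ _).trans ?_
    have := norm_inv_le_of_le_norm_matOp hc (norm_le_of_coercive (coercive_QΦΦ hbd τ))
    exact mul_le_mul this (norm_sum_smul_le (fun j => h3 j τ) g) (norm_nonneg _) (by positivity)
  have hone : ∀ τ, ∑ j, ξ j • 𝒵 j τ ω = ∑ j, (ξ j * sgn (1 : Signs J) j) • 𝒵 j τ ω := fun τ => by
    simp [sgn]
  have key : ∀ (g : Signs J) (v : Υ → Vec dφ),
      (∀ τ, ‖M.r n • v τ - matOp (QΦΦ QΨΨ ξ τ)⁻¹ (∑ j, (ξ j * sgn g j) • 𝒵 j τ ω)‖ ≤ e) →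
      ENNReal.ofReal (M.r n / √(s n)) * supNorm (Ahat n ω) v ≤ limitAR QΨΨ ξ 𝒵 A ω g + ε ∧
      limitAR QΨΨ ξ 𝒵 A ω g ≤ ENNReal.ofReal (M.r n / √(s n)) * supNorm (Ahat n ω) v + ε := by
    intro g v hv
    rw [ofReal_mul_supNorm _ _ hsn (hM.r_pos n).le]
    have hd := fun τ => (abs_inner_matOp_sub_le (h2 τ) (hv τ) (min_le_left _ _) (hu g τ)
      (h4 τ)).trans ((mul_le_mul_of_nonneg_left (le_abs_self _) he0.le).trans heK)
    refine ⟨supNorm_le_supNorm_add hd, supNorm_le_supNorm_add fun τ => ?_⟩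
    rw [abs_sub_comm]
    exact hd τ
  exact ⟨fun g => key g _ fun τ => (h1 τ).2.2 g, key 1 _ fun τ => by
    rw [← hone]; exact (h1 τ).2.1⟩

/-! ### The cluster-robust weight -/

/-- Symmetry is given for the estimates only. At every tolerance some realization of the symmetric
`Ĥ` is that close to `H`, since the exceptional event has probability at most one half. -/
lemma ClusterRobustWeight.limit_isSymm [IsProbabilityMeasure μ]
    {Hhat : ℕ → Ω → Υ → Matrix (Fin dφ) (Fin dφ) ℝ} {H : Υ → Matrix (Fin dφ) (Fin dφ) ℝ}
    (hH : ClusterRobustWeight (J := J) μ Hhat H) (τ : Υ) : (H τ).IsSymm := by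
  refine isSymm_of_inner_matOp_comm fun x y => ?_
  by_contra hne
  have hd : 0 < |inner ℝ x (matOp (H τ) y) - inner ℝ y (matOp (H τ) x)| :=
    abs_pos.2 (sub_ne_zero.2 hne)
  set d := |inner ℝ x (matOp (H τ) y) - inner ℝ y (matOp (H τ) x)| with hdd
  set e := d / (4 * (‖x‖ * ‖y‖ + 1)) with he
  have he0 : 0 < e := by positivity
  have h1 := withHighProb_iff.1 (hH.consistent.withHighProb he0) (1 / 2) (by simp)
  obtain ⟨n, hn⟩ := h1.exists
  obtain ⟨ω, hω⟩ : ∃ ω, ∀ τ, ‖Hhat n ω τ - H τ‖ ≤ e := by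
    by_contra hcon
    simp only [not_exists] at hcon
    have : {ω | ¬ ∀ τ, ‖Hhat n ω τ - H τ‖ ≤ e} = univ := eq_univ_of_forall hcon
    rw [this, measure_univ] at hn
    exact absurd hn (by simp)
  have h2 : ∀ a b : Vec dφ, |inner ℝ a (matOp (Hhat n ω τ - H τ) b)| ≤ ‖a‖ * (e * ‖b‖) :=
    fun a b => (abs_real_inner_le_norm _ _).trans (by
      gcongr
      exact (norm_matOp_apply_le _ _).trans (by gcongr; exact hω τ))
  have h3 : inner ℝ x (matOp (H τ) y) - inner ℝ y (matOp (H τ) x)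
      = inner ℝ y (matOp (Hhat n ω τ - H τ) x) - inner ℝ x (matOp (Hhat n ω τ - H τ) y) := by
    have := inner_matOp_comm (hH.symm n ω τ) x y
    rw [matOp_sub, matOp_sub, inner_sub_right, inner_sub_right]
    linarith
  have h4 : d ≤ 2 * (e * (‖x‖ * ‖y‖)) := by
    rw [hdd, h3]
    refine (abs_sub _ _).trans ?_
    have := h2 x y
    have := h2 y x
    linarith
  have h5 : e * (4 * (‖x‖ * ‖y‖ + 1)) = d := by rw [he]; field_simp
  nlinarith

lemma ClusterRobustWeight.bounds
    {Hhat : ℕ → Ω → Υ → Matrix (Fin dφ) (Fin dφ) ℝ} {H : Υ → Matrix (Fin dφ) (Fin dφ) ℝ}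
    (hH : ClusterRobustWeight (J := J) μ Hhat H) : ∃ c C : ℝ, 0 < c ∧ 0 ≤ C ∧
      ∀ τ, ‖H τ‖ ≤ C ∧ ∀ x, c * ‖x‖ ^ 2 ≤ ‖matOp (H τ) x‖ ^ 2 := by
  obtain ⟨c, C, hc, h⟩ := hH.eigenvalues
  refine ⟨c, √C, hc, Real.sqrt_nonneg _, fun τ => ?_⟩
  have h1 := fun x => rayleighBounds_iff.1 (h τ) x
  simp_rw [inner_matOp_transpose_mul] at h1
  refine ⟨?_, fun x => (h1 x).1⟩
  rw [← norm_matOp]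
  refine ContinuousLinearMap.opNorm_le_bound _ (Real.sqrt_nonneg _) fun x => ?_
  rw [← Real.sqrt_sq (norm_nonneg (matOp (H τ) x)), ← Real.sqrt_sq (norm_nonneg x),
    ← Real.sqrt_mul' _ (sq_nonneg _)]
  exact Real.sqrt_le_sqrt (by simpa using (h1 x).2)

theorem withHighProb_weightCR [IsProbabilityMeasure μ]
    {est : ℕ → Ω → ℝ → Υ → StackVec dw dφ} {boot : ℕ → Ω → Signs J → ℝ → Υ → StackVec dw dφ}
    (hM : M.Setup μ) (hmodel : M.ModelAssumption μ 𝓑 𝓡 𝓣)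
    (hasym : M.AsymptoticAssumption μ 𝓑 𝓡 𝓣 fε QΨΨ QΨX ξ)
    (hboot : M.BootstrapAssumption μ QΨΨ 𝒵) (hnull : ∀ n τ, M.βn n τ = M.β₀ τ)
    (hest : M.IsEstimator est) (hbootest : M.IsBootEstimator est boot)
    {Hhat : ℕ → Ω → Υ → Matrix (Fin dφ) (Fin dφ) ℝ} {H : Υ → Matrix (Fin dφ) (Fin dφ) ℝ}
    (hH : ClusterRobustWeight (J := J) μ Hhat H)
    (hlow : ∀ η : ℝ≥0∞, 0 < η → ∃ c : ℝ, 0 < c ∧ μ {ω | ¬ ∀ (τ : Υ) (x : Vec dφ),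
      c * ‖x‖ ^ 2 ≤ inner ℝ x (matOp (limitCRVE ξ 𝒵 ω τ) x)} ≤ η) {e : ℝ} (he : 0 < e) :
    WithHighProb μ (fun n ω => ∀ τ : Υ,
      ‖(M.r n ^ 2 / n)⁻¹ • M.weightCR est Hhat n ω τ - limitWeightCR ξ 𝒵 H ω τ‖ ≤ e) := by
  rw [withHighProb_iff]
  intro η hη
  have hη4 : 0 < η / 4 := ENNReal.div_pos hη.ne' (by simp)
  obtain ⟨c, h, hc, hh, hHb⟩ := hH.bounds
  obtain ⟨B, hB⟩ := hboot.exists_norm_le hasym hM hη4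
  obtain ⟨c', hc', hlow⟩ := hlow _ hη4
  set k := c' * c with hk
  have hk0 : 0 < k := by positivity
  set m := ∑ j, (|ξ j| * B) ^ 2 with hm
  set m' := ∑ j, (2 * (|ξ j| * |B|) + 1) with hm'
  have hm'0 : 0 ≤ m' := Finset.sum_nonneg fun j _ => by positivity
  have hm0 : 0 ≤ m := Finset.sum_nonneg fun j _ => by positivity
  set K := (m + 1) * (h + 1) + h * (h + 1) + h * m with hK
  have hK0 : 0 ≤ K := by positivity
  -- The number `t * (m' + 1)` bounds the errors of both `Ĥ` and the scaled covariance estimate. The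
  -- remaining conditions keep the sandwich within `k / 2` of its limit and the inverse within `e`.
  obtain ⟨t, ht0, ht1, htm, htk, hte⟩ : ∃ t : ℝ, 0 < t ∧ t ≤ 1 ∧ t * (m' + 1) ≤ 1 ∧
      t * (m' + 1) * K ≤ k / 2 ∧ 2 / k ^ 2 * (t * (m' + 1) * K) ≤ e := by
    have hlim : ∀ a : ℝ, Tendsto (fun t : ℝ => t * a) (𝓝[>] 0) (𝓝 0) := fun a => by
      have : Tendsto (fun t : ℝ => t * a) (𝓝 0) (𝓝 (0 * a)) := tendsto_id.mul_const a
      rw [zero_mul] at this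
      exact this.mono_left nhdsWithin_le_nhds
    have h1 := (hlim 1).eventually (ge_mem_nhds one_pos)
    have h2 := (hlim (m' + 1)).eventually (ge_mem_nhds one_pos)
    have h3 := (hlim ((m' + 1) * K)).eventually (ge_mem_nhds (half_pos hk0))
    have h4 := (hlim (2 / k ^ 2 * ((m' + 1) * K))).eventually (ge_mem_nhds he)
    obtain ⟨t, ⟨⟨⟨h1, h2⟩, h3⟩, h4⟩, h0⟩ :=
      ((((h1.and h2).and h3).and h4).and self_mem_nhdsWithin).exists
    exact ⟨t, h0, by linarith, h2, by linarith, by linarith⟩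
  have h1 := withHighProb_iff.1
    (withHighProb_expansion hM hmodel hasym hboot hnull hest hbootest ht0) _ hη4
  have h2 := withHighProb_iff.1 (hH.consistent.withHighProb ht0) _ hη4
  filter_upwards [h1, h2, eventually_gt_atTop 0] with n hn1 hn2 hn
  refine measure_not_le_of_imp hn1 hn2 hB hlow fun ω h1 h2 h3 h4 τ => ?_
  have hr : M.r n ^ 2 / n ≠ 0 := by
    have := hM.r_pos n
    positivity
  rw [scaled_weightCR_eq M est Hhat hr, limitWeightCR]
  have hB' : ∀ j, ‖𝒵 j τ ω‖ ≤ |B| := fun j => (h3 j τ).trans (le_abs_self B)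
  have hS : ‖(M.r n ^ 2 / n) • M.nullCRVE est n ω τ - limitCRVE ξ 𝒵 ω τ‖ ≤ t * (m' + 1) :=
    (norm_scaled_nullCRVE_sub_le hn ht1 hB' (h1 τ).1).trans (by gcongr; linarith)
  have hH' : ‖Hhat n ω τ - H τ‖ ≤ t * (m' + 1) := (h2 τ).trans (by nlinarith)
  have hconj := norm_conj_sub_conj_le htm hH' hS (hHb τ).1
    (norm_limitCRVE_le (ξ := ξ) (𝒵 := 𝒵) fun j => h3 j τ)
  exact (norm_inv_sub_inv_le hk0 (norm_le_of_coercive (coercive_conj (hH.limit_isSymm τ) hc'.le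
    (h4 τ) (hHb τ).2)) hconj htk).trans hte

end IVQR

/-! ### The limit statistic as a measurable function of a sign-symmetric process -/

section LimitLaw

lemma le_biSup_of_mem_closure {X : Type*} [TopologicalSpace X] {f : X → ℝ≥0∞} {p : X}
    (hf : ContinuousAt f p) {ι : Type*} {D : Set ι} {q : ι → X} (hp : p ∈ closure (q '' D)) :
    f p ≤ ⨆ i ∈ D, f (q i) := by
  by_contra! hlt
  have h1 := hf.eventually (lt_mem_nhds hlt)
  obtain ⟨x, hx, hxS⟩ := mem_closure_iff_nhds.1 hp _ h1
  obtain ⟨i, hi, rfl⟩ := hxS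
  exact absurd (le_biSup (fun i => f (q i)) hi) (not_le.2 hx)

variable {Ω : Type*} [MeasurableSpace Ω] {μ : Measure Ω} [IsProbabilityMeasure μ] {ι X : Type*}
  {d J : ℕ} [TopologicalSpace X] [SecondCountableTopology X]

/-- The joint law of the sign-randomized suprema of a functional of independent tight centered
Gaussian processes is invariant under translations of the group of signs. -/
theorem exists_measurable_invariant {Z : Fin J → ι → Ω → Vec d}
    (htight : ∀ j, IsTightProcess μ (Z j)) (hgauss : ∀ j, IsGaussianProcess (Z j) μ)
    (hm : ∀ j i, Measurable (Z j i)) (h0 : ∀ j i, ∫ ω, Z j i ω ∂μ = 0)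
    (hind : iIndepFun (fun j ω i => Z j i ω) μ) (e : ι → X)
    {f : (Fin J → Vec d) × X → ℝ≥0∞} (hf : ∀ x, Measurable fun z => f (z, x))
    (hcont : ∀ᵐ ω ∂μ, ∀ i (g : Signs J), ContinuousAt f (fun j => sgn g j • Z j i ω, e i))
    {T : Ω → Signs J → ℝ≥0∞} (hT : ∀ ω g, T ω g = ⨆ i, f (fun j => sgn g j • Z j i ω, e i)) :
    ∃ T' : Ω → Signs J → ℝ≥0∞, Measurable T' ∧ (∀ᵐ ω ∂μ, T ω = T' ω) ∧
      ∀ h : Signs J, μ.map (fun ω g => T' ω (h * g)) = μ.map T' := by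
  obtain ⟨D, hD, hclos⟩ := exists_countable_closure htight e
  set Λ : (Fin J → ι → Vec d) → Signs J → ℝ≥0∞ := fun z g =>
    ⨆ i ∈ D, f (fun j => sgn g j • z j i, e i) with hΛ
  have hΛm : Measurable Λ := measurable_pi_lambda _ fun g => by
    refine Measurable.biSup D hD fun i _ => (hf (e i)).comp ?_
    refine measurable_pi_lambda _ fun j => ?_
    exact (measurable_const_smul (sgn g j)).comp
      ((measurable_pi_apply i).comp (measurable_pi_apply j))
  have hZm : Measurable fun ω j i => Z j i ω :=
    measurable_pi_lambda _ fun j => measurable_pi_lambda _ fun i => hm j i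
  have hZm' : ∀ h : Signs J, Measurable fun ω j i => sgn h j • Z j i ω := fun h =>
    measurable_pi_lambda _ fun j => measurable_pi_lambda _ fun i => (hm j i).const_smul (sgn h j)
  refine ⟨fun ω => Λ fun j i => Z j i ω, hΛm.comp hZm, ?_, fun h => ?_⟩
  · filter_upwards [hclos, hcont] with ω hω hω'
    ext1 g
    rw [hT]
    refine le_antisymm (iSup_le fun i => ?_) (iSup₂_le fun i _ => le_iSup (fun i =>
      f (fun j => sgn g j • Z j i ω, e i)) i)
    refine le_biSup_of_mem_closure (q := fun i => (fun j => sgn g j • Z j i ω, e i)) (hω' i g) ?_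
    have hc : Continuous fun p : (Fin J → Vec d) × X =>
        ((fun j => sgn g j • p.1 j, p.2) : (Fin J → Vec d) × X) := by fun_prop
    have := image_closure_subset_closure_image hc (mem_image_of_mem _ (hω i))
    rwa [image_image] at this
  -- Translating the sign vector by `h` amounts to flipping the processes by `h`, which preserves
  -- their joint law.
  · have h1 : (fun ω g => Λ (fun j i => Z j i ω) (h * g))
        = Λ ∘ fun ω j i => sgn h j • Z j i ω := by
      ext ω g
      simp only [hΛ, Function.comp_apply, smul_smul]
      refine iSup_congr fun i => iSup_congr fun _ => ?_
      congr 3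
      ext1 j
      simp [sgn, mul_comm]
    have h2 : (fun ω => Λ fun j i => Z j i ω) = Λ ∘ fun ω j i => Z j i ω := rfl
    rw [h1, h2, ← Measure.map_map hΛm (hZm' h), ← Measure.map_map hΛm hZm,
      map_sgn_smul_eq hgauss hm h0 hind h]

end LimitLaw

/-! ### Uniform lower bounds in probability -/

section LowerBound

variable {Ω : Type*} [MeasurableSpace Ω] {μ : Measure Ω} [IsProbabilityMeasure μ] {ι : Type*}
  {d J : ℕ}

lemma isClosed_setOf_coercive (ξ : Fin J → ℝ) (c : ℝ) :
    IsClosed {z : Fin J → Vec d | ∀ x : Vec d, c * ‖x‖ ^ 2 ≤ ∑ j, (ξ j * inner ℝ (z j) x) ^ 2} := by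
  rw [ofPred_forall]
  refine isClosed_iInter fun x => isClosed_le (by fun_prop) (by fun_prop)

/-- A random positive constant that works almost surely exceeds some `1 / (m + 1)` with probability
close to one, by continuity of the measure. The events involved are measurable because the closed
condition need only be checked on a countable set of indices. -/
lemma exists_lower_bound_of_ae {Z : Fin J → ι → Ω → Vec d}
    (htight : ∀ j, IsTightProcess μ (Z j)) (hm : ∀ j i, Measurable (Z j i)) (ξ : Fin J → ℝ)
    (hae : ∀ᵐ ω ∂μ, ∃ c : ℝ, 0 < c ∧ ∀ i (x : Vec d),
      c * ‖x‖ ^ 2 ≤ ∑ j, (ξ j * inner ℝ (Z j i ω) x) ^ 2) {η : ℝ≥0∞} (hη : 0 < η) :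
    ∃ c : ℝ, 0 < c ∧ μ {ω | ¬ ∀ i (x : Vec d),
      c * ‖x‖ ^ 2 ≤ ∑ j, (ξ j * inner ℝ (Z j i ω) x) ^ 2} ≤ η := by
  obtain ⟨D, hD, hclos⟩ := exists_countable_closure htight (fun _ : ι => ())
  set C : ℕ → Set (Fin J → Vec d) := fun m =>
    {z | ∀ x : Vec d, 1 / (m + 1 : ℝ) * ‖x‖ ^ 2 ≤ ∑ j, (ξ j * inner ℝ (z j) x) ^ 2} with hC
  have hCcl : ∀ m, IsClosed (C m) := fun m => isClosed_setOf_coercive ξ _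
  have hCmono : Monotone C := fun m m' hmm z hz x => by
    refine le_trans ?_ (hz x)
    gcongr
  set G : ℕ → Set Ω := fun m => ⋂ i ∈ D, {ω | (fun j => Z j i ω) ∈ C m} with hG
  have hGm : ∀ m, MeasurableSet (G m) := fun m => MeasurableSet.biInter hD fun i _ =>
    (measurable_pi_lambda _ fun j => hm j i) (hCcl m).measurableSet
  have hGanti : Antitone fun m => (G m)ᶜ := fun m m' hmm => by
    refine compl_subset_compl.2 (iInter₂_mono fun i _ => ?_)
    intro ω hω
    exact hCmono hmm hω
  have hinter : μ (⋂ m, (G m)ᶜ) = 0 := by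
    refine measure_mono_null ?_ (ae_iff.1 hae)
    intro ω hω hex
    obtain ⟨c, hc, h⟩ := hex
    obtain ⟨m, hm⟩ := exists_nat_one_div_lt hc
    refine mem_iInter.1 hω m (mem_iInter₂.2 fun i _ => fun x => ?_)
    exact le_trans (by gcongr) (h i x)
  have hlim := tendsto_measure_iInter_atTop (μ := μ) (fun m => (hGm m).compl.nullMeasurableSet)
    hGanti ⟨0, measure_ne_top _ _⟩
  rw [hinter] at hlim
  obtain ⟨m, hm⟩ := (ENNReal.tendsto_nhds_zero.1 hlim η hη).exists
  refine ⟨1 / (m + 1 : ℝ), by positivity, le_trans (measure_mono_ae ?_) hm⟩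
  filter_upwards [hclos] with ω hω hbad hgood
  refine hbad fun i => ?_
  have h1 : ((fun j => Z j i ω, ()) : (Fin J → Vec d) × Unit) ∈ C m ×ˢ univ := by
    refine closure_minimal ?_ ((hCcl m).prod isClosed_univ) (hω i)
    rintro _ ⟨i', hi', rfl⟩
    exact ⟨mem_iInter₂.1 hgood i' hi', mem_univ _⟩
  exact h1.1

/-- The form is continuous and positive on the compact unit sphere, and homogeneity extends the
bound. -/
lemma exists_coercive_of_injective {z : Fin J → Vec d} {ξ : Fin J → ℝ}
    (h : ∀ x : Vec d, (∀ j, ξ j * inner ℝ (z j) x = 0) → x = 0) :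
    ∃ c : ℝ, 0 < c ∧ ∀ x : Vec d, c * ‖x‖ ^ 2 ≤ ∑ j, (ξ j * inner ℝ (z j) x) ^ 2 := by
  have hcont : ContinuousOn (fun x : Vec d => ∑ j, (ξ j * inner ℝ (z j) x) ^ 2)
      (Metric.sphere 0 1) := by fun_prop
  obtain ⟨c, hc, hcs⟩ := (isCompact_sphere (0 : Vec d) 1).exists_forall_le' hcont (a := 0)
    fun x hx => by
      refine lt_of_le_of_ne (Finset.sum_nonneg fun j _ => sq_nonneg _) fun h0 => ?_
      have h1 := (Finset.sum_eq_zero_iff_of_nonneg fun j _ => sq_nonneg _).1 h0.symm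
      have h2 := h x fun j => by simpa using h1 j (Finset.mem_univ j)
      rw [h2] at hx
      simp at hx
  refine ⟨c, hc, fun x => ?_⟩
  rcases eq_or_ne x 0 with rfl | hx
  · simp
  have hn : 0 < ‖x‖ := norm_pos_iff.2 hx
  have h1 := hcs (‖x‖⁻¹ • x) (by simp [norm_smul, hn.ne'])
  have h2 : ∑ j, (ξ j * inner ℝ (z j) (‖x‖⁻¹ • x)) ^ 2
      = (‖x‖⁻¹) ^ 2 * ∑ j, (ξ j * inner ℝ (z j) x) ^ 2 := by
    rw [Finset.mul_sum]
    refine Finset.sum_congr rfl fun j _ => ?_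
    rw [real_inner_smul_right]; ring
  rw [h2, inv_pow, inv_mul_eq_div, le_div_iff₀ (by positivity)] at h1
  exact h1

end LowerBound

/-! ### Generic position of independent nondegenerate Gaussian vectors -/

section Generic

open Polynomial in
lemma IsPolyFun.sub {f g : ℝ → ℝ} (hf : IsPolyFun f) (hg : IsPolyFun g) :
    IsPolyFun fun t => f t - g t := by
  obtain ⟨p, hp⟩ := hf; obtain ⟨q, hq⟩ := hg
  exact ⟨p - q, fun t => by rw [eval_sub, ← hp, ← hq]⟩

variable {d J : ℕ}

lemma isPolyFun_matApply_sum (Q : Matrix (Fin d) (Fin d) ℝ) (w : Fin J → ℝ)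
    (z₀ z : Fin J → Vec d) (a : Fin d) :
    IsPolyFun fun t => matApply Q (∑ j, w j • (z₀ + t • z) j) a := by
  have h : (fun t : ℝ => matApply Q (∑ j, w j • (z₀ + t • z) j) a)
      = fun t => ∑ b, Q a b * ∑ j, w j * (z₀ j b + t * z j b) := by
    ext t
    simp [matApply, Matrix.mulVec, dotProduct, mul_add]
  rw [h]
  exact IsPolyFun.sum fun b => (IsPolyFun.const _).mul
    (IsPolyFun.sum fun j => (IsPolyFun.const _).mul (IsPolyFun.affine _ _))

lemma isPolyFun_conj_apply (H : Matrix (Fin d) (Fin d) ℝ) (w : Fin J → ℝ)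
    (z₀ z : Fin J → Vec d) (a b : Fin d) :
    IsPolyFun fun t => (H * (∑ j, w j • outerProd ((z₀ + t • z) j)) * H) a b := by
  have h : (fun t : ℝ => (H * (∑ j, w j • outerProd ((z₀ + t • z) j)) * H) a b)
      = fun t => ∑ k, (∑ l, H a l * ∑ j, w j * ((z₀ j l + t * z j l) * (z₀ j k + t * z j k)))
        * H k b := by
    ext t
    simp [Matrix.mul_apply, Matrix.sum_apply, outerProd, Matrix.vecMulVec_apply]
  rw [h]
  exact IsPolyFun.sum fun k => (IsPolyFun.sum fun l => (IsPolyFun.const _).mul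
    (IsPolyFun.sum fun j => (IsPolyFun.const _).mul
      ((IsPolyFun.affine _ _).mul (IsPolyFun.affine _ _)))).mul (IsPolyFun.const _)

lemma IsPolyFun.quadratic {v : ℝ → Vec d} {N : ℝ → Matrix (Fin d) (Fin d) ℝ}
    (hv : ∀ a, IsPolyFun fun t => v t a) (hN : ∀ a b, IsPolyFun fun t => N t a b) :
    IsPolyFun fun t => (fun a => v t a) ⬝ᵥ (N t).mulVec (fun a => v t a) := by
  change IsPolyFun fun t => ∑ a, v t a * ∑ b, N t a b * v t b
  exact IsPolyFun.sum fun a => (hv a).mul (IsPolyFun.sum fun b => (hN a b).mul (hv b))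

lemma wnorm_inv_eq (B : Matrix (Fin d) (Fin d) ℝ) (u : Vec d) :
    wnorm B⁻¹ u = √((B.det)⁻¹ * ((fun a => u a) ⬝ᵥ B.adjugate.mulVec (fun a => u a))) := by
  rw [wnorm, Matrix.inv_def, Ring.inverse_eq_inv', Matrix.smul_mulVec, dotProduct_smul, smul_eq_mul]

variable {Ω ι : Type*} [MeasurableSpace Ω] {μ : Measure Ω}

lemma map_absolutelyContinuous_volume [IsProbabilityMeasure μ] {U : Fin J → Ω → Vec d} (hm : ∀ j, Measurable (U j))
    (hgauss : ∀ j, HasGaussianLaw (U j) μ) (h0 : ∀ j, ∫ ω, U j ω ∂μ = 0) (hind : iIndepFun U μ)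
    {c C : ℝ} (hc : 0 < c) (hcov : ∀ j, RayleighBounds c C (IVQR.secondMoment μ (U j))) :
    μ.map (fun ω j => U j ω) ≪ (volume : Measure (Fin J → Vec d)) := by
  rw [(iIndepFun_iff_map_fun_eq_pi_map fun j => (hm j).aemeasurable).1 hind]
  have : ∀ j, IsProbabilityMeasure (μ.map (U j)) := fun j =>
    Measure.isProbabilityMeasure_map (hm j).aemeasurable
  exact Measure.pi_absolutelyContinuous fun j =>
    HasGaussianLaw.absolutelyContinuous (hgauss j) (h0 j) hc (hcov j)

lemma ae_ne_zero_of_polynomial {U : Fin J → Ω → Vec d} (hm : ∀ j, Measurable (U j))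
    (hU : μ.map (fun ω j => U j ω) ≪ (volume : Measure (Fin J → Vec d)))
    {F : (Fin J → Vec d) → ℝ} (hF : Measurable F) {z₀ : Fin J → Vec d} (h0 : F z₀ ≠ 0)
    (hline : ∀ z, IsPolyFun fun t => F (z₀ + t • z)) : ∀ᵐ ω ∂μ, F (fun j => U j ω) ≠ 0 := by
  have h := hU (addHaar_zeros_eq_zero volume hF h0 hline)
  have hmeas : MeasurableSet {z | F z = 0} := hF (measurableSet_singleton 0)
  rw [Measure.map_apply (measurable_pi_lambda _ hm) hmeas] at h
  rw [ae_iff]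
  simpa using h

/-! #### Witnesses -/

lemma exists_ne_and_exists_eq {g g' : Signs J} (h : g' ≠ g) (h' : g' ≠ -g) :
    ∃ j₁ j₂, g' j₁ = -g j₁ ∧ g' j₂ = g j₂ := by
  obtain ⟨j₁, h₁⟩ := Function.ne_iff.1 h
  obtain ⟨j₂, h₂⟩ := Function.ne_iff.1 h'
  refine ⟨j₁, j₂, ?_, ?_⟩
  · rcases Int.units_eq_one_or (g j₁) with h1 | h1 <;> rcases Int.units_eq_one_or (g' j₁) with h2 | h2 <;>
      simp_all
  · rcases Int.units_eq_one_or (g j₂) with h1 | h1 <;> rcases Int.units_eq_one_or (g' j₂) with h2 | h2 <;>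
      simp_all

lemma sgn_mul_self (g : Signs J) (j : Fin J) : sgn g j * sgn g j = 1 := by
  rcases Int.units_eq_one_or (g j) with h | h <;> simp [sgn, h]

/-- Vectors whose two partial sums over the parts of a partition agree with a given nonzero vector
and which span the space. -/
lemma exists_spanning_of_partition (hd : 0 < d) (hdJ : d < J) {D : Finset (Fin J)} {j₁ j₂ : Fin J}
    (h₁ : j₁ ∈ D) (h₂ : j₂ ∉ D) : ∃ (a : Fin J → Vec d) (u : Vec d), u ≠ 0 ∧
      ∑ j ∈ D, a j = u ∧ ∑ j ∈ Dᶜ, a j = u ∧ ∀ x, (∀ j, inner ℝ (a j) x = 0) → x = 0 := by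
  classical
  set k₀ : Fin d := ⟨0, hd⟩
  -- The `d - 1` basis vectors other than the one at `k₀` are placed at indices different from `j₁`
  -- and `j₂`, which is possible because `d < J`. The vectors at `j₁` and `j₂` are kept free to
  -- correct the two partial sums.
  obtain ⟨σ⟩ : Nonempty ({k : Fin d // k ≠ k₀} ↪ {j : Fin J // j ≠ j₁ ∧ j ≠ j₂}) := by
    refine Function.Embedding.nonempty_of_card_le ?_
    have hne : j₁ ≠ j₂ := fun h => h₂ (h ▸ h₁)
    have h1 : Fintype.card {k : Fin d // k ≠ k₀} = d - 1 := by simp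
    have h2 : Fintype.card {j : Fin J // j ≠ j₁ ∧ j ≠ j₂} = J - 2 := by
      rw [Fintype.card_subtype]
      have : (Finset.univ.filter fun j : Fin J => j ≠ j₁ ∧ j ≠ j₂) = ({j₁, j₂} : Finset _)ᶜ := by
        ext j; simp
      rw [this, Finset.card_compl, Finset.card_pair hne, Fintype.card_fin]
    omega
  set u : Vec d := EuclideanSpace.single k₀ 1 with hu
  set b : Fin J → Vec d := fun j => ∑ k, if (σ k : Fin J) = j then EuclideanSpace.single k.1 1 else 0
    with hb
  set a : Fin J → Vec d := fun j => b j + (if j = j₁ then u - ∑ j ∈ D, b j else 0)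
    + (if j = j₂ then u - ∑ j ∈ Dᶜ, b j else 0) with ha
  have hb0 : ∀ x : Vec d, (∀ k : {k : Fin d // k ≠ k₀}, x k.1 = 0) → ∀ j, inner ℝ (b j) x = 0 := by
    intro x hx j
    rw [hb, sum_inner]
    refine Finset.sum_eq_zero fun k _ => ?_
    split_ifs
    · simp [EuclideanSpace.inner_single_left, hx k]
    · exact inner_zero_left _
  have hne : j₁ ≠ j₂ := fun h => h₂ (h ▸ h₁)
  have hb₁ : b j₁ = 0 := Finset.sum_eq_zero fun k _ => if_neg (σ k).2.1
  refine ⟨a, u, ?_, ?_, ?_, fun x hx => ?_⟩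
  · intro h
    have := congrArg (fun v : Vec d => v k₀) h
    simp [hu] at this
  · simp only [ha, Finset.sum_add_distrib, Finset.sum_ite_eq', h₁, h₂, if_true, if_false]
    abel
  · simp only [ha, Finset.sum_add_distrib, Finset.sum_ite_eq', Finset.mem_compl, h₁, h₂, if_true,
      not_true_eq_false, not_false_eq_true, if_false]
    abel
  · have hxk : ∀ k : {k : Fin d // k ≠ k₀}, x k.1 = 0 := fun k => by
      have h := hx (σ k)
      have hak : a (σ k) = EuclideanSpace.single k.1 1 := by
        simp only [ha, hb, (σ k).2.1, (σ k).2.2, if_false, add_zero]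
        rw [Finset.sum_eq_single k]
        · simp
        · intro k' _ hk'
          exact if_neg fun h => hk' (σ.injective (Subtype.ext h))
        · simp
      rw [hak, EuclideanSpace.inner_single_left] at h
      simpa using h
    -- All coordinates of `x` other than `k₀` vanish, so `x` is orthogonal to every `b j`, and
    -- pairing with `a j₁` reads off the remaining coordinate.
    have hx₁ := hx j₁
    have ha₁ : a j₁ = u - ∑ j ∈ D, b j := by simp [ha, hb₁, hne]
    rw [ha₁, inner_sub_left, sum_inner, Finset.sum_eq_zero fun j _ => hb0 x hxk j, sub_zero, hu,
      EuclideanSpace.inner_single_left] at hx₁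
    ext k
    by_cases hk : k = k₀
    · subst hk; simpa using hx₁
    · exact hxk ⟨k, hk⟩

end Generic

/-! ### Sums of outer products and witnesses against ties -/

section OuterProducts

variable {d J : ℕ}

lemma matOp_sum_outerProd (w : Fin J → ℝ) (z : Fin J → Vec d) (x : Vec d) :
    matOp (∑ j, w j • outerProd (z j)) x = ∑ j, (w j * inner ℝ (z j) x) • z j := by
  rw [matOp, map_sum, sum_apply]
  refine Finset.sum_congr rfl fun j _ => ?_
  rw [mul_smul, ← matOp_outerProd, ← smul_apply]
  exact congrArg (fun F : Vec d →L[ℝ] Vec d => F x) (matOp_smul _ _)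

lemma inner_sum_outerProd (ξ : Fin J → ℝ) (z : Fin J → Vec d) (x : Vec d) :
    inner ℝ x (matOp (∑ j, ξ j ^ 2 • outerProd (z j)) x) = ∑ j, (ξ j * inner ℝ (z j) x) ^ 2 := by
  rw [matOp_sum_outerProd, inner_sum]
  refine Finset.sum_congr rfl fun j _ => ?_
  rw [real_inner_smul_right, real_inner_comm x]
  ring

lemma exists_coercive_of_det_ne_zero {ξ : Fin J → ℝ} {z : Fin J → Vec d}
    (h : (∑ j, ξ j ^ 2 • outerProd (z j)).det ≠ 0) :
    ∃ c : ℝ, 0 < c ∧ ∀ x : Vec d, c * ‖x‖ ^ 2 ≤ ∑ j, (ξ j * inner ℝ (z j) x) ^ 2 := by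
  refine exists_coercive_of_injective fun x hx => ?_
  set S := ∑ j, ξ j ^ 2 • outerProd (z j) with hS
  have h1 : matOp S x = 0 := by
    rw [hS, matOp_sum_outerProd]
    refine Finset.sum_eq_zero fun j _ => ?_
    rw [sq, mul_assoc, hx j, mul_zero, zero_smul]
  rw [← matOp_one x, ← Matrix.nonsing_inv_mul S (isUnit_iff_ne_zero.2 h), matOp_mul, h1, map_zero]

/-- With `w = B⁻¹ v` the form equals `⟨B w, w⟩`, which is positive by coercivity. It is written with
the adjugate because that expression is polynomial up to the determinant. -/
lemma inner_inv_pos {B : Matrix (Fin d) (Fin d) ℝ} {c : ℝ} (hc : 0 < c)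
    (h : ∀ x : Vec d, c * ‖x‖ ^ 2 ≤ inner ℝ x (matOp B x)) {v : Vec d} (hv : v ≠ 0) :
    0 < (B.det)⁻¹ * ((fun a => v a) ⬝ᵥ B.adjugate.mulVec (fun a => v a)) := by
  have hu := isUnit_det_of_le_norm_matOp hc (norm_le_of_coercive h)
  have h1 : (B.det)⁻¹ * ((fun a => v a) ⬝ᵥ B.adjugate.mulVec (fun a => v a))
      = inner ℝ v (matOp B⁻¹ v) := by
    rw [Matrix.inner_toEuclideanCLM, Matrix.inv_def, Ring.inverse_eq_inv', Matrix.smul_mulVec,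
      dotProduct_smul, smul_eq_mul]
  have hv' : matOp B (matOp B⁻¹ v) = v := by
    rw [← matOp_mul, Matrix.mul_nonsing_inv _ hu, matOp_one]
  have hw : matOp B⁻¹ v ≠ 0 := fun h0 => hv (by rw [← hv', h0, map_zero])
  rw [h1]
  have h2 := h (matOp B⁻¹ v)
  rw [hv', real_inner_comm] at h2
  have := norm_pos_iff.2 hw
  exact lt_of_lt_of_le (by positivity) h2

lemma outerProd_sgn_smul (g : Signs J) (j : Fin J) (x : Vec d) :
    outerProd (sgn g j • x) = outerProd x := by
  rw [outerProd_smul, sq, sgn_mul_self, one_smul]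

lemma sgn_eq_neg_of_ne {g g' : Signs J} {j : Fin J} (h : g' j ≠ g j) : sgn g' j = -sgn g j := by
  rw [sgn, sgn]
  rcases Int.units_eq_one_or (g j) with h1 | h1 <;>
    rcases Int.units_eq_one_or (g' j) with h2 | h2 <;> rw [h1, h2] at h ⊢ <;>
    first
    | exact absurd rfl h
    | norm_num

/-- Since `g'` is neither `g` nor `-g`, the set `D` of disagreement and its complement are both
nonempty. Vectors `a j` with sum `u` over each part give, after multiplication by `g_j / ξ_j`, the
signed sums `u + u` for `g` and `-u + u` for `g'`, while they still span the space. -/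
lemma exists_spanning_signed_sum (hd : 0 < d) (hdJ : d < J) {ξ : Fin J → ℝ} (hξ : ∀ j, 0 < ξ j)
    {g g' : Signs J} (hg : g' ≠ g) (hg' : g' ≠ -g) : ∃ (z : Fin J → Vec d) (u : Vec d), u ≠ 0 ∧
      ∑ j, (ξ j * sgn g j) • z j = u ∧ ∑ j, (ξ j * sgn g' j) • z j = 0 ∧
      ∀ x, (∀ j, ξ j * inner ℝ (z j) x = 0) → x = 0 := by
  obtain ⟨j₁, j₂, h₁, h₂⟩ := exists_ne_and_exists_eq hg hg'
  set D : Finset (Fin J) := Finset.univ.filter fun j => g' j ≠ g j with hD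
  have hj₁ : j₁ ∈ D := by
    rw [hD, Finset.mem_filter, h₁]
    exact ⟨Finset.mem_univ _, by
      rcases Int.units_eq_one_or (g j₁) with h | h <;> rw [h] <;> decide⟩
  have hj₂ : j₂ ∉ D := fun h => (Finset.mem_filter.1 h).2 h₂
  obtain ⟨a, u, hu, hau, hau', hspan⟩ := exists_spanning_of_partition hd hdJ hj₁ hj₂
  have hsum : ∀ f : Signs J, ∑ j, (ξ j * sgn f j) • (sgn g j / ξ j) • a j
      = ∑ j, (sgn f j * sgn g j) • a j :=
    fun f => Finset.sum_congr rfl fun j _ => by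
      rw [smul_smul]
      have := (hξ j).ne'
      congr 1
      field_simp
  refine ⟨fun j => (sgn g j / ξ j) • a j, (2 : ℝ) • u, smul_ne_zero two_ne_zero hu, ?_, ?_,
    fun x hx => hspan x fun j => ?_⟩
  · rw [hsum]
    simp_rw [sgn_mul_self, one_smul]
    rw [← Finset.sum_add_sum_compl D, hau, hau', two_smul]
  · rw [hsum, ← Finset.sum_add_sum_compl D]
    have e1 : ∑ j ∈ D, (sgn g' j * sgn g j) • a j = -u := by
      rw [← hau, ← Finset.sum_neg_distrib]
      refine Finset.sum_congr rfl fun j hj => ?_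
      rw [sgn_eq_neg_of_ne (Finset.mem_filter.1 hj).2, neg_mul, sgn_mul_self, neg_one_smul]
    have e2 : ∑ j ∈ Dᶜ, (sgn g' j * sgn g j) • a j = u := by
      rw [← hau']
      refine Finset.sum_congr rfl fun j hj => ?_
      have hj' : g' j = g j := by
        by_contra h
        exact Finset.mem_compl.1 hj (Finset.mem_filter.2 ⟨Finset.mem_univ _, h⟩)
      have : sgn g' j = sgn g j := by rw [sgn, hj', sgn]
      rw [this, sgn_mul_self, one_smul]
    rw [e1, e2, neg_add_cancel]
  · have h6 := hx j
    rw [real_inner_smul_left, ← mul_assoc, mul_div_cancel₀ _ (hξ j).ne'] at h6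
    refine (mul_eq_zero.1 h6).resolve_left fun h0 => ?_
    have := sgn_mul_self g j
    rw [h0, zero_mul] at this
    exact zero_ne_one this

end OuterProducts

/-! ### Ties of the limit statistic at a single quantile -/

section Ties

variable {Ω : Type*} {J dw dφ : ℕ} {Υ : Set ℝ}
  {QΨΨ : Fin J → Υ → Matrix (Fin dw ⊕ Fin dφ) (Fin dw ⊕ Fin dφ) ℝ}
  {ξ : Fin J → ℝ} {𝒵 : Fin J → Υ → Ω → Vec dφ}

lemma limitAR_of_subsingleton {τ₀ : Υ} (hτ : ∀ τ, τ = τ₀) (A : Ω → Υ → Matrix (Fin dφ) (Fin dφ) ℝ)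
    (ω : Ω) (g : Signs J) : limitAR QΨΨ ξ 𝒵 A ω g = ENNReal.ofReal
      (wnorm (A ω τ₀) (matApply (QΦΦ QΨΨ ξ τ₀)⁻¹ (∑ j, (ξ j * sgn g j) • 𝒵 j τ₀ ω))) := by
  refine le_antisymm (iSup_le fun τ => ?_) (le_iSup (fun τ => ENNReal.ofReal (wnorm (A ω τ)
    (matApply (QΦΦ QΨΨ ξ τ)⁻¹ (∑ j, (ξ j * sgn g j) • 𝒵 j τ ω)))) τ₀)
  rw [hτ τ]

variable [MeasurableSpace Ω] {μ : Measure Ω}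

/-- A tie of the limit statistic is turned by `hcmp` into equality of the functions `q g` and `q
g'`, polynomial along lines. Their difference is nonzero at a witness, hence Lebesgue almost
everywhere, hence almost surely. -/
lemma noTies_of_polynomial {τ₀ : Υ} (hm : ∀ j, Measurable (𝒵 j τ₀))
    (hlaw : μ.map (fun ω j => 𝒵 j τ₀ ω) ≪ (volume : Measure (Fin J → Vec dφ)))
    {A : Ω → Υ → Matrix (Fin dφ) (Fin dφ) ℝ} {Q : Matrix (Fin dφ) (Fin dφ) ℝ}
    {N : (Fin J → Vec dφ) → Matrix (Fin dφ) (Fin dφ) ℝ} (hN : Continuous N)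
    (hline : ∀ z₀ z a b, IsPolyFun fun t => N (z₀ + t • z) a b)
    {q : Signs J → (Fin J → Vec dφ) → ℝ}
    (hq : ∀ g z, q g z = (fun a => matApply Q (∑ j, (ξ j * sgn g j) • z j) a) ⬝ᵥ
      (N z).mulVec (fun a => matApply Q (∑ j, (ξ j * sgn g j) • z j) a))
    (hcmp : ∀ᵐ ω ∂μ, ∀ g g', limitAR QΨΨ ξ 𝒵 A ω g = limitAR QΨΨ ξ 𝒵 A ω g' →
      q g (fun j => 𝒵 j τ₀ ω) = q g' (fun j => 𝒵 j τ₀ ω))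
    (hwit : ∀ g g' : Signs J, g' ≠ g → g' ≠ -g → ∃ z, q g z ≠ q g' z) :
    NoTies μ (limitAR QΨΨ ξ 𝒵 A) := by
  intro g g' hg hg'
  obtain ⟨z₀, hz₀⟩ := hwit g g' hg hg'
  have hqc : ∀ g, Continuous (q g) := fun g => by
    have : q g = fun z => (fun a => matApply Q (∑ j, (ξ j * sgn g j) • z j) a) ⬝ᵥ
      (N z).mulVec (fun a => matApply Q (∑ j, (ξ j * sgn g j) • z j) a) := funext (hq g)
    rw [this]
    have hv : Continuous fun z : Fin J → Vec dφ =>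
        (fun a => matApply Q (∑ j, (ξ j * sgn g j) • z j) a) := by
      simp only [matApply]
      fun_prop
    exact Continuous.dotProduct hv (hN.matrix_mulVec hv)
  have hqp : ∀ g z, IsPolyFun fun t => q g (z₀ + t • z) := fun g z => by
    simp_rw [hq]
    exact IsPolyFun.quadratic (isPolyFun_matApply_sum Q _ z₀ z) (hline z₀ z)
  have h := ae_ne_zero_of_polynomial hm hlaw (F := fun z => q g z - q g' z)
    ((hqc g).sub (hqc g')).measurable (sub_ne_zero.2 hz₀) fun z => (hqp g z).sub (hqp g' z)
  filter_upwards [h, hcmp] with ω hω hω' heq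
  exact hω (sub_eq_zero.2 (hω' g g' heq))

lemma eq_of_ofReal_sqrt_eq {a b : ℝ} (ha : 0 ≤ a) (hb : 0 ≤ b)
    (h : ENNReal.ofReal √a = ENNReal.ofReal √b) : a = b := by
  rw [ENNReal.ofReal_eq_ofReal_iff (Real.sqrt_nonneg _) (Real.sqrt_nonneg _)] at h
  rwa [Real.sqrt_inj ha hb] at h

lemma noTies_deterministicWeight (hd : 0 < dφ) {τ₀ : Υ} (hτ : ∀ τ, τ = τ₀)
    (hm : ∀ j, Measurable (𝒵 j τ₀))
    (hlaw : μ.map (fun ω j => 𝒵 j τ₀ ω) ≪ (volume : Measure (Fin J → Vec dφ)))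
    (hξ : ∀ j, 0 < ξ j) (hQ : IsUnit (QΦΦ QΨΨ ξ τ₀).det) {A : Υ → Matrix (Fin dφ) (Fin dφ) ℝ}
    {c : ℝ} (hc : 0 < c) (hA : ∀ x : Vec dφ, c * ‖x‖ ^ 2 ≤ inner ℝ x (matOp (A τ₀) x)) :
    NoTies μ (limitAR QΨΨ ξ 𝒵 (fun _ => A)) := by
  have hq : ∀ v : Vec dφ, (fun a => v a) ⬝ᵥ (A τ₀).mulVec (fun a => v a)
      = inner ℝ v (matOp (A τ₀) v) := fun v => (Matrix.inner_toEuclideanCLM _ _ _).symm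
  refine noTies_of_polynomial hm hlaw (Q := (QΦΦ QΨΨ ξ τ₀)⁻¹) (N := fun _ => A τ₀)
    continuous_const (fun _ _ _ _ => IsPolyFun.const _) (fun g z => rfl) ?_ ?_
  · refine Eventually.of_forall fun ω g g' h => ?_
    rw [limitAR_of_subsingleton hτ, limitAR_of_subsingleton hτ] at h
    refine eq_of_ofReal_sqrt_eq ?_ ?_ h <;> rw [hq] <;> exact le_trans (by positivity) (hA _)
  · intro g g' hg hg'
    obtain ⟨j₁, j₂, h₁, h₂⟩ := exists_ne_and_exists_eq hg hg'
    have hne : j₁ ≠ j₂ := by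
      rintro rfl
      rw [h₁] at h₂
      exact absurd h₂ (by rcases Int.units_eq_one_or (g j₁) with h | h <;> rw [h] <;> decide)
    set u : Vec dφ := EuclideanSpace.single ⟨0, hd⟩ 1 with hu
    have hu0 : u ≠ 0 := by
      intro h
      have := congrArg (fun v : Vec dφ => v ⟨0, hd⟩) h
      simp [hu] at this
    -- Only two clusters are active, one where the signs disagree and one where they agree. The
    -- signed sum is `2 • u` for `g` and zero for `g'`.
    set z : Fin J → Vec dφ := fun j => (if j = j₁ then (sgn g j₁ / ξ j₁) • u else 0)
      + (if j = j₂ then (sgn g j₂ / ξ j₂) • u else 0) with hz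
    have hsum : ∀ f : Signs J, ∑ j, (ξ j * sgn f j) • z j
        = (sgn f j₁ * sgn g j₁ + sgn f j₂ * sgn g j₂) • u := fun f => by
      simp only [hz, smul_add, smul_ite, smul_zero, Finset.sum_add_distrib, Finset.sum_ite_eq',
        Finset.mem_univ, if_true, smul_smul, ← add_smul]
      congr 1
      have := (hξ j₁).ne'
      have := (hξ j₂).ne'
      field_simp
    refine ⟨z, ?_⟩
    rw [hsum, hsum]
    have h3 : sgn g' j₁ = - sgn g j₁ := by simp [sgn, h₁]
    have h4 : sgn g' j₂ = sgn g j₂ := by simp [sgn, h₂]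
    rw [h3, h4, neg_mul, sgn_mul_self, sgn_mul_self, neg_add_cancel, zero_smul, matApply_eq,
      matApply_eq, hq, hq, map_zero, map_zero, inner_zero_left]
    have hv : matOp (QΦΦ QΨΨ ξ τ₀)⁻¹ ((1 + 1 : ℝ) • u) ≠ 0 := fun h0 => by
      have h5 : matOp (QΦΦ QΨΨ ξ τ₀) (matOp (QΦΦ QΨΨ ξ τ₀)⁻¹ ((1 + 1 : ℝ) • u)) = (1 + 1 : ℝ) • u := by
        rw [← matOp_mul, Matrix.mul_nonsing_inv _ hQ, matOp_one]
      rw [h0, map_zero] at h5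
      exact smul_ne_zero (by norm_num) hu0 h5.symm
    have := norm_pos_iff.2 hv
    exact (lt_of_lt_of_le (by positivity) (hA _)).ne'

/-- The inverse weight is not polynomial, but its denominator `(B z).det` is even in each `z j` and
common to all sign vectors. Cancelling it reduces a tie to an equality of adjugate forms. The
witness must keep `B` invertible, hence the spanning requirement and `dφ < J`. -/
lemma noTies_clusterRobust (hd : 0 < dφ) (hdJ : dφ < J) {τ₀ : Υ} (hτ : ∀ τ, τ = τ₀)
    (hm : ∀ j, Measurable (𝒵 j τ₀))
    (hlaw : μ.map (fun ω j => 𝒵 j τ₀ ω) ≪ (volume : Measure (Fin J → Vec dφ)))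
    (hξ : ∀ j, 0 < ξ j) (hQ : IsUnit (QΦΦ QΨΨ ξ τ₀).det) {H : Υ → Matrix (Fin dφ) (Fin dφ) ℝ}
    (hsymm : (H τ₀).IsSymm) {c : ℝ} (hc : 0 < c) (hH : ∀ x, c * ‖x‖ ^ 2 ≤ ‖matOp (H τ₀) x‖ ^ 2)
    (hlow : ∀ᵐ ω ∂μ, ∃ c : ℝ, 0 < c ∧ ∀ x : Vec dφ,
      c * ‖x‖ ^ 2 ≤ ∑ j, (ξ j * inner ℝ (𝒵 j τ₀ ω) x) ^ 2) :
    NoTies μ (limitAR QΨΨ ξ 𝒵 (limitWeightCR ξ 𝒵 H)) := by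
  set B : (Fin J → Vec dφ) → Matrix (Fin dφ) (Fin dφ) ℝ := fun z =>
    H τ₀ * (∑ j, ξ j ^ 2 • outerProd (z j)) * H τ₀ with hB
  have hBc : Continuous B := by
    have : ∀ j, Continuous fun z : Fin J → Vec dφ => outerProd (z j) := fun j => by
      refine continuous_matrix fun a b => ?_
      simp only [outerProd, Matrix.vecMulVec_apply]
      fun_prop
    fun_prop
  have hcoer : ∀ z : Fin J → Vec dφ, (∃ c : ℝ, 0 < c ∧ ∀ x : Vec dφ,
      c * ‖x‖ ^ 2 ≤ ∑ j, (ξ j * inner ℝ (z j) x) ^ 2) →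
      ∃ c : ℝ, 0 < c ∧ ∀ x : Vec dφ, c * ‖x‖ ^ 2 ≤ inner ℝ x (matOp (B z) x) := by
    rintro z ⟨c', hc', h⟩
    refine ⟨c' * c, by positivity, coercive_conj hsymm hc'.le (fun x => ?_) hH⟩
    rw [inner_sum_outerProd]
    exact h x
  refine noTies_of_polynomial hm hlaw (Q := (QΦΦ QΨΨ ξ τ₀)⁻¹) (N := fun z => (B z).adjugate)
    hBc.matrix_adjugate (fun z₀ z a b => IsPolyFun.adjugate (isPolyFun_conj_apply _ _ z₀ z) a b)
    (fun g z => rfl) ?_ ?_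
  · filter_upwards [hlow] with ω hω g g' h
    obtain ⟨c', hc', h'⟩ := hcoer _ hω
    have hu := isUnit_det_of_le_norm_matOp hc' (norm_le_of_coercive h')
    rw [limitAR_of_subsingleton hτ, limitAR_of_subsingleton hτ, limitWeightCR, wnorm_inv_eq,
      wnorm_inv_eq] at h
    have hnn : ∀ v : Vec dφ, 0 ≤ ((B fun j => 𝒵 j τ₀ ω).det)⁻¹ * ((fun a => v a) ⬝ᵥ
        (B fun j => 𝒵 j τ₀ ω).adjugate.mulVec (fun a => v a)) := fun v => by
      rcases eq_or_ne v 0 with rfl | hv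
      · have : (fun a : Fin dφ => (0 : Vec dφ) a) = 0 := rfl
        rw [this, zero_dotProduct, mul_zero]
      · exact (inner_inv_pos hc' h' hv).le
    exact mul_left_cancel₀ (inv_ne_zero (isUnit_iff_ne_zero.1 hu))
      (eq_of_ofReal_sqrt_eq (hnn _) (hnn _) h)
  · intro g g' hg hg'
    obtain ⟨z, u, hu, hg1, hg2, hspan⟩ := exists_spanning_signed_sum hd hdJ hξ hg hg'
    refine ⟨z, ?_⟩
    rw [hg1, hg2, matApply_eq, matApply_eq, map_zero]
    have hv : matOp (QΦΦ QΨΨ ξ τ₀)⁻¹ u ≠ 0 := fun h0 => by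
      have h5 : matOp (QΦΦ QΨΨ ξ τ₀) (matOp (QΦΦ QΨΨ ξ τ₀)⁻¹ u) = u := by
        rw [← matOp_mul, Matrix.mul_nonsing_inv _ hQ, matOp_one]
      rw [h0, map_zero] at h5
      exact hu h5.symm
    obtain ⟨c', hc', h'⟩ := hcoer z (exists_coercive_of_injective hspan)
    have h6 := inner_inv_pos hc' h' hv
    have h0 : (fun a : Fin dφ => (0 : Vec dφ) a) = 0 := rfl
    rw [h0, zero_dotProduct]
    exact fun h7 => by rw [h7, mul_zero] at h6; exact lt_irrefl _ h6

end Ties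

/-! ### The limit law of the two statistics -/

section LimitLaws

variable {d J : ℕ}

lemma continuous_matApply_sum (w : Fin J → ℝ) : Continuous fun p : (Fin J → Vec d) ×
    Matrix (Fin d) (Fin d) ℝ × Matrix (Fin d) (Fin d) ℝ =>
      (fun a => matApply p.2.1 (∑ j, w j • p.1 j) a) := by
  simp only [matApply]
  fun_prop

lemma continuous_conj_sum_outerProd (w : Fin J → ℝ) : Continuous fun p : (Fin J → Vec d) ×
    Matrix (Fin d) (Fin d) ℝ × Matrix (Fin d) (Fin d) ℝ =>
      p.2.2 * (∑ j, w j • outerProd (p.1 j)) * p.2.2 := by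
  have : ∀ j, Continuous fun p : (Fin J → Vec d) × Matrix (Fin d) (Fin d) ℝ ×
      Matrix (Fin d) (Fin d) ℝ => outerProd (p.1 j) := fun j => by
    refine continuous_matrix fun a b => ?_
    simp only [outerProd, Matrix.vecMulVec_apply]
    fun_prop
  fun_prop

end LimitLaws

/-! ### Invariance of the limit statistics and invertibility of the limit covariance -/

namespace IVQR

variable {Ω : Type*} {J dw dz dφ : ℕ} {Υ : Set ℝ} {M : IVQR Ω J dw dz dφ Υ}
  {QΨΨ : Fin J → Υ → Matrix (Fin dw ⊕ Fin dφ) (Fin dw ⊕ Fin dφ) ℝ}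
  {ξ : Fin J → ℝ} {𝒵 : Fin J → Υ → Ω → Vec dφ}
  [MeasurableSpace Ω] {μ : Measure Ω} {𝓑 : Set ℝ} {𝓡 : Set (Vec dw)} {𝓣 : Set (Vec dφ)}
  {fε : ℕ → Fin J → ℕ → Υ → ℝ → Vec dw × Vec dz → ℝ} {QΨX : Fin J → Υ → StackVec dw dφ}

lemma BootstrapAssumption.exists_invariant_deterministicWeight [IsProbabilityMeasure μ]
    (hboot : M.BootstrapAssumption μ QΨΨ 𝒵) (A : Υ → Matrix (Fin dφ) (Fin dφ) ℝ) :
    ∃ T' : Ω → Signs J → ℝ≥0∞, Measurable T' ∧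
      (∀ᵐ ω ∂μ, limitAR QΨΨ ξ 𝒵 (fun _ => A) ω = T' ω) ∧
      ∀ h : Signs J, μ.map (fun ω g => T' ω (h * g)) = μ.map T' := by
  set f : (Fin J → Vec dφ) × Matrix (Fin dφ) (Fin dφ) ℝ × Matrix (Fin dφ) (Fin dφ) ℝ → ℝ≥0∞ :=
    fun p => ENNReal.ofReal (wnorm p.2.2 (matApply p.2.1 (∑ j, ξ j • p.1 j))) with hf
  have hfc : Continuous f := by
    refine ENNReal.continuous_ofReal.comp (Real.continuous_sqrt.comp ?_)
    have h1 := continuous_matApply_sum (d := dφ) ξ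
    exact Continuous.dotProduct h1 ((continuous_snd.comp continuous_snd).matrix_mulVec h1)
  refine exists_measurable_invariant hboot.tight hboot.gaussian hboot.measurable hboot.centered
    hboot.indep (fun τ => ((QΦΦ QΨΨ ξ τ)⁻¹, A τ)) (f := f)
    (fun x => (hfc.comp (by fun_prop)).measurable)
    (Eventually.of_forall fun ω τ g => hfc.continuousAt) fun ω g => ?_
  simp only [limitAR, supNorm, hf, smul_smul]

lemma BootstrapAssumption.exists_invariant_clusterRobust [IsProbabilityMeasure μ]
    (hboot : M.BootstrapAssumption μ QΨΨ 𝒵) {H : Υ → Matrix (Fin dφ) (Fin dφ) ℝ}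
    (hdet : ∀ᵐ ω ∂μ, ∀ τ, (H τ * limitCRVE ξ 𝒵 ω τ * H τ).det ≠ 0) :
    ∃ T' : Ω → Signs J → ℝ≥0∞, Measurable T' ∧
      (∀ᵐ ω ∂μ, limitAR QΨΨ ξ 𝒵 (limitWeightCR ξ 𝒵 H) ω = T' ω) ∧
      ∀ h : Signs J, μ.map (fun ω g => T' ω (h * g)) = μ.map T' := by
  set B : (Fin J → Vec dφ) × Matrix (Fin dφ) (Fin dφ) ℝ × Matrix (Fin dφ) (Fin dφ) ℝ →
    Matrix (Fin dφ) (Fin dφ) ℝ := fun p => p.2.2 * (∑ j, ξ j ^ 2 • outerProd (p.1 j)) * p.2.2 with hB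
  set v : (Fin J → Vec dφ) × Matrix (Fin dφ) (Fin dφ) ℝ × Matrix (Fin dφ) (Fin dφ) ℝ →
    Vec dφ := fun p => matApply p.2.1 (∑ j, ξ j • p.1 j) with hv
  set f : (Fin J → Vec dφ) × Matrix (Fin dφ) (Fin dφ) ℝ × Matrix (Fin dφ) (Fin dφ) ℝ → ℝ≥0∞ :=
    fun p => ENNReal.ofReal (wnorm (B p)⁻¹ (v p)) with hf
  have hBc : Continuous B := continuous_conj_sum_outerProd _
  have hvc : Continuous fun p a => v p a := continuous_matApply_sum ξ
  have hdc : Continuous fun p => (B p).det := hBc.matrix_det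
  have hqc : Continuous fun p => (fun a => v p a) ⬝ᵥ (B p).adjugate.mulVec (fun a => v p a) :=
    Continuous.dotProduct hvc (hBc.matrix_adjugate.matrix_mulVec hvc)
  have hfe : f = fun p => ENNReal.ofReal √((B p).det⁻¹ *
      ((fun a => v p a) ⬝ᵥ (B p).adjugate.mulVec (fun a => v p a))) := by
    ext p; rw [hf]; simp only [wnorm_inv_eq]
  -- Outer products ignore signs, so the random weight is the same for all `g` and the statistic is
  -- one fixed functional of the signed processes.
  have hBs : ∀ ω τ (g : Signs J), B (fun j => sgn g j • 𝒵 j τ ω, (QΦΦ QΨΨ ξ τ)⁻¹, H τ)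
      = H τ * limitCRVE ξ 𝒵 ω τ * H τ := fun ω τ g => by
    simp only [hB, outerProd_sgn_smul, limitCRVE]
  refine exists_measurable_invariant hboot.tight hboot.gaussian hboot.measurable hboot.centered
    hboot.indep (fun τ => ((QΦΦ QΨΨ ξ τ)⁻¹, H τ)) (f := f) (fun x => ?_) ?_ fun ω g => ?_
  · rw [hfe]
    have h1 : Measurable fun z => (B (z, x)).det := (hdc.comp (by fun_prop)).measurable
    have h2 : Measurable fun z => (fun a => v (z, x) a) ⬝ᵥ
      (B (z, x)).adjugate.mulVec (fun a => v (z, x) a) := (hqc.comp (by fun_prop)).measurable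
    exact ENNReal.measurable_ofReal.comp (Real.continuous_sqrt.measurable.comp (h1.inv.mul h2))
  · filter_upwards [hdet] with ω hω τ g
    rw [hfe]
    refine ENNReal.continuous_ofReal.continuousAt.comp
      (Real.continuous_sqrt.continuousAt.comp ?_)
    refine (hdc.continuousAt.inv₀ ?_).mul hqc.continuousAt
    rw [hBs]
    exact hω τ
  · simp only [limitAR, supNorm, hf, hBs, limitWeightCR, hv, smul_smul]

lemma AsymptoticAssumption.isUnit_det_QΦΦ (hasym : M.AsymptoticAssumption μ 𝓑 𝓡 𝓣 fε QΨΨ QΨX ξ)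
    (τ : Υ) : IsUnit (QΦΦ QΨΨ ξ τ).det := by
  obtain ⟨c, C, hc, h⟩ := hasym.eigenvalues
  exact isUnit_det_of_le_norm_matOp hc (norm_le_of_coercive (coercive_QΦΦ h τ))

lemma BootstrapAssumption.map_absolutelyContinuous [IsProbabilityMeasure μ]
    (hboot : M.BootstrapAssumption μ QΨΨ 𝒵) (τ : Υ) :
    μ.map (fun ω j => 𝒵 j τ ω) ≪ (volume : Measure (Fin J → Vec dφ)) := by
  obtain ⟨c, C, hc, h⟩ := hboot.covariance
  exact map_absolutelyContinuous_volume (fun j => hboot.measurable j τ)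
    (fun j => (hboot.gaussian j).hasGaussianLaw_eval τ) (fun j => hboot.centered j τ)
    (hboot.indep.comp (fun _ z => z τ) fun _ => measurable_pi_apply τ) hc fun j => h j τ

lemma BootstrapAssumption.ae_coercive [IsProbabilityMeasure μ] (hd : 0 < dφ) (hdJ : dφ < J)
    (hξ : ∀ j, 0 < ξ j) (hboot : M.BootstrapAssumption μ QΨΨ 𝒵) (τ : Υ) :
    ∀ᵐ ω ∂μ, ∃ c : ℝ, 0 < c ∧ ∀ x : Vec dφ,
      c * ‖x‖ ^ 2 ≤ ∑ j, (ξ j * inner ℝ (𝒵 j τ ω) x) ^ 2 := by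
  set F : (Fin J → Vec dφ) → ℝ := fun z =>
    ((1 : Matrix (Fin dφ) (Fin dφ) ℝ) * (∑ j, ξ j ^ 2 • outerProd (z j)) * 1).det with hF
  -- The partition is immaterial here: only the spanning property is used, to exhibit a point where
  -- the determinant is nonzero.
  obtain ⟨a, u, -, -, -, ha⟩ := exists_spanning_of_partition (J := J) hd hdJ
    (D := {⟨0, by omega⟩}) (j₁ := ⟨0, by omega⟩) (j₂ := ⟨1, by omega⟩) (by simp)
    (by rw [Finset.mem_singleton, Fin.mk.injEq]; exact one_ne_zero)
  have h0 : F a ≠ 0 := by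
    obtain ⟨c, hc, h⟩ := exists_coercive_of_injective (z := a) (ξ := ξ) fun x hx => ha x fun j =>
      (mul_eq_zero.1 (hx j)).resolve_left (hξ j).ne'
    rw [hF]
    simp only [one_mul, mul_one]
    refine isUnit_iff_ne_zero.1 (isUnit_det_of_le_norm_matOp hc (norm_le_of_coercive fun x => ?_))
    rw [inner_sum_outerProd]
    exact h x
  have hFc : Continuous F := ((continuous_conj_sum_outerProd fun j => ξ j ^ 2).comp
    (by fun_prop : Continuous fun z : Fin J → Vec dφ =>
      (z, (1 : Matrix (Fin dφ) (Fin dφ) ℝ), (1 : Matrix (Fin dφ) (Fin dφ) ℝ)))).matrix_det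
  filter_upwards [ae_ne_zero_of_polynomial (fun j => hboot.measurable j τ)
    (hboot.map_absolutelyContinuous τ) hFc.measurable h0 fun z =>
      IsPolyFun.det (isPolyFun_conj_apply _ _ a z)] with ω hω
  refine exists_coercive_of_det_ne_zero ?_
  simpa only [hF, one_mul, mul_one] using hω

/-- For finitely many quantiles the pointwise constants have a positive minimum; for infinitely many
the uniform bound is the hypothesis `hinf`. -/
lemma BootstrapAssumption.ae_uniformly_coercive [IsProbabilityMeasure μ] (hd : 0 < dφ)
    (hdJ : dφ < J) (hξ : ∀ j, 0 < ξ j) (hboot : M.BootstrapAssumption μ QΨΨ 𝒵)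
    (hne : Υ.Nonempty)
    (hinf : Υ.Infinite → ∀ᵐ ω ∂μ, ∃ c : ℝ, 0 < c ∧ ∀ (τ : Υ) (x : Fin dφ → ℝ),
      c * (x ⬝ᵥ x) ≤ x ⬝ᵥ (limitCRVE ξ 𝒵 ω τ).mulVec x) :
    ∀ᵐ ω ∂μ, ∃ c : ℝ, 0 < c ∧ ∀ (τ : Υ) (x : Vec dφ),
      c * ‖x‖ ^ 2 ≤ ∑ j, (ξ j * inner ℝ (𝒵 j τ ω) x) ^ 2 := by
  rcases Υ.finite_or_infinite with hfin | hinfinite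
  · have := hfin.to_subtype
    have := hne.to_subtype
    filter_upwards [ae_all_iff.2 (hboot.ae_coercive hd hdJ hξ)] with ω hω
    choose c hc h using hω
    obtain ⟨τ₀, hτ₀⟩ := Finite.exists_min c
    refine ⟨c τ₀, hc τ₀, fun τ x => le_trans ?_ (h τ x)⟩
    exact mul_le_mul_of_nonneg_right (hτ₀ τ) (sq_nonneg _)
  · filter_upwards [hinf hinfinite] with ω ⟨c, hc, h⟩
    refine ⟨c, hc, fun τ x => ?_⟩
    rw [← inner_limitCRVE, Matrix.inner_toEuclideanCLM, ← real_inner_self_eq_norm_sq,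
      EuclideanSpace.inner_eq_star_dotProduct, star_trivial]
    exact h τ _

/-! ### Asymptotic size -/

theorem rejects_bounds [IsProbabilityMeasure μ]
    {est : ℕ → Ω → ℝ → Υ → StackVec dw dφ} {boot : ℕ → Ω → Signs J → ℝ → Υ → StackVec dw dφ}
    (hM : M.Setup μ) (hmodel : M.ModelAssumption μ 𝓑 𝓡 𝓣)
    (hasym : M.AsymptoticAssumption μ 𝓑 𝓡 𝓣 fε QΨΨ QΨX ξ)
    (hboot : M.BootstrapAssumption μ QΨΨ 𝒵) (hnull : ∀ n τ, M.βn n τ = M.β₀ τ)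
    (hest : M.IsEstimator est) (hbootest : M.IsBootEstimator est boot)
    {α : ℝ} (hα : α ∈ Ioo (0 : ℝ) 1)
    {Ahat : ℕ → Ω → Υ → Matrix (Fin dφ) (Fin dφ) ℝ} {A : Ω → Υ → Matrix (Fin dφ) (Fin dφ) ℝ}
    {s : ℕ → ℝ} (hs : ∀ᶠ n in atTop, 0 < s n)
    (hA : ∀ e : ℝ, 0 < e →
      WithHighProb μ (fun n ω => ∀ τ : Υ, ‖(s n)⁻¹ • Ahat n ω τ - A ω τ‖ ≤ e))
    (hAb : ∀ η : ℝ≥0∞, 0 < η → ∃ C : ℝ, μ {ω | ¬ ∀ τ : Υ, ‖A ω τ‖ ≤ C} ≤ η)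
    (hT : ∃ T' : Ω → Signs J → ℝ≥0∞, Measurable T' ∧ (∀ᵐ ω ∂μ, limitAR QΨΨ ξ 𝒵 A ω = T' ω) ∧
      ∀ h : Signs J, μ.map (fun ω g => T' ω (h * g)) = μ.map T')
    (hties : NoTies μ (limitAR QΨΨ ξ 𝒵 A)) :
    α - 1 / 2 ^ (J - 1) ≤ liminf (fun n => μ.real (M.rejects est boot Ahat α n)) atTop ∧
    liminf (fun n => μ.real (M.rejects est boot Ahat α n)) atTop ≤
      limsup (fun n => μ.real (M.rejects est boot Ahat α n)) atTop ∧
    limsup (fun n => μ.real (M.rejects est boot Ahat α n)) atTop ≤ α + 1 / 2 ^ (J - 1) := by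
  obtain ⟨T', hT'm, hTT', hinv⟩ := hT
  -- Without clusters the sizes could not add up to a sample of size one.
  have hJ : 1 ≤ J := by
    by_contra hJ
    obtain rfl : J = 0 := by omega
    simpa using hM.total 1
  refine randomization_test hT'm hTT' hinv hties hJ hα (S := M.ARboot est boot Ahat)
    (s := M.AR est Ahat) (κ := fun n => ENNReal.ofReal (M.r n / √(s n))) ?_ fun ε hε =>
      withHighProb_limitAR hM hmodel hasym hboot hnull hest hbootest hs hA hAb hε
  filter_upwards [hs] with n hn
  refine ⟨?_, ENNReal.ofReal_ne_top⟩
  have := div_pos (hM.r_pos n) (Real.sqrt_pos.2 hn)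
  simpa using this

lemma subsingleton_of_not_nontrivial (h : ¬ Υ.Nontrivial) (τ₀ τ : Υ) : τ = τ₀ :=
  Subtype.ext (Set.not_nontrivial_iff.1 h τ.2 τ₀.2)

end IVQR

theorem theorem4 {Ω : Type*} [MeasurableSpace Ω] (μ : Measure Ω) [IsProbabilityMeasure μ]
    {J dw dz dφ : ℕ} (hdφ : 0 < dφ) {Υ : Set ℝ}
    (M : IVQR Ω J dw dz dφ Υ)
    (𝓑 : Set ℝ) (𝓡 : Set (Vec dw)) (𝓣 : Set (Vec dφ))
    (fε : ℕ → Fin J → ℕ → Υ → ℝ → Vec dw × Vec dz → ℝ)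
    (QΨΨ : Fin J → Υ → Matrix (Fin dw ⊕ Fin dφ) (Fin dw ⊕ Fin dφ) ℝ)
    (QΨX : Fin J → Υ → StackVec dw dφ) (ξ : Fin J → ℝ)
    (𝒵 : Fin J → Υ → Ω → Vec dφ)
    (est : ℕ → Ω → ℝ → Υ → StackVec dw dφ)
    (boot : ℕ → Ω → Signs J → ℝ → Υ → StackVec dw dφ)
    (hsetup : M.Setup μ)
    (hmodel : M.ModelAssumption μ 𝓑 𝓡 𝓣)
    (hasym : M.AsymptoticAssumption μ 𝓑 𝓡 𝓣 fε QΨΨ QΨX ξ)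
    (hboot : M.BootstrapAssumption μ QΨΨ 𝒵)
    (hnull : ∀ n τ, M.βn n τ = M.β₀ τ)
    (hest : M.IsEstimator est) (hbootest : M.IsBootEstimator est boot)
    (α : ℝ) (hα : α ∈ Ioo (0 : ℝ) 1) :
    (∀ (A3hat : ℕ → Ω → Υ → Matrix (Fin dφ) (Fin dφ) ℝ) (A3 : Υ → Matrix (Fin dφ) (Fin dφ) ℝ),
      IVQR.DeterministicWeight μ A3hat A3 →
      (Υ.Nontrivial → NoTies μ (limitAR QΨΨ ξ 𝒵 (fun _ => A3))) →
      α - 1 / 2 ^ (J - 1) ≤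
        liminf (fun n => μ.real (M.rejects est boot A3hat α n)) atTop ∧
      liminf (fun n => μ.real (M.rejects est boot A3hat α n)) atTop ≤
        limsup (fun n => μ.real (M.rejects est boot A3hat α n)) atTop ∧
      limsup (fun n => μ.real (M.rejects est boot A3hat α n)) atTop ≤ α + 1 / 2 ^ (J - 1)) ∧
    (∀ (Hhat : ℕ → Ω → Υ → Matrix (Fin dφ) (Fin dφ) ℝ) (H : Υ → Matrix (Fin dφ) (Fin dφ) ℝ),
      IVQR.ClusterRobustWeight (J := J) μ Hhat H →
      (Υ.Infinite → ∀ᵐ ω ∂μ, ∃ c : ℝ, 0 < c ∧ ∀ (τ : Υ) (x : Fin dφ → ℝ),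
        c * (x ⬝ᵥ x) ≤ x ⬝ᵥ (limitCRVE ξ 𝒵 ω τ).mulVec x) →
      (Υ.Nontrivial → NoTies μ (limitAR QΨΨ ξ 𝒵 (limitWeightCR ξ 𝒵 H))) →
      α - 1 / 2 ^ (J - 1) ≤
        liminf (fun n => μ.real (M.rejects est boot (M.weightCR est Hhat) α n)) atTop ∧
      liminf (fun n => μ.real (M.rejects est boot (M.weightCR est Hhat) α n)) atTop ≤
        limsup (fun n => μ.real (M.rejects est boot (M.weightCR est Hhat) α n)) atTop ∧
      limsup (fun n => μ.real (M.rejects est boot (M.weightCR est Hhat) α n)) atTop ≤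
        α + 1 / 2 ^ (J - 1)) := by

  have hne := hsetup.nonempty
  obtain ⟨τ₀⟩ := hne.to_subtype
  refine ⟨fun A3hat A3 hA3 hties => ?_, fun Hhat H hH hinf hties => ?_⟩
  · obtain ⟨c, C, hc, hbd⟩ := hA3.eigenvalues
    refine IVQR.rejects_bounds hsetup hmodel hasym hboot hnull hest hbootest hα (s := fun _ => 1)
      (A := fun _ => A3) (Eventually.of_forall fun _ => one_pos) (fun e he => ?_)
      (fun η _ => ⟨|C|, ?_⟩) (hboot.exists_invariant_deterministicWeight A3) ?_
    · simpa only [inv_one, one_smul] using hA3.consistent.withHighProb he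
    · have : {ω : Ω | ¬ ∀ τ, ‖A3 τ‖ ≤ |C|} = ∅ := by
        ext ω
        simpa using fun τ => (hbd τ).norm_le (hA3.symm τ) hc.le
      rw [this, measure_empty]
      exact zero_le
    -- Absence of ties is assumed for several quantiles and proved for a single one.
    · by_cases hnt : Υ.Nontrivial
      · exact hties hnt
      · exact noTies_deterministicWeight hdφ (IVQR.subsingleton_of_not_nontrivial hnt τ₀)
          (fun j => hboot.measurable j τ₀) (hboot.map_absolutelyContinuous τ₀) hasym.ξ_pos
          (hasym.isUnit_det_QΦΦ τ₀) hc fun x => (rayleighBounds_iff.1 (hbd τ₀) x).1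
  · have hlow := hboot.ae_uniformly_coercive hdφ hH.clusters hasym.ξ_pos hne hinf
    obtain ⟨c, C, hc, -, hHb⟩ := hH.bounds
    have hlowP : ∀ η : ℝ≥0∞, 0 < η → ∃ c : ℝ, 0 < c ∧ μ {ω | ¬ ∀ (τ : Υ) (x : Vec dφ),
        c * ‖x‖ ^ 2 ≤ inner ℝ x (matOp (limitCRVE ξ 𝒵 ω τ) x)} ≤ η := fun η hη => by
      simp_rw [IVQR.inner_limitCRVE]
      exact exists_lower_bound_of_ae hboot.tight hboot.measurable ξ hlow hη
    -- Cluster sums of scores are of order `n / r_n`, so `n⁻¹` times their outer products is of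
    -- order `n / r_n ^ 2`; this fixes the normalization of the inverse weight.
    refine IVQR.rejects_bounds hsetup hmodel hasym hboot hnull hest hbootest hα
      (s := fun n => M.r n ^ 2 / n) (A := limitWeightCR ξ 𝒵 H) ?_
      (fun e he => IVQR.withHighProb_weightCR hsetup hmodel hasym hboot hnull hest hbootest hH
        hlowP he) (fun η hη => ?_) (hboot.exists_invariant_clusterRobust ?_) ?_
    · filter_upwards [eventually_gt_atTop 0] with n hn
      have := hsetup.r_pos n
      positivity
    · obtain ⟨c', hc', h⟩ := hlowP η hη
      refine ⟨1 / (c' * c), le_trans (measure_mono ?_) h⟩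
      intro ω hω h'
      exact hω fun τ => IVQR.norm_limitWeightCR_le (hH.limit_isSymm τ) hc hc' (hHb τ).2 (h' τ)
    · filter_upwards [hlow] with ω ⟨c', hc', h⟩ τ
      refine isUnit_iff_ne_zero.1 (isUnit_det_of_le_norm_matOp (mul_pos hc' hc)
        (norm_le_of_coercive (coercive_conj (hH.limit_isSymm τ) hc'.le (fun x => ?_) (hHb τ).2)))
      rw [IVQR.inner_limitCRVE]
      exact h τ x
    · by_cases hnt : Υ.Nontrivial
      · exact hties hnt
      · refine noTies_clusterRobust hdφ hH.clusters (IVQR.subsingleton_of_not_nontrivial hnt τ₀)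
          (fun j => hboot.measurable j τ₀) (hboot.map_absolutelyContinuous τ₀) hasym.ξ_pos
          (hasym.isUnit_det_QΦΦ τ₀) (hH.limit_isSymm τ₀) hc (hHb τ₀).2 ?_
        filter_upwards [hlow] with ω ⟨c', hc', h⟩
        exact ⟨c', hc', h τ₀⟩
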